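/- Let $\mathbb T=([0,\infty],\min,+)$ be the tropical semiring (zero element $\infty$, unit $0$) and let $s$ be a polynomial over $\mathbb T$ in $n\ge 1$ variables, with support $\mathrm{supp}(s)\subseteq\mathbb N^n$. Let $NP(s)\subseteq\mathbb R^n$ be the convex hull of $\mathrm{supp}(s)$, let $V_{\min}(s)$ be the set of those vertices of $NP(s)$ that are minimal among the vertices of $NP(s)$ for the coordinatewise order, and put $s_{\min}:=\sum_{\mu\in V_{\min}(s)}x^\mu$ (all coefficients equal to the unit). Call $s$ minimal if $s=s_{\min}$. A minimal polynomial is represented by the list, in any order and without repetition, of the exponent vectors of its monomials. Time is counted on a random access machine that computes with integers, at unit cost per addition, subtraction, multiplication, comparison, direct or indirect memory access, and fair coin toss. (1) There are an algorithm $\mathbf{VN}$ and an absolute constant $C$ such that the following holds for all integers $n\ge1$, $k\ge 2$, $d\ge 2$ and all minimal tropical polynomials $s_1,\dots,s_k$ in $n$ variables of degree at most $d$, given to $\mathbf{VN}$ as input (together with $n$ and $k$). - If $n\le k$, then $\mathbf{VN}$ computes $\bigl(\prod_{i=1}^k s_i\bigr)_{\min}$ as a randomised algorithm whose output is correct whenever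 it halts and whose expected running time is at most $C\,n\,d^{\,k(2n-1)\max\{2,n\}}$. - If $n>k$, then $\mathbf{VN}$ computes $\bigl(\prod_{i=1}^k s_i\bigr)_{\min}$ deterministically (without tossing a coin) in time at most $C\,(1+k)\,d^{\,k(2n-1)}$. (2) There is an absolute constant $C'$ such that for all $n\ge1$, $k\ge2$, $d\ge1$ and all minimal tropical polynomials $s_1,\dots,s_k$ in $n$ variables of degree at most $d$, the polynomial $\bigl(\prod_{i=1}^k s_i\bigr)_{\min}$ has at most $C'(kd)^{2n-1}$ monomials. -/

import Mathlib

open MeasureTheory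
open scoped ENNReal

namespace TropVN

/-! ### Tropical polynomials and the minimal Newton polytope -/

/-- The tropical semiring on `[0, ∞]`: addition is `min`, with neutral element `∞`;
multiplication is `+`, with neutral element `0`. -/
abbrev Trop : Type := Tropical ℝ≥0∞

/-- Formal tropical polynomials in `n` variables. -/
abbrev TPoly (n : ℕ) : Type := MvPolynomial (Fin n) Trop

/-- An exponent vector, as a point of `ℝⁿ`. -/
def toPoint {n : ℕ} (μ : Fin n →₀ ℕ) : Fin n → ℝ := fun i => (μ i : ℝ)

/-- The Newton polytope: the convex hull of the support. -/
def newtonPolytope {n : ℕ} (s : TPoly n) : Set (Fin n → ℝ) :=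
  convexHull ℝ (toPoint '' (s.support : Set (Fin n →₀ ℕ)))

/-- The exponent vectors that are vertices (extreme points) of the Newton polytope. -/
def vertNP {n : ℕ} (s : TPoly n) : Set (Fin n →₀ ℕ) :=
  {μ | toPoint μ ∈ (newtonPolytope s).extremePoints ℝ}

/-- The vertices of the minimal Newton polytope: the elements of `vertNP s` that are minimal
in `vertNP s` for the pointwise order. -/
def vertNPmin {n : ℕ} (s : TPoly n) : Set (Fin n →₀ ℕ) :=
  {μ | Minimal (fun ν => ν ∈ vertNP s) μ}

theorem toPoint_injective {n : ℕ} : Function.Injective (toPoint (n := n)) := by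
  intro μ ν h
  ext i
  have := congrFun h i
  simpa [toPoint] using this

theorem vertNP_subset_support {n : ℕ} (s : TPoly n) :
    vertNP s ⊆ (s.support : Set (Fin n →₀ ℕ)) := by
  intro μ hμ
  obtain ⟨ν, hν, h⟩ := extremePoints_convexHull_subset hμ
  exact toPoint_injective h ▸ hν

open Classical in
/-- `s_min`, the sum of the monomials (with coefficient `1`) that are vertices of the minimal
Newton polytope of `s`; all of these lie in the support of `s` (`vertNP_subset_support`). -/
noncomputable def minPoly {n : ℕ} (s : TPoly n) : TPoly n :=
  ∑ μ ∈ s.support.filter (fun μ => μ ∈ vertNPmin s), MvPolynomial.monomial μ 1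

/-- `s` is minimal when `s = s_min`. -/
def IsMinimalPoly {n : ℕ} (s : TPoly n) : Prop := s = minPoly s

/-! ### The machine model: a randomised unit-cost random access machine

Programs are structured; they use finitely many integer registers and finitely many
integer arrays. Every executed basic instruction and every executed test costs one step. -/

/-- Arithmetic operations on integers. -/
inductive ArithOp
  | add
  | sub
  | mul

/-- The value of an arithmetic operation. -/
def ArithOp.eval : ArithOp → ℤ → ℤ → ℤ
  | .add, a, b => a + b
  | .sub, a, b => a - b
  | .mul, a, b => a * b

/-- Programs. Registers and arrays are named by natural numbers. -/
inductive Prog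
  /-- do nothing -/
  | skip
  /-- `R x := c` -/
  | const (x : ℕ) (c : ℤ)
  /-- `R x := R y op R z` -/
  | arith (o : ArithOp) (x y z : ℕ)
  /-- `R x := A a [R y]` -/
  | load (x a y : ℕ)
  /-- `A a [R x] := R y` -/
  | store (a x y : ℕ)
  /-- `R x :=` a fresh fair random bit -/
  | flip (x : ℕ)
  /-- `p ; q` -/
  | seq (p q : Prog)
  /-- `if R x ≤ R y then p else q` -/
  | cond (x y : ℕ) (p q : Prog)
  /-- `while R x ≤ R y do p` -/
  | loop (x y : ℕ) (p : Prog)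

/-- Machine states: the registers, the arrays (cells of an array are indexed by `ℕ`) and the
number of random bits consumed so far. -/
structure State where
  reg : ℕ → ℤ
  arr : ℕ → ℕ → ℤ
  used : ℕ

/-- Write `v` into register `x`. -/
def State.setReg (σ : State) (x : ℕ) (v : ℤ) : State :=
  { σ with reg := Function.update σ.reg x v }

/-- Write `v` into cell `j` of array `a`. -/
def State.setArr (σ : State) (a j : ℕ) (v : ℤ) : State :=
  { σ with arr := Function.update σ.arr a (Function.update (σ.arr a) j v) }

/-- `Exec ω p σ τ t`: with the random bits `ω`, the program `p` started in state `σ` halts in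
state `τ` after exactly `t` steps. (A negative address is read as address `0`.) -/
inductive Exec (ω : ℕ → Bool) : Prog → State → State → ℕ → Prop
  | skip (σ : State) : Exec ω .skip σ σ 1
  | const (x : ℕ) (c : ℤ) (σ : State) : Exec ω (.const x c) σ (σ.setReg x c) 1
  | arith (o : ArithOp) (x y z : ℕ) (σ : State) :
      Exec ω (.arith o x y z) σ (σ.setReg x (o.eval (σ.reg y) (σ.reg z))) 1
  | load (x a y : ℕ) (σ : State) :
      Exec ω (.load x a y) σ (σ.setReg x (σ.arr a (σ.reg y).toNat)) 1
  | store (a x y : ℕ) (σ : State) :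
      Exec ω (.store a x y) σ (σ.setArr a (σ.reg x).toNat (σ.reg y)) 1
  | flip (x : ℕ) (σ : State) :
      Exec ω (.flip x) σ
        { σ.setReg x (if ω σ.used then 1 else 0) with used := σ.used + 1 } 1
  | seq {p q : Prog} {σ σ' τ : State} {t u : ℕ} :
      Exec ω p σ σ' t → Exec ω q σ' τ u → Exec ω (.seq p q) σ τ (t + u)
  | cond_true {x y : ℕ} {p q : Prog} {σ τ : State} {t : ℕ} :
      σ.reg x ≤ σ.reg y → Exec ω p σ τ t → Exec ω (.cond x y p q) σ τ (t + 1)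
  | cond_false {x y : ℕ} {p q : Prog} {σ τ : State} {t : ℕ} :
      ¬ σ.reg x ≤ σ.reg y → Exec ω q σ τ t → Exec ω (.cond x y p q) σ τ (t + 1)
  | loop_exit {x y : ℕ} {p : Prog} {σ : State} :
      ¬ σ.reg x ≤ σ.reg y → Exec ω (.loop x y p) σ σ 1
  | loop_step {x y : ℕ} {p : Prog} {σ σ' τ : State} {t u : ℕ} :
      σ.reg x ≤ σ.reg y → Exec ω p σ σ' t → Exec ω (.loop x y p) σ' τ u →
        Exec ω (.loop x y p) σ τ (t + u + 1)

/-- The number of steps before halting; `∞` if the program does not halt. -/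
noncomputable def runTime (p : Prog) (σ : State) (ω : ℕ → Bool) : ℝ≥0∞ :=
  ⨅ (t : ℕ) (_ : ∃ τ, Exec ω p σ τ t), (t : ℝ≥0∞)

/-- The law of a sequence of independent fair random bits. -/
noncomputable def fairCoins : Measure (ℕ → Bool) :=
  Measure.infinitePi (fun _ : ℕ => (PMF.uniformOfFintype Bool).toMeasure)

/-- The expected number of steps. -/
noncomputable def expectedTime (p : Prog) (σ : State) : ℝ≥0∞ :=
  ∫⁻ ω, runTime p σ ω ∂fairCoins

/-! ### Input and output -/

/-- `l` lists, without repetition and in some order, the monomials of the polynomial `s`, all of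
whose nonzero coefficients are `1`. -/
def IsListing {n : ℕ} (l : List (Fin n →₀ ℕ)) (s : TPoly n) : Prop :=
  l.Nodup ∧ s = (l.map fun μ => MvPolynomial.monomial μ (1 : Trop)).sum

/-- The exponent vectors of `l`, written out one after the other, as `l.length * n` integers. -/
def encode {n : ℕ} (l : List (Fin n →₀ ℕ)) : List ℤ :=
  l.flatMap fun μ => List.ofFn fun i => (μ i : ℤ)

/-- The initial state for the `k` lists of monomials `L 0, …, L (k-1)` in `n` variables:
register `0` holds `n`, register `1` holds `k`, array `0` holds the lengths of the lists,
array `1` holds all the exponent vectors; everything else is `0`. -/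
def inputState {n k : ℕ} (L : Fin k → List (Fin n →₀ ℕ)) : State where
  reg x := if x = 0 then (n : ℤ) else if x = 1 then (k : ℤ) else 0
  arr a j :=
    if a = 0 then (List.ofFn fun i => ((L i).length : ℤ)).getD j 0
    else if a = 1 then (encode (List.ofFn L).flatten).getD j 0
    else 0
  used := 0

/-- The state `τ` holds the polynomial `s` as output: register `0` holds the number of monomials
of `s`, and array `0` starts with their exponent vectors, in some order. -/
def IsOutput {n : ℕ} (τ : State) (s : TPoly n) : Prop :=
  ∃ l : List (Fin n →₀ ℕ), IsListing l s ∧ τ.reg 0 = (l.length : ℤ) ∧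
    ∀ j < l.length * n, τ.arr 0 j = (encode l).getD j 0

end TropVN

namespace TropVN

/-! ### Supports of tropical polynomials -/

/-! Nothing cancels in the tropical semiring, so the support of the product consists of all sums of
one exponent vector from each factor. The algorithm lists these sums by brute force, decides for
each of them whether it is a vertex of the Newton polytope of the product, and keeps one copy of
every vertex that has no other vertex below it. It never tosses a coin, so a single program serves
both ranges of `n` and `k`, and its expected time is at most its running time.

A point of the support is a vertex exactly if some linear functional is strictly smaller there than
on the rest of the support (`mem_vertNP_iff`). The resulting system of strict inequalities is
handled by the ellipsoid method. If the system is solvable, Cramer's rule yields an integer solution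
with entries at most `n! * D ^ n` (`exists_bounded_feasible`), where `D` bounds the exponents; hence
the normalised feasible region contains a ball of radius `2 ^ (-radiusExp n D)`. Every cut divides
the determinant of the ellipsoid by at least `1 + 1 / (32 * n)`, while the ball keeps it bounded
below, so a solvable system is solved within a number of cuts that is polynomial in `n` and `D`
(`EllipsoidInv.time_lt`). Since multiplication has unit cost, centre and matrix are stored exactly,
as integer numerators over a common denominator, and no rounding has to be analysed. The only
irrational quantity, a square root, is replaced by an upper bound that is at most twice too large;
the cut used here tolerates this (`inEllipsoid_cut`).

For the running time, the support of a minimal polynomial is an antichain and so is determined by `n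
- 1` of the coordinates. If `U` bounds the numbers of partial sums and `N` is the number of cuts,
the cost is of order `U² n N + (k + 1) U N²` (`mainCmd_cost_le`), and `D ≤ k * d`. For `n ≤ k` the
bound `(d + 1) ^ (n - 1)` for each list leaves a spare factor `d ^ (2 * k)`, which absorbs all
polynomial factors. For `n > k` the budget is only `d ^ (2 * k * (n - 1) + k)`; there a count with
geometric weights gives `16 * (2 * d / 3) ^ (n - 1)` (`antichain_card_le_sixteen`), and the powers
of `2 / 3` absorb the polynomials in `n`. The antichain bound for the product itself gives the bound
on the number of monomials, with constant `1`.

The program is written in a language with bounded loops, for which effect and cost are total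
functions. `Cmd.compile_runs` transfers both to the machine, so correctness and cost are statements
about ordinary functions. -/

theorem trop_add_eq_zero {a b : Trop} : a + b = 0 ↔ a = 0 ∧ b = 0 := by
  rw [← Tropical.untrop_inj_iff, Tropical.untrop_add, ← Tropical.untrop_inj_iff,
    ← Tropical.untrop_inj_iff (y := (0 : Trop))]
  simp [Tropical.untrop_zero]

theorem trop_sum_eq_zero {ι : Type*} (F : Finset ι) (f : ι → Trop) :
    ∑ i ∈ F, f i = 0 ↔ ∀ i ∈ F, f i = 0 := by
  classical
  induction F using Finset.induction_on with
  | empty => simp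
  | insert a F ha ih => rw [Finset.sum_insert ha, trop_add_eq_zero, ih]; simp

theorem trop_mul_eq_zero {a b : Trop} : a * b = 0 ↔ a = 0 ∨ b = 0 := by
  rw [← Tropical.untrop_inj_iff, Tropical.untrop_mul, ← Tropical.untrop_inj_iff,
    ← Tropical.untrop_inj_iff (y := (0 : Trop))]
  simp [Tropical.untrop_zero]

theorem trop_one_ne_zero : (1 : Trop) ≠ 0 := by
  rw [Ne, ← Tropical.untrop_inj_iff]
  simp [Tropical.untrop_zero, Tropical.untrop_one]

/-- A tropical sum is zero only if all its terms are, and a product only if a factor is. Hence no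
monomial disappears and supports add as sets, whatever the coefficients. -/
theorem mem_support_mul {n : ℕ} (p q : TPoly n) (μ : Fin n →₀ ℕ) :
    μ ∈ (p * q).support ↔ ∃ a ∈ p.support, ∃ b ∈ q.support, a + b = μ := by
  classical
  rw [MvPolynomial.mem_support_iff, MvPolynomial.coeff_mul, Ne, trop_sum_eq_zero]
  simp only [trop_mul_eq_zero, Prod.forall, MvPolynomial.mem_support_iff]
  push Not
  constructor
  · rintro ⟨a, b, h, ha, hb⟩
    exact ⟨a, ha, b, hb, Finset.HasAntidiagonal.mem_antidiagonal.1 h⟩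
  · rintro ⟨a, ha, b, hb, h⟩
    exact ⟨a, b, Finset.HasAntidiagonal.mem_antidiagonal.2 h, ha, hb⟩

theorem coeff_sum_monomial_one {n : ℕ} (F : Finset (Fin n →₀ ℕ)) (μ : Fin n →₀ ℕ)
    [Decidable (μ ∈ F)] :
    MvPolynomial.coeff μ (∑ ν ∈ F, MvPolynomial.monomial ν (1 : Trop)) = if μ ∈ F then 1 else 0 := by
  classical
  rw [MvPolynomial.coeff_sum]
  simp [MvPolynomial.coeff_monomial]

theorem support_sum_monomial_one {n : ℕ} (F : Finset (Fin n →₀ ℕ)) :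
    (∑ ν ∈ F, MvPolynomial.monomial ν (1 : Trop)).support = F := by
  classical
  ext μ
  rw [MvPolynomial.mem_support_iff, coeff_sum_monomial_one]
  by_cases h : μ ∈ F <;> simp [h, trop_one_ne_zero]

theorem IsListing.mem_iff {n : ℕ} {l : List (Fin n →₀ ℕ)} {s : TPoly n} (h : IsListing l s)
    (μ : Fin n →₀ ℕ) : μ ∈ l ↔ μ ∈ s.support := by
  classical
  rw [h.2, ← List.sum_toFinset _ h.1, support_sum_monomial_one, List.mem_toFinset]

theorem support_minPoly {n : ℕ} (s : TPoly n) (μ : Fin n →₀ ℕ) :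
    μ ∈ (minPoly s).support ↔ μ ∈ vertNPmin s := by
  classical
  rw [minPoly, support_sum_monomial_one, Finset.mem_filter]
  exact ⟨fun h => h.2, fun h => ⟨vertNP_subset_support s h.1, h⟩⟩

theorem isListing_minPoly {n : ℕ} (s : TPoly n) (l : List (Fin n →₀ ℕ)) (hl : l.Nodup)
    (h : ∀ μ, μ ∈ l ↔ μ ∈ vertNPmin s) : IsListing l (minPoly s) := by
  classical
  refine ⟨hl, ?_⟩
  rw [minPoly, ← List.sum_toFinset _ hl]
  refine Finset.sum_congr ?_ fun _ _ => rfl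
  ext μ
  rw [Finset.mem_filter, List.mem_toFinset, h]
  exact ⟨fun h => h.2, fun h => ⟨vertNP_subset_support s h.1, h⟩⟩

/-! ### Vertices and linear functionals -/

theorem linearMap_toPoint {n : ℕ} (f : (Fin n → ℝ) →L[ℝ] ℝ) :
    ∃ w : Fin n → ℝ, ∀ x, f x = ∑ i, w i * x i := by
  refine ⟨fun i => f (Pi.single i 1), fun x => ?_⟩
  have : x = ∑ i, x i • (Pi.single i 1 : Fin n → ℝ) := by
    ext j
    simp [Finset.sum_apply, Pi.single_apply]
  conv_lhs => rw [this]
  rw [map_sum]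
  refine Finset.sum_congr rfl fun i _ => ?_
  rw [map_smul, smul_eq_mul, mul_comm]

/-- A vertex lies outside the hull of the other support points, and this hull is compact, so the two
are strictly separated. This replaces a convexity condition by a finite system of strict linear
inequalities, which an algorithm can test. -/
theorem mem_vertNP_iff {n : ℕ} (s : TPoly n) (μ : Fin n →₀ ℕ) :
    μ ∈ vertNP s ↔ μ ∈ s.support ∧
      ∃ w : Fin n → ℝ, ∀ ν ∈ s.support, ν ≠ μ → 0 < ∑ i, w i * ((ν i : ℝ) - μ i) := by
  constructor
  · intro h
    refine ⟨vertNP_subset_support s h, ?_⟩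
    have h1 : toPoint μ ∈ (convexHull ℝ (toPoint '' (s.support : Set _))).extremePoints ℝ := h
    rw [(convex_convexHull ℝ _).mem_extremePoints_iff_mem_sdiff_convexHull_sdiff] at h1
    have h2 : toPoint μ ∉ convexHull ℝ (toPoint '' ((s.support : Set _) \ {μ})) := by
      intro h3
      refine h1.2 (convexHull_mono ?_ h3)
      rintro _ ⟨ν, hν, rfl⟩
      exact ⟨subset_convexHull ℝ _ ⟨ν, hν.1, rfl⟩, fun h4 => hν.2 (toPoint_injective h4)⟩
    have hfin : (toPoint '' ((s.support : Set (Fin n →₀ ℕ)) \ {μ})).Finite :=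
      (s.support.finite_toSet.subset Set.sdiff_subset).image _
    obtain ⟨f, u, hu, hf⟩ := geometric_hahn_banach_point_closed (convex_convexHull ℝ _)
      (hfin.isClosed_convexHull ℝ) h2
    obtain ⟨w, hw⟩ := linearMap_toPoint f
    refine ⟨w, fun ν hν hne => ?_⟩
    have h5 := hf (toPoint ν) (subset_convexHull ℝ _ ⟨ν, ⟨hν, hne⟩, rfl⟩)
    have h6 : f (toPoint ν) - f (toPoint μ) = ∑ i, w i * ((ν i : ℝ) - μ i) := by
      rw [hw, hw, ← Finset.sum_sub_distrib]
      refine Finset.sum_congr rfl fun i _ => ?_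
      simp only [toPoint]; ring
    rw [← h6]; linarith
  · rintro ⟨hμ, w, hw⟩
    set f : (Fin n → ℝ) → ℝ := fun x => ∑ i, w i * (x i - μ i) with hf
    have hfa : ∀ (a b : ℝ) (x y : Fin n → ℝ), a + b = 1 → f (a • x + b • y) = a * f x + b * f y := by
      intro a b x y hab
      simp only [hf, Finset.mul_sum, ← Finset.sum_add_distrib]
      refine Finset.sum_congr rfl fun i _ => ?_
      have : b = 1 - a := by linarith
      subst this
      simp only [Pi.add_apply, Pi.smul_apply, smul_eq_mul]; ring
    have hf0 : f (toPoint μ) = 0 := by simp [hf, toPoint]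
    -- An open half-space with one boundary point added is still convex. It contains the support,
    -- hence the polytope, and that boundary point is extreme in it.
    have hconv : Convex ℝ {x : Fin n → ℝ | x = toPoint μ ∨ 0 < f x} := by
      intro x hx y hy a b ha hb hab
      have hx0 : 0 ≤ f x := by
        rcases hx with rfl | h
        · exact hf0.ge
        · exact h.le
      have hy0 : 0 ≤ f y := by
        rcases hy with rfl | h
        · exact hf0.ge
        · exact h.le
      rcases ha.eq_or_lt with rfl | ha'
      · have : b = 1 := by linarith
        subst this; simpa using hy
      rcases hb.eq_or_lt with rfl | hb'
      · have : a = 1 := by linarith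
        subst this; simpa using hx
      rcases hx with rfl | hx
      · rcases hy with rfl | hy
        · left
          rw [← add_smul, hab, one_smul]
        · right
          rw [hfa a b _ _ hab]
          have := mul_pos hb' hy
          have := mul_nonneg ha hx0
          linarith
      · right
        rw [hfa a b _ _ hab]
        have := mul_pos ha' hx
        have := mul_nonneg hb hy0
        linarith
    have hsub : newtonPolytope s ⊆ {x : Fin n → ℝ | x = toPoint μ ∨ 0 < f x} := by
      refine convexHull_min ?_ hconv
      rintro _ ⟨ν, hν, rfl⟩
      by_cases h : ν = μ
      · exact Or.inl (h ▸ rfl)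
      · exact Or.inr (hw ν hν h)
    refine mem_extremePoints.2 ⟨subset_convexHull ℝ _ ⟨μ, hμ, rfl⟩, ?_⟩
    rintro x hx y hy ⟨a, b, ha, hb, hab, he⟩
    have h1 : a * f x + b * f y = 0 := by rw [← hfa a b _ _ hab, he, hf0]
    rcases hsub hx with hx | hx
    · rcases hsub hy with hy | hy
      · exact ⟨hx, hy⟩
      · rw [hx, hf0] at h1
        have := mul_pos hb hy
        linarith
    · have hy0 : 0 ≤ f y := by
        rcases hsub hy with rfl | h
        · exact hf0.ge
        · exact h.le
      have := mul_pos ha hx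
      have := mul_nonneg hb.le hy0
      linarith

/-! ### Sizes of antichains -/

theorem coe_le_totalDegree {n : ℕ} {s : TPoly n} {d : ℕ} (hd : s.totalDegree ≤ d)
    {μ : Fin n →₀ ℕ} (hμ : μ ∈ s.support) : ∑ i, μ i ≤ d := by
  have h := MvPolynomial.le_totalDegree hμ
  rw [Finsupp.sum_fintype _ _ (fun _ => rfl)] at h
  exact h.trans hd

/-- An antichain in `ℕᵐ⁺¹` is determined by the first `m` coordinates of its elements. -/
theorem antichain_init_injOn {m : ℕ} {F : Finset (Fin (m + 1) →₀ ℕ)}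
    (hF : ∀ μ ∈ F, ∀ ν ∈ F, μ ≤ ν → μ = ν) :
    Set.InjOn (fun (μ : Fin (m + 1) →₀ ℕ) (i : Fin m) => μ i.castSucc) F := by
  intro μ hμ ν hν h
  have h1 : ∀ i : Fin m, μ i.castSucc = ν i.castSucc := fun i => congrFun h i
  -- Two elements that differ at most in the last coordinate are comparable.
  rcases le_total (μ (Fin.last m)) (ν (Fin.last m)) with hl | hl
  · refine hF μ hμ ν hν fun i => ?_
    induction i using Fin.lastCases with
    | last => exact hl
    | cast i => exact (h1 i).le
  · refine (hF ν hν μ hμ fun i => ?_).symm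
    induction i using Fin.lastCases with
    | last => exact hl
    | cast i => exact (h1 i).ge

theorem antichain_card_le_pow {m d : ℕ} {F : Finset (Fin (m + 1) →₀ ℕ)}
    (hF : ∀ μ ∈ F, ∀ ν ∈ F, μ ≤ ν → μ = ν) (hd : ∀ μ ∈ F, ∑ i, μ i ≤ d) :
    F.card ≤ (d + 1) ^ m := by
  classical
  have h : F.card ≤ (Fintype.piFinset fun _ : Fin m => Finset.range (d + 1)).card := by
    refine Finset.card_le_card_of_injOn _ ?_ (antichain_init_injOn hF)
    intro μ hμ
    simp only [Finset.mem_coe, Fintype.mem_piFinset, Finset.mem_range]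
    intro i
    have := Finset.single_le_sum (f := fun i => μ i) (fun _ _ => Nat.zero_le _)
      (Finset.mem_univ i.castSucc)
    have h3 := hd μ hμ
    have h4 := this.trans h3
    exact Nat.lt_succ_of_le h4
  simpa [Fintype.card_piFinset] using h

/-- Weight a projected point `x` by `θ ^ (∑ x i)`, which is at least `θ ^ d`. Summed over a whole
box the weights factor into `m` truncated geometric series. -/
theorem antichain_card_mul_pow_le {m d : ℕ} {F : Finset (Fin (m + 1) →₀ ℕ)}
    (hF : ∀ μ ∈ F, ∀ ν ∈ F, μ ≤ ν → μ = ν) (hd : ∀ μ ∈ F, ∑ i, μ i ≤ d)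
    {θ : ℝ} (h0 : 0 < θ) (h1 : θ < 1) :
    F.card * θ ^ d ≤ (1 / (1 - θ)) ^ m := by
  classical
  set ι : (Fin (m + 1) →₀ ℕ) → (Fin m → ℕ) := fun μ i => μ i.castSucc
  have hsum : ∀ μ ∈ F, ∑ i, ι μ i ≤ d := by
    intro μ hμ
    have := hd μ hμ
    rw [Fin.sum_univ_castSucc] at this
    simp only [ι]; omega
  calc (F.card : ℝ) * θ ^ d = ∑ μ ∈ F, θ ^ d := by simp
    _ ≤ ∑ μ ∈ F, θ ^ (∑ i, ι μ i) :=
        Finset.sum_le_sum fun μ hμ => pow_le_pow_of_le_one h0.le h1.le (hsum μ hμ)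
    _ = ∑ x ∈ F.image ι, θ ^ (∑ i, x i) :=
        (Finset.sum_image (f := fun x : Fin m → ℕ => θ ^ (∑ i, x i))
          fun μ hμ ν hν h => antichain_init_injOn hF hμ hν h).symm
    _ ≤ ∑ x ∈ Fintype.piFinset fun _ : Fin m => Finset.range (d + 1), θ ^ (∑ i, x i) := by
        refine Finset.sum_le_sum_of_subset_of_nonneg ?_ fun x _ _ => by positivity
        intro x hx
        obtain ⟨μ, hμ, rfl⟩ := Finset.mem_image.1 hx
        simp only [Fintype.mem_piFinset, Finset.mem_range]
        intro i
        have h2 := Finset.single_le_sum (f := ι μ) (fun _ _ => Nat.zero_le _) (Finset.mem_univ i)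
        exact Nat.lt_succ_of_le (h2.trans (hsum μ hμ))
    _ = ∏ _i : Fin m, ∑ j ∈ Finset.range (d + 1), θ ^ j := by
        rw [Finset.prod_univ_sum]
        exact Finset.sum_congr rfl fun x _ => (Finset.prod_pow_eq_pow_sum _ _ _).symm
    _ ≤ ∏ _i : Fin m, (1 / (1 - θ)) := by
        refine Finset.prod_le_prod (fun _ _ => Finset.sum_nonneg fun _ _ => by positivity) ?_
        intro _ _
        rw [geom_sum_eq h1.ne, one_div, ← neg_div_neg_eq, neg_sub, neg_sub, div_eq_mul_inv]
        have : 0 < 1 - θ := by linarith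
        have h4 : 0 < θ ^ (d + 1) := by positivity
        refine mul_le_of_le_one_left (by positivity) (by linarith)
    _ = (1 / (1 - θ)) ^ m := by simp

/-- The function `x ↦ (1 / 16) ^ x` is convex with values `1` at `0` and `1 / 4` at `1 / 2`. At `x =
1 / d ≤ 1 / 2` it lies below the chord, whose value there is `1 - 3 / (2 * d)`. -/
theorem sixteen_pow_ge {d : ℕ} (hd : 2 ≤ d) : (1 / 16 : ℝ) ≤ (1 - 3 / (2 * d)) ^ d := by
  have hd' : (2 : ℝ) ≤ d := by exact_mod_cast hd
  have h16 : (1 / 16 : ℝ) ^ (1 / (d : ℝ)) ≤ 1 - 3 / (2 * d) := by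
    have hc := (convexOn_rpow_left (b := (1 / 16 : ℝ)) (by norm_num)).2 (Set.mem_univ (0 : ℝ))
      (Set.mem_univ (1 / 2 : ℝ)) (show (0 : ℝ) ≤ 1 - 2 / d from ?_)
      (show (0 : ℝ) ≤ 2 / d by positivity) (by ring)
    · have h4 : ((1 / 16 : ℝ)) ^ (1 / 2 : ℝ) = 1 / 4 := by
        rw [show (1 / 16 : ℝ) = (1 / 4) ^ (2 : ℝ) by norm_num, ← Real.rpow_mul (by norm_num)]
        norm_num
      simp only [smul_eq_mul, mul_zero, zero_add, Real.rpow_zero, mul_one, h4] at hc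
      refine le_trans (le_of_eq ?_) (hc.trans (le_of_eq ?_))
      · congr 1; field_simp
      · field_simp; ring
    · rw [sub_nonneg, div_le_one (by positivity)]; exact hd'
  calc (1 / 16 : ℝ) = ((1 / 16 : ℝ) ^ (1 / (d : ℝ))) ^ d := by
        rw [← Real.rpow_natCast, ← Real.rpow_mul (by norm_num), one_div_mul_cancel (by positivity),
          Real.rpow_one]
    _ ≤ _ := pow_le_pow_left₀ (by positivity) h16 d

/-- The weight `θ = 1 - 3 / (2 * d)` makes each geometric series at most `2 * d / 3`, at the price
of the constant `16`. The base has to be smaller than `d` by a constant factor: for `n > k` this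
pays for the polynomial cost of the vertex tests. -/
theorem antichain_card_le_sixteen {m d : ℕ} (h2 : 2 ≤ d) {F : Finset (Fin (m + 1) →₀ ℕ)}
    (hF : ∀ μ ∈ F, ∀ ν ∈ F, μ ≤ ν → μ = ν) (hd : ∀ μ ∈ F, ∑ i, μ i ≤ d) :
    (F.card : ℝ) ≤ 16 * (2 * d / 3) ^ m := by
  have hd' : (2 : ℝ) ≤ d := by exact_mod_cast h2
  have h3 : (3 : ℝ) / (2 * d) ≤ 3 / 4 := by
    rw [div_le_div_iff₀ (by positivity) (by norm_num)]; linarith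
  have h4 : (0 : ℝ) < 3 / (2 * d) := by positivity
  have h := antichain_card_mul_pow_le hF hd (θ := 1 - 3 / (2 * d)) (by linarith) (by linarith)
  have h5 := mul_le_mul_of_nonneg_left (sixteen_pow_ge h2) (Nat.cast_nonneg (α := ℝ) F.card)
  have h6 : (1 / (1 - (1 - 3 / (2 * (d : ℝ))))) = 2 * d / 3 := by field_simp; ring
  rw [h6] at h
  linarith

theorem vertNPmin_antichain {n : ℕ} (s : TPoly n) :
    ∀ μ ∈ (minPoly s).support, ∀ ν ∈ (minPoly s).support, μ ≤ ν → μ = ν := by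
  intro μ hμ ν hν h
  rw [support_minPoly] at hμ hν
  exact le_antisymm h (hν.2 hμ.1 h)

theorem support_minPoly_subset {n : ℕ} (s : TPoly n) : (minPoly s).support ⊆ s.support :=
  fun _ hμ => vertNP_subset_support s ((support_minPoly s _).1 hμ).1

theorem card_support_minPoly_prod_le (n k d : ℕ) (s : Fin k → TPoly n) (hn : 1 ≤ n) (hk : 2 ≤ k)
    (hd : 1 ≤ d) (hs : ∀ i, (s i).totalDegree ≤ d) :
    (minPoly (∏ i, s i)).support.card ≤ (k * d) ^ (2 * n - 1) := by
  obtain ⟨m, rfl⟩ : ∃ m, n = m + 1 := ⟨n - 1, by omega⟩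
  have hdeg : (∏ i, s i).totalDegree ≤ k * d := by
    refine (MvPolynomial.totalDegree_finsetProd _ _).trans ?_
    refine (Finset.sum_le_sum fun i _ => hs i).trans ?_
    simp
  have h := antichain_card_le_pow (vertNPmin_antichain (∏ i, s i)) (d := k * d) fun μ hμ =>
    coe_le_totalDegree hdeg (support_minPoly_subset _ hμ)
  have h2 : 2 ≤ k * d := by nlinarith
  calc _ ≤ (k * d + 1) ^ m := h
    _ ≤ ((k * d) ^ 2) ^ m := Nat.pow_le_pow_left (by nlinarith) m
    _ = (k * d) ^ (2 * m) := by rw [← pow_mul]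
    -- The exponent `2 * m` coming from `k * d + 1 ≤ (k * d) ^ 2` is one less than the allowed one,
    -- so the constant `1` suffices.
    _ ≤ (k * d) ^ (2 * (m + 1) - 1) := Nat.pow_le_pow_right (by omega) (by omega)

end TropVN

namespace TropVN

/-! ### Small integer solutions of systems of strict linear inequalities -/

theorem linearMap_eq_dotProduct {n : ℕ} (f : (Fin n → ℝ) →ₗ[ℝ] ℝ) :
    ∃ z : Fin n → ℝ, ∀ x, f x = x ⬝ᵥ z := by
  refine ⟨fun i => f (Pi.single i 1), fun x => ?_⟩
  have : x = ∑ i, x i • (Pi.single i 1 : Fin n → ℝ) := by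
    ext j
    simp [Finset.sum_apply, Pi.single_apply]
  conv_lhs => rw [this]
  rw [map_sum]
  refine Finset.sum_congr rfl fun i _ => ?_
  rw [map_smul, smul_eq_mul]

/-- The constraint vectors that are tight at `w`. -/
def tight {n : ℕ} {ι : Type*} (v : ι → Fin n → ℝ) (w : Fin n → ℝ) : Set (Fin n → ℝ) :=
  {x | ∃ j, v j = x ∧ v j ⬝ᵥ w = 1}

/-- Choose `z` orthogonal to all tight vectors with `v l ⬝ᵥ z < 0` and move from `w` along `z` until
the first constraint becomes tight. The old tight constraints stay tight, and the new one is not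
orthogonal to `z`, hence outside the old span. -/
theorem exists_tighter {n : ℕ} {ι : Type*} [Fintype ι] (v : ι → Fin n → ℝ) (w : Fin n → ℝ)
    (hw : ∀ j, 1 ≤ v j ⬝ᵥ w) (l : ι) (hl : v l ∉ Submodule.span ℝ (tight v w)) :
    ∃ w', (∀ j, 1 ≤ v j ⬝ᵥ w') ∧
      Submodule.span ℝ (tight v w) < Submodule.span ℝ (tight v w') := by
  classical
  obtain ⟨z, hzT, hzl⟩ : ∃ z : Fin n → ℝ,
      (∀ x ∈ Submodule.span ℝ (tight v w), x ⬝ᵥ z = 0) ∧ v l ⬝ᵥ z < 0 := by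
    obtain ⟨f, hf, hker⟩ := Submodule.exists_le_ker_of_notMem hl
    obtain ⟨z, hz⟩ := linearMap_eq_dotProduct f
    have hz0 : ∀ x ∈ Submodule.span ℝ (tight v w), x ⬝ᵥ z = 0 := fun x hx => by
      rw [← hz]; exact hker hx
    rw [hz] at hf
    rcases lt_or_gt_of_ne hf with h | h
    · exact ⟨z, hz0, h⟩
    · exact ⟨-z, fun x hx => by rw [dotProduct_neg, hz0 x hx, neg_zero], by
        rw [dotProduct_neg]; linarith⟩
  -- The ratio test of the simplex method: the step length is the least one at which a decreasing
  -- constraint reaches `1`.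
  obtain ⟨j₀, hj₀, hmin⟩ := Finset.exists_min_image
    (Finset.univ.filter fun j => v j ⬝ᵥ z < 0) (fun j => (v j ⬝ᵥ w - 1) / (-(v j ⬝ᵥ z)))
    ⟨l, by simpa using hzl⟩
  simp only [Finset.mem_filter, Finset.mem_univ, true_and] at hj₀ hmin
  set τ := (v j₀ ⬝ᵥ w - 1) / (-(v j₀ ⬝ᵥ z)) with hτ
  have hτ0 : 0 ≤ τ := div_nonneg (by linarith [hw j₀]) (by linarith)
  have hdot : ∀ x : Fin n → ℝ, x ⬝ᵥ (w + τ • z) = x ⬝ᵥ w + τ * (x ⬝ᵥ z) := fun x => by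
    rw [dotProduct_add, dotProduct_smul, smul_eq_mul]
  have hj₀t : v j₀ ⬝ᵥ (w + τ • z) = 1 := by
    have : v j₀ ⬝ᵥ z ≠ 0 := hj₀.ne
    rw [hdot, hτ]; field_simp; ring
  refine ⟨w + τ • z, fun j => ?_, ?_⟩
  · rw [hdot]
    rcases lt_or_ge (v j ⬝ᵥ z) 0 with h | h
    · have h1 := hmin j h
      rw [le_div_iff₀ (by linarith)] at h1
      linarith
    · have := mul_nonneg hτ0 h
      linarith [hw j]
  · rw [SetLike.lt_iff_le_and_exists]
    refine ⟨Submodule.span_mono ?_, v j₀, Submodule.subset_span ⟨j₀, rfl, hj₀t⟩, fun h => ?_⟩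
    · rintro _ ⟨j, rfl, hj⟩
      refine ⟨j, rfl, ?_⟩
      rw [hdot, hj, hzT _ (Submodule.subset_span ⟨j, rfl, hj⟩), mul_zero, add_zero]
    · exact hj₀.ne (hzT _ h)

/-- Otherwise the dimension of the span of the tight vectors could be raised forever, beyond `n`. -/
theorem exists_spanning_tight {n : ℕ} {ι : Type*} [Fintype ι] (v : ι → Fin n → ℝ)
    (w : Fin n → ℝ) (hw : ∀ j, 1 ≤ v j ⬝ᵥ w) :
    ∃ w, (∀ j, 1 ≤ v j ⬝ᵥ w) ∧ ∀ l, v l ∈ Submodule.span ℝ (tight v w) := by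
  by_contra! hcon
  have key : ∀ m : ℕ, ∃ w, (∀ j, 1 ≤ v j ⬝ᵥ w) ∧
      m ≤ Module.finrank ℝ (Submodule.span ℝ (tight v w)) := by
    intro m
    induction m with
    | zero => exact ⟨w, hw, Nat.zero_le _⟩
    | succ m ih =>
      obtain ⟨w, hw, hm⟩ := ih
      obtain ⟨l, hl⟩ := hcon w hw
      obtain ⟨w', hw', hlt⟩ := exists_tighter v w hw l hl
      exact ⟨w', hw', hm.trans_lt (Submodule.finrank_lt_finrank_of_lt hlt)⟩
  obtain ⟨w, -, hm⟩ := key (n + 1)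
  have := Submodule.finrank_le (Submodule.span ℝ (tight v w))
  simp at this
  omega

/-- At a point where the tight vectors span all constraint vectors, the constraints are governed by
a square linear system with small integer entries. Cramer's rule solves it, and the determinant
serves as common denominator. -/
theorem exists_bounded_feasible {n : ℕ} {ι : Type*} [Fintype ι] (a : ι → Fin n → ℤ) (D : ℕ)
    (h1 : 1 ≤ D) (hD : ∀ j i, |a j i| ≤ D) (w : Fin n → ℝ)
    (hw : ∀ j, 0 < ∑ i, w i * (a j i : ℝ)) :
    ∃ z : Fin n → ℤ, (∀ j, 1 ≤ ∑ i, z i * a j i) ∧ ∀ i, |z i| ≤ n.factorial * D ^ n := by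
  classical
  set v : ι → Fin n → ℝ := fun j i => (a j i : ℝ) with hv
  have hw1 : ∃ w : Fin n → ℝ, ∀ j, 1 ≤ v j ⬝ᵥ w := by
    rcases isEmpty_or_nonempty ι with hι | hι
    · exact ⟨0, fun j => (hι.false j).elim⟩
    obtain ⟨j₀, -, hmin⟩ := Finset.exists_min_image Finset.univ (fun j => v j ⬝ᵥ w)
      Finset.univ_nonempty
    have hpos : ∀ j, 0 < v j ⬝ᵥ w := fun j => by
      rw [dotProduct_comm]; exact hw j
    refine ⟨(v j₀ ⬝ᵥ w)⁻¹ • w, fun j => ?_⟩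
    rw [dotProduct_smul, smul_eq_mul, ← div_eq_inv_mul, one_le_div (hpos j₀)]
    exact hmin j (Finset.mem_univ j)
  obtain ⟨w₀, hw₀⟩ := hw1
  obtain ⟨w, hw1, hspan⟩ := exists_spanning_tight v w₀ hw₀
  -- `b₀` is a maximal independent set of tight vectors; the unit vectors then complete it to a
  -- basis, which keeps the matrix integral with entries at most `D`.
  obtain ⟨b₀, hb₀T, -, hTb₀, hb₀⟩ := exists_linearIndepOn_id_extension
    (K := ℝ) (s := (∅ : Set (Fin n → ℝ))) (t := tight v w) (by exact linearIndependent_empty ℝ _)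
    (Set.empty_subset _)
  obtain ⟨b, hbt, hb₀b, htb, hb⟩ := exists_linearIndepOn_id_extension
    (K := ℝ) (s := b₀) (t := b₀ ∪ Set.range fun i : Fin n => (Pi.single i 1 : Fin n → ℝ)) hb₀
    Set.subset_union_left
  have hbtop : Submodule.span ℝ b = ⊤ := by
    rw [eq_top_iff, ← (Pi.basisFun ℝ (Fin n)).span_eq, Submodule.span_le]
    rintro _ ⟨i, rfl⟩
    refine htb (Or.inr ⟨i, ?_⟩)
    simp
  let B : Module.Basis b ℝ (Fin n → ℝ) := Module.Basis.mk hb (by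
    rw [← hbtop]; simp)
  have : Fintype b := FiniteDimensional.fintypeBasisIndex B
  have hcard : Fintype.card b = n := by
    rw [← Module.finrank_eq_card_basis B]; simp
  let e : Fin n ≃ b := (Fintype.equivFinOfCardEq hcard).symm
  have hint : ∀ i, ∃ m : Fin n → ℤ, (fun c => (m c : ℝ)) = (e i : Fin n → ℝ) ∧ ∀ c, |m c| ≤ D := by
    intro i
    rcases hbt (e i).2 with h | ⟨c, hc⟩
    · obtain ⟨j, hj, -⟩ := hb₀T h
      exact ⟨a j, hj, hD j⟩
    · refine ⟨Pi.single c 1, ?_, fun c' => ?_⟩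
      · rw [← hc]; ext c'
        by_cases h : c' = c
        · subst h; simp
        · simp [h]
      · by_cases h : c' = c
        · subst h; simpa using by exact_mod_cast h1
        · simp [h]
  choose M hM hMD using hint
  let Mz : Matrix (Fin n) (Fin n) ℤ := Matrix.of M
  have hMr : Mz.map (Int.castRingHom ℝ) = Matrix.of fun i => (e i : Fin n → ℝ) := by
    ext i c; exact congrFun (hM i) c
  have hdet : Mz.det ≠ 0 := by
    have hli : LinearIndependent ℝ (Matrix.of fun i => (e i : Fin n → ℝ)).row := by
      have := hb.linearIndependent.comp e e.injective
      exact this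
    rw [Matrix.linearIndependent_rows_iff_isUnit, Matrix.isUnit_iff_isUnit_det, ← hMr] at hli
    intro h0
    have h2 : (Mz.map (Int.castRingHom ℝ)).det = ((Mz.det : ℤ) : ℝ) :=
      (RingHom.map_det (Int.castRingHom ℝ) Mz).symm
    rw [h2, h0] at hli
    simp at hli
  -- The right-hand side asks for the value `1` on tight rows and `0` on the auxiliary unit vectors.
  -- The sign of the determinant makes the common multiple `|Mz.det|` positive.
  let c : Fin n → ℤ := fun i => if (e i : Fin n → ℝ) ∈ b₀ then 1 else 0
  let z : Fin n → ℤ := Mz.det.sign • Mz.cramer c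
  have hz : Mz.mulVec z = |Mz.det| • c := by
    rw [Matrix.mulVec_smul, Matrix.mulVec_cramer, smul_smul, Int.sign_mul_self_eq_abs]
  -- On the span of `b₀`, and so on every constraint vector, `z` acts as `|Mz.det|` times the real
  -- solution `w`. Feasibility of `w` therefore passes to `z`.
  have hlin : ∀ x ∈ Submodule.span ℝ b₀,
      x ⬝ᵥ (fun i => (z i : ℝ)) = (|Mz.det| : ℤ) * (x ⬝ᵥ w) := by
    intro x hx
    induction hx using Submodule.span_induction with
    | mem x hx =>
      obtain ⟨j, rfl, hj⟩ := hb₀T hx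
      rw [hj, mul_one]
      obtain ⟨i, hi⟩ : ∃ i, (e i : Fin n → ℝ) = v j := ⟨e.symm ⟨v j, hb₀b hx⟩, by simp⟩
      have h2 := congrFun hz i
      have h3 : c i = 1 := by simp [c, hi, hx]
      simp only [Pi.smul_apply, smul_eq_mul, h3, mul_one] at h2
      rw [← h2, ← hi, ← hM i]
      simp [Matrix.mulVec, dotProduct, Mz]
    | zero => simp
    | add x y _ _ hx hy => rw [add_dotProduct, add_dotProduct, hx, hy]; ring
    | smul r x _ hx => rw [smul_dotProduct, smul_dotProduct, hx, smul_eq_mul, smul_eq_mul]; ring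
  refine ⟨z, fun j => ?_, fun i => ?_⟩
  · have hj : v j ∈ Submodule.span ℝ b₀ := by
      have := hspan j
      exact (Submodule.span_le.2 hTb₀) this
    have h2 := hlin _ hj
    have h3 : (1 : ℝ) ≤ (|Mz.det| : ℤ) := by
      exact_mod_cast Int.one_le_abs hdet
    have h4 : (1 : ℝ) ≤ v j ⬝ᵥ (fun i => (z i : ℝ)) := by
      rw [h2]; nlinarith [hw1 j]
    have h5 : ((∑ i, z i * a j i : ℤ) : ℝ) = v j ⬝ᵥ (fun i => (z i : ℝ)) := by
      push_cast
      exact Finset.sum_congr rfl fun i _ => mul_comm _ _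
    rw [← h5] at h4
    exact_mod_cast h4
  · have h2 : |z i| ≤ |Mz.cramer c i| := by
      simp only [z, Pi.smul_apply, smul_eq_mul, abs_mul, Int.abs_sign_of_ne_zero hdet, one_mul,
        le_refl]
    refine h2.trans ?_
    rw [Matrix.cramer_apply]
    have h3 := Matrix.det_le (A := Mz.updateCol i c) (abv := AbsoluteValue.abs) (x := (D : ℤ)) ?_
    · simpa using h3
    · intro p r
      rw [Matrix.updateCol_apply]
      by_cases hr : r = i
      · rw [if_pos hr]
        have : |c p| ≤ 1 := by
          simp only [c]; split_ifs <;> simp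
        exact this.trans (by exact_mod_cast h1)
      · rw [if_neg hr]
        exact hMD p r

end TropVN

namespace TropVN

/-! ### The ellipsoid method -/

/-- This is the Cauchy–Schwarz inequality for `(√Y, √Z)` and `(√p, √r)`, free of square roots. -/
theorem sq_add_le_of_sq_le {u v Y Z p r : ℝ} (hY : 0 ≤ Y) (hZ : 0 ≤ Z) (hp : 0 ≤ p) (hr : 0 ≤ r)
    (hu : u ^ 2 ≤ Y * p) (hv : v ^ 2 ≤ Z * r) : (u + v) ^ 2 ≤ (Y + Z) * (p + r) := by
  have h1 : (u * v) ^ 2 ≤ (Y * p) * (Z * r) := by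
    rw [mul_pow]
    exact mul_le_mul hu hv (sq_nonneg v) (by positivity)
  have h2 : (2 * (u * v)) ^ 2 ≤ (Y * r + Z * p) ^ 2 := by
    nlinarith [sq_nonneg (Y * r - Z * p)]
  have h3 : 2 * (u * v) ≤ Y * r + Z * p :=
    (abs_le_of_sq_le_sq' h2 (by positivity)).2
  nlinarith

/-- The inequality behind one step of the ellipsoid method, in the two directions spanned by
a test vector and the cut. -/
theorem ellipsoid_step_scalar {u t q s l Y β : ℝ} (hq : 0 < q) (hs : 0 < s) (hqs : q ≤ s ^ 2)
    (hl : 0 < l) (hY : 0 ≤ Y) (ht : 0 ≤ t) (htq : t ^ 2 ≤ q)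
    (h : ∀ γ : ℝ, (u + γ * t) ^ 2 ≤ Y + γ ^ 2 * q) :
    (u + β * (t - l * s / (2 * (s ^ 2 + l * q)) * q)) ^ 2 ≤
      (1 + l ^ 2 / 4) * (Y + β ^ 2 * q - l * β ^ 2 * q ^ 2 / (s ^ 2 + l * q)) := by
  have hden : 0 < s ^ 2 + l * q := by positivity
  -- Optimising the hypothesis over `γ` shows that a point that is far out in the direction of the
  -- cut is close to the centre in the complementary direction. The case `t ^ 2 = q` has no finite
  -- optimiser and forces `u = 0`.
  have hu : u ^ 2 ≤ Y * (1 - t ^ 2 / q) := by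
    rcases htq.eq_or_lt with he | hlt
    · have hu0 : u = 0 := by
        have ht0 : 0 < t := by
          rcases ht.eq_or_lt with h0 | h0
          · subst h0; simp at he; exact absurd he hq.ne
          · exact h0
        have h2 : u * t = 0 := by
          by_contra hne
          -- For `t ^ 2 = q` the hypothesis reads `u ^ 2 + 2 * γ * (u * t) ≤ Y`, and this `γ`
          -- contradicts it.
          have h3 := h ((Y + 1) / (2 * (u * t)))
          have h4 : (Y + 1) / (2 * (u * t)) * (2 * (u * t)) = Y + 1 :=
            div_mul_cancel₀ _ (mul_ne_zero two_ne_zero hne)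
          rw [← he] at h3
          nlinarith [sq_nonneg u]
        rcases mul_eq_zero.1 h2 with h3 | h3
        · exact h3
        · exact absurd h3 ht0.ne'
      rw [hu0, he, div_self hq.ne']; simp
    -- This `γ` maximises `(u + γ * t) ^ 2 - γ ^ 2 * q`.
    · have h3 := h (u * t / (q - t ^ 2))
      have hpos : 0 < q - t ^ 2 := by linarith
      have h4 : u + u * t / (q - t ^ 2) * t = u * q / (q - t ^ 2) := by field_simp; ring
      rw [h4] at h3
      have h5 : (u * q / (q - t ^ 2)) ^ 2 - (u * t / (q - t ^ 2)) ^ 2 * q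
          = u ^ 2 * q / (q - t ^ 2) := by field_simp
      have h6 : u ^ 2 * q / (q - t ^ 2) ≤ Y := by linarith
      rw [div_le_iff₀ hpos] at h6
      have h7 : Y * (1 - t ^ 2 / q) = Y * (q - t ^ 2) / q := by field_simp
      rw [h7, le_div_iff₀ hq]
      exact h6
  -- `Q` is the value of the quadratic form at the cut vector after the rank-one correction, before
  -- scaling.
  set Q := q * s ^ 2 / (s ^ 2 + l * q) with hQ
  have hQ0 : 0 < Q := by positivity
  have hp : 0 ≤ 1 - t ^ 2 / q := by
    rw [sub_nonneg, div_le_one hq]; exact htq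
  set τ := t - l * s / (2 * (s ^ 2 + l * q)) * q with hτ
  -- Completing the square. The terms `l * (t / s) ^ 2 - l * (t / s)` are not positive because `0 ≤
  -- t ≤ s`; this is where only the half of the ellipsoid beyond the cut is used.
  have hid : τ ^ 2 / Q = t ^ 2 / q + l * (t / s) ^ 2 - l * (t / s)
      + l ^ 2 * q / (4 * (s ^ 2 + l * q)) := by
    rw [hτ, hQ]; field_simp; ring
  have hts : t / s ≤ 1 := by
    rw [div_le_one hs]
    exact abs_le_of_sq_le_sq' (htq.trans hqs) hs.le |>.2
  have hts0 : 0 ≤ t / s := by positivity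
  have h8 : l ^ 2 * q / (4 * (s ^ 2 + l * q)) ≤ l ^ 2 / 4 := by
    rw [div_le_div_iff₀ (by positivity) (by norm_num)]
    have : 0 ≤ l ^ 2 * (s ^ 2 + l * q - q) := by
      have : 0 ≤ l * q := by positivity
      exact mul_nonneg (by positivity) (by linarith)
    nlinarith
  have h9 : l * (t / s) ^ 2 ≤ l * (t / s) := by
    refine mul_le_mul_of_nonneg_left ?_ hl.le
    nlinarith
  have hτ2 : τ ^ 2 / Q ≤ (1 + l ^ 2 / 4) - (1 - t ^ 2 / q) := by rw [hid]; linarith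
  have hr : 0 ≤ (1 + l ^ 2 / 4) - (1 - t ^ 2 / q) := le_trans (by positivity) hτ2
  have hv : (β * τ) ^ 2 ≤ β ^ 2 * Q * ((1 + l ^ 2 / 4) - (1 - t ^ 2 / q)) := by
    rw [div_le_iff₀ hQ0] at hτ2
    have := mul_le_mul_of_nonneg_left hτ2 (sq_nonneg β)
    rw [mul_pow]
    linarith
  have hfin := sq_add_le_of_sq_le hY (by positivity) hp hr hu hv
  have e1 : Y + β ^ 2 * q - l * β ^ 2 * q ^ 2 / (s ^ 2 + l * q) = Y + β ^ 2 * Q := by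
    rw [hQ]; field_simp; ring
  rw [e1]
  calc _ ≤ _ := hfin
    _ = _ := by ring

open Matrix

variable {n : ℕ}

/-- `x` lies in the ellipsoid with centre `c` and matrix `A`, in terms of support functions. -/
def InEllipsoid (A : Matrix (Fin n) (Fin n) ℝ) (c x : Fin n → ℝ) : Prop :=
  ∀ y : Fin n → ℝ, (y ⬝ᵥ (x - c)) ^ 2 ≤ y ⬝ᵥ A *ᵥ y

/-- The matrix of the ellipsoid after a cut along `a`. -/
noncomputable def cutMatrix (A : Matrix (Fin n) (Fin n) ℝ) (a : Fin n → ℝ) (l s : ℝ) :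
    Matrix (Fin n) (Fin n) ℝ :=
  (1 + l ^ 2 / 4) • (A - (l / (s ^ 2 + l * (a ⬝ᵥ A *ᵥ a))) • vecMulVec (A *ᵥ a) (A *ᵥ a))

/-- The centre of the ellipsoid after a cut along `a`. -/
noncomputable def cutCentre (A : Matrix (Fin n) (Fin n) ℝ) (c a : Fin n → ℝ) (l s : ℝ) :
    Fin n → ℝ :=
  c + (l * s / (2 * (s ^ 2 + l * (a ⬝ᵥ A *ᵥ a)))) • (A *ᵥ a)

theorem dotProduct_mulVec_comm {A : Matrix (Fin n) (Fin n) ℝ} (hA : Aᵀ = A) (x y : Fin n → ℝ) :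
    x ⬝ᵥ A *ᵥ y = y ⬝ᵥ A *ᵥ x := by
  rw [dotProduct_mulVec, ← mulVec_transpose, hA, dotProduct_comm]

theorem quad_cutMatrix (A : Matrix (Fin n) (Fin n) ℝ) (a : Fin n → ℝ) (l s : ℝ)
    (y : Fin n → ℝ) :
    y ⬝ᵥ cutMatrix A a l s *ᵥ y = (1 + l ^ 2 / 4) *
      (y ⬝ᵥ A *ᵥ y - l / (s ^ 2 + l * (a ⬝ᵥ A *ᵥ a)) * (y ⬝ᵥ A *ᵥ a) ^ 2) := by
  rw [cutMatrix, smul_mulVec, dotProduct_smul, sub_mulVec, dotProduct_sub, smul_mulVec,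
    dotProduct_smul, vecMulVec_mulVec, smul_eq_mul, smul_eq_mul]
  congr 3
  rw [dotProduct_smul, dotProduct_comm (A *ᵥ a) y]
  simp [sq]

/-- On the half to be kept, `t = a ⬝ᵥ (x - c)` satisfies `0 ≤ t ≤ s`. Adding `l * ((t / s) ^ 2 - t /
s) ≤ 0` to the inequality of the old ellipsoid and completing the square gives the new one;
inverting the matrix `A⁻¹ + (l / s ^ 2) • a aᵀ` produces the rank-one correction, and the remaining
constant is at most `1 + l ^ 2 / 4`. Any `s` with `q ≤ s ^ 2` is admissible, so no exact square root
is needed. With support functions in place of `A⁻¹`, the argument stays in two dimensions. -/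
theorem inEllipsoid_cut {A : Matrix (Fin n) (Fin n) ℝ} (hA : Aᵀ = A) {c a x : Fin n → ℝ} {l s : ℝ}
    (hq : 0 < a ⬝ᵥ A *ᵥ a) (hs : 0 < s) (hqs : a ⬝ᵥ A *ᵥ a ≤ s ^ 2) (hl : 0 < l)
    (hx : InEllipsoid A c x) (hax : 0 ≤ a ⬝ᵥ x) (hac : a ⬝ᵥ c ≤ 0) :
    InEllipsoid (cutMatrix A a l s) (cutCentre A c a l s) x := by
  intro y
  set q := a ⬝ᵥ A *ᵥ a with hqdef
  set g := A *ᵥ a with hg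
  -- Split `y` into a multiple of `a` and a part that is orthogonal to `a` for the form `A`. The
  -- mixed terms of the quadratic form vanish and the scalar inequality applies.
  set β := (y ⬝ᵥ g) / q with hβ
  set y₀ := y - β • a with hy₀
  have hyg : y ⬝ᵥ g = β * q := by rw [hβ]; field_simp
  have hy₀g : y₀ ⬝ᵥ g = 0 := by
    rw [hy₀, sub_dotProduct, smul_dotProduct, hyg, smul_eq_mul]; simp [hqdef]
  have hy : y = y₀ + β • a := by rw [hy₀]; simp
  have hquad : ∀ γ : ℝ, (y₀ + γ • a) ⬝ᵥ A *ᵥ (y₀ + γ • a) = y₀ ⬝ᵥ A *ᵥ y₀ + γ ^ 2 * q := by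
    intro γ
    rw [mulVec_add, mulVec_smul, add_dotProduct, dotProduct_add, dotProduct_add, dotProduct_smul,
      smul_dotProduct, smul_dotProduct, dotProduct_smul, ← hg, hy₀g,
      dotProduct_mulVec_comm hA a y₀, ← hg, hy₀g]
    simp only [smul_eq_mul, mul_zero, add_zero, zero_add, ← hqdef]
    ring
  have hlin : ∀ γ : ℝ, (y₀ + γ • a) ⬝ᵥ (x - c) = y₀ ⬝ᵥ (x - c) + γ * (a ⬝ᵥ (x - c)) := by
    intro γ; rw [add_dotProduct, smul_dotProduct, smul_eq_mul]
  have hY : 0 ≤ y₀ ⬝ᵥ A *ᵥ y₀ := (sq_nonneg _).trans (hx y₀)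
  have ht : 0 ≤ a ⬝ᵥ (x - c) := by rw [dotProduct_sub]; linarith
  have key := ellipsoid_step_scalar (u := y₀ ⬝ᵥ (x - c)) (β := β) hq hs hqs hl hY ht (hx a)
    (fun γ => by have := hx (y₀ + γ • a); rwa [hquad, hlin] at this)
  have e1 : y ⬝ᵥ (x - cutCentre A c a l s) =
      y₀ ⬝ᵥ (x - c) + β * (a ⬝ᵥ (x - c) - l * s / (2 * (s ^ 2 + l * q)) * q) := by
    rw [cutCentre, ← hg, ← hqdef, ← sub_sub, dotProduct_sub, dotProduct_smul, hyg]
    conv_lhs => rw [hy, hlin]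
    rw [smul_eq_mul]; ring
  have e2 : y ⬝ᵥ cutMatrix A a l s *ᵥ y =
      (1 + l ^ 2 / 4) * (y₀ ⬝ᵥ A *ᵥ y₀ + β ^ 2 * q - l * β ^ 2 * q ^ 2 / (s ^ 2 + l * q)) := by
    rw [quad_cutMatrix, ← hg, ← hqdef, hyg]
    conv_lhs => rw [hy, hquad]
    ring
  rw [e1, e2]
  exact key

theorem transpose_cutMatrix {A : Matrix (Fin n) (Fin n) ℝ} (hA : Aᵀ = A) (a : Fin n → ℝ)
    (l s : ℝ) : (cutMatrix A a l s)ᵀ = cutMatrix A a l s := by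
  rw [cutMatrix, transpose_smul, transpose_sub, transpose_smul, hA, transpose_vecMulVec]

/-- By the matrix determinant lemma the rank-one correction multiplies the determinant by `1 - l * q
/ (s ^ 2 + l * q)`, which is the inverse of `1 + l * q / s ^ 2`. -/
theorem det_cutMatrix {A : Matrix (Fin n) (Fin n) ℝ} (hdet : A.det ≠ 0)
    (a : Fin n → ℝ) {l s : ℝ} (hq : 0 < a ⬝ᵥ A *ᵥ a) (hs : 0 < s) (hl : 0 < l) :
    (cutMatrix A a l s).det =
      (1 + l ^ 2 / 4) ^ n * (A.det / (1 + l * (a ⬝ᵥ A *ᵥ a) / s ^ 2)) := by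
  set q := a ⬝ᵥ A *ᵥ a with hqdef
  have hden : 0 < s ^ 2 + l * q := by positivity
  have hvec : A - (l / (s ^ 2 + l * q)) • vecMulVec (A *ᵥ a) (A *ᵥ a) =
      A + replicateCol Unit (-(l / (s ^ 2 + l * q)) • (A *ᵥ a)) * replicateRow Unit (A *ᵥ a) := by
    rw [← vecMulVec_eq, sub_eq_add_neg, smul_vecMulVec, neg_smul]
  have hinv : A⁻¹ *ᵥ (A *ᵥ a) = a := by
    rw [mulVec_mulVec, nonsing_inv_mul _ (isUnit_iff_ne_zero.2 hdet), one_mulVec]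
  rw [cutMatrix, det_smul, Fintype.card_fin, ← hqdef, hvec,
    det_add_replicateCol_mul_replicateRow (isUnit_iff_ne_zero.2 hdet)]
  congr 1
  have : (1 + replicateRow Unit (A *ᵥ a) * A⁻¹ *
      replicateCol Unit (-(l / (s ^ 2 + l * q)) • (A *ᵥ a))).det = 1 - l / (s ^ 2 + l * q) * q := by
    rw [Matrix.mul_assoc, ← replicateCol_mulVec, mulVec_smul, hinv, det_unique, Matrix.add_apply,
      one_apply_eq, replicateRow_mul_replicateCol_apply, dotProduct_smul, dotProduct_comm,
      ← hqdef, smul_eq_mul]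
    ring
  rw [this, div_eq_mul_inv]
  congr 1
  field_simp
  ring

/-- For `l = 1 / (2 * n)` the scaling costs only `(1 + 1 / (16 * n ^ 2)) ^ n ≤ 1 / (1 - 1 / (16 *
n))`, by Bernoulli's inequality, while the correction gains at least `1 + 1 / (8 * n)`. A net gain
of `1 + 1 / (32 * n)` remains. -/
theorem shrink_factor (hn : 1 ≤ n) {x : ℝ} (hx : 1 / (8 * n : ℝ) ≤ x) :
    (1 + (1 / (2 * n : ℝ)) ^ 2 / 4) ^ n * (1 + 1 / (32 * n)) ≤ 1 + x := by
  have hn' : (1 : ℝ) ≤ n := by exact_mod_cast hn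
  have hn0 : (0 : ℝ) < n := by linarith
  set e : ℝ := 1 / n with he
  have he1 : e ≤ 1 := by rw [he, div_le_one hn0]; exact hn'
  have he0 : 0 < e := by positivity
  have hK : (1 + (1 / (2 * n : ℝ)) ^ 2 / 4) = 1 + e ^ 2 / 16 := by rw [he]; field_simp; ring
  have hb : 1 - e / 16 ≤ (1 - e ^ 2 / 16) ^ n := by
    have := one_add_mul_le_pow (a := -(e ^ 2 / 16)) (by nlinarith) n
    have h2 : (n : ℝ) * e = 1 := by rw [he]; field_simp
    have h3 : 1 + (n : ℝ) * -(e ^ 2 / 16) = 1 - e / 16 := by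
      linear_combination (-e / 16) * h2
    rw [h3, ← sub_eq_add_neg] at this
    exact this
  have hc : (1 + e ^ 2 / 16) ^ n * (1 - e ^ 2 / 16) ^ n ≤ 1 := by
    rw [← mul_pow]
    refine pow_le_one₀ ?_ ?_
    · have : e ^ 2 ≤ 1 := by nlinarith
      nlinarith [sq_nonneg e]
    · nlinarith [sq_nonneg (e ^ 2)]
  set K := (1 + e ^ 2 / 16) ^ n
  have hK0 : 0 ≤ K := by positivity
  have hd : K * (1 - e / 16) ≤ 1 := (mul_le_mul_of_nonneg_left hb hK0).trans hc
  have h32 : (1 : ℝ) / (32 * n) = e / 32 := by rw [he]; field_simp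
  have h8 : (1 : ℝ) / (8 * n) = e / 8 := by rw [he]; field_simp
  rw [hK, h32]
  rw [h8] at hx
  have hf : 1 + e / 32 ≤ (1 - e / 16) * (1 + e / 8) := by nlinarith
  calc K * (1 + e / 32) ≤ K * ((1 - e / 16) * (1 + e / 8)) := mul_le_mul_of_nonneg_left hf hK0
    _ = (K * (1 - e / 16)) * (1 + e / 8) := by ring
    _ ≤ 1 * (1 + e / 8) := mul_le_mul_of_nonneg_right hd (by positivity)
    _ ≤ 1 + x := by linarith

/-- The state of the ellipsoid method after `t` cuts, when looking for a point of `G`. -/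
structure EllipsoidInv (G : Set (Fin n → ℝ)) (t : ℕ) (A : Matrix (Fin n) (Fin n) ℝ)
    (c : Fin n → ℝ) : Prop where
  symm : Aᵀ = A
  mem : ∀ x ∈ G, InEllipsoid A c x
  det_pos : 0 < A.det
  det_le : A.det * (1 + 1 / (32 * n)) ^ t ≤ 1
  le : ∀ y : Fin n → ℝ, y ⬝ᵥ A *ᵥ y ≤ 2 ^ t * (y ⬝ᵥ y)

theorem EllipsoidInv.init {G : Set (Fin n → ℝ)} (hG : ∀ x ∈ G, x ⬝ᵥ x ≤ 1) :
    EllipsoidInv G 0 1 0 where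
  symm := transpose_one
  mem x hx y := by
    rw [one_mulVec, sub_zero]
    have h1 : (y ⬝ᵥ x) ^ 2 ≤ (y ⬝ᵥ y) * (x ⬝ᵥ x) := by
      have := Finset.sum_mul_sq_le_sq_mul_sq Finset.univ y x
      simpa [dotProduct, sq] using this
    have h2 : 0 ≤ y ⬝ᵥ y := by
      simp only [dotProduct]; exact Finset.sum_nonneg fun i _ => mul_self_nonneg _
    exact h1.trans (mul_le_of_le_one_right h2 (hG x hx))
  det_pos := by simp
  det_le := by simp
  le y := by simp

/-- The bound `s ^ 2 ≤ 4 * q` limits the loss caused by the inexact square root: it makes the gain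
`l * q / s ^ 2` at least `1 / (8 * n)`. -/
theorem EllipsoidInv.step (hn : 1 ≤ n) {G : Set (Fin n → ℝ)} (hne : G.Nonempty) {t : ℕ}
    {A : Matrix (Fin n) (Fin n) ℝ} {c a : Fin n → ℝ} {s : ℝ} (h : EllipsoidInv G t A c)
    (hq : 0 < a ⬝ᵥ A *ᵥ a) (hs : 0 < s) (hqs : a ⬝ᵥ A *ᵥ a ≤ s ^ 2)
    (hsq : s ^ 2 ≤ 4 * (a ⬝ᵥ A *ᵥ a)) (hG : ∀ x ∈ G, 0 ≤ a ⬝ᵥ x) (hac : a ⬝ᵥ c ≤ 0) :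
    EllipsoidInv G (t + 1) (cutMatrix A a (1 / (2 * n)) s) (cutCentre A c a (1 / (2 * n)) s) := by
  have hn0 : (0 : ℝ) < n := by exact_mod_cast hn
  have hl : (0 : ℝ) < 1 / (2 * n) := by positivity
  have hdet := det_cutMatrix h.det_pos.ne' a hq hs hl
  have hx : 1 / (8 * n : ℝ) ≤ 1 / (2 * n) * (a ⬝ᵥ A *ᵥ a) / s ^ 2 := by
    rw [le_div_iff₀ (by positivity)]
    have : 1 / (8 * n : ℝ) * s ^ 2 ≤ 1 / (8 * n : ℝ) * (4 * (a ⬝ᵥ A *ᵥ a)) :=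
      mul_le_mul_of_nonneg_left hsq (by positivity)
    refine this.trans (le_of_eq ?_)
    field_simp; norm_num
  have hsf := shrink_factor hn hx
  set x := 1 / (2 * n) * (a ⬝ᵥ A *ᵥ a) / s ^ 2 with hxd
  have hx0 : 0 < 1 + x := by positivity
  refine ⟨transpose_cutMatrix h.symm a _ _,
    fun z hz => inEllipsoid_cut h.symm hq hs hqs hl (h.mem z hz) (hG z hz) hac, ?_, ?_, ?_⟩
  · rw [hdet]
    have := h.det_pos
    positivity
  · rw [hdet, pow_succ]
    have h1 := h.det_le
    have h2 : 0 ≤ A.det * (1 + 1 / (32 * n : ℝ)) ^ t := by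
      have := h.det_pos
      positivity
    calc _ = (A.det * (1 + 1 / (32 * n : ℝ)) ^ t) *
          (((1 + (1 / (2 * n : ℝ)) ^ 2 / 4) ^ n * (1 + 1 / (32 * n))) / (1 + x)) := by
          ring
      _ ≤ 1 * 1 := by
          refine mul_le_mul h1 ?_ (by positivity) zero_le_one
          rw [div_le_one hx0]; exact hsf
      _ = 1 := one_mul 1
  -- The rank-one correction only lowers the form and the scaling factor is at most `2`. A point of
  -- `G` shows that the form is nonnegative.
  · intro y
    have hn1 : (1 : ℝ) ≤ n := by exact_mod_cast hn
    obtain ⟨z, hz⟩ := hne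
    have hy0 : 0 ≤ y ⬝ᵥ A *ᵥ y := (sq_nonneg _).trans (h.mem z hz y)
    have hK : 1 + (1 / (2 * n : ℝ)) ^ 2 / 4 ≤ 2 := by
      have : 1 / (2 * n : ℝ) ≤ 1 := by
        rw [div_le_one (by positivity)]; linarith
      nlinarith
    rw [quad_cutMatrix]
    have h3 : 0 ≤ 1 / (2 * n) / (s ^ 2 + 1 / (2 * n) * (a ⬝ᵥ A *ᵥ a)) * (y ⬝ᵥ A *ᵥ a) ^ 2 := by
      positivity
    calc _ ≤ (1 + (1 / (2 * n : ℝ)) ^ 2 / 4) * (y ⬝ᵥ A *ᵥ y) :=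
          mul_le_mul_of_nonneg_left (by linarith) (by positivity)
      _ ≤ 2 * (y ⬝ᵥ A *ᵥ y) := mul_le_mul_of_nonneg_right hK hy0
      _ ≤ 2 * (2 ^ t * (y ⬝ᵥ y)) := mul_le_mul_of_nonneg_left (h.le y) (by norm_num)
      _ = _ := by ring

/-- An ellipsoid that contains a ball of radius `r` has width at least `r`. -/
theorem EllipsoidInv.sq_mul_le {G : Set (Fin n → ℝ)} {t : ℕ} {A : Matrix (Fin n) (Fin n) ℝ}
    {c p : Fin n → ℝ} {r : ℝ} (h : EllipsoidInv G t A c)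
    (hG : ∀ u : Fin n → ℝ, u ⬝ᵥ u ≤ r ^ 2 → p + u ∈ G) (y : Fin n → ℝ) :
    r ^ 2 * (y ⬝ᵥ y) ≤ y ⬝ᵥ A *ᵥ y := by
  have hyy : 0 ≤ y ⬝ᵥ y := by
    simp only [dotProduct]; exact Finset.sum_nonneg fun i _ => mul_self_nonneg _
  rcases hyy.eq_or_lt with h0 | h0
  · rw [← h0, mul_zero]
    exact (sq_nonneg _).trans (h.mem p (by simpa using hG 0 (by simpa using sq_nonneg r)) y)
  -- The points `p + b • y` and `p - b • y` are the ends of the diameter of the ball in the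
  -- direction `y`. Adding their two inequalities eliminates the unknown centre.
  set b := r / Real.sqrt (y ⬝ᵥ y) with hb
  have hsq : Real.sqrt (y ⬝ᵥ y) ^ 2 = y ⬝ᵥ y := Real.sq_sqrt hyy
  have hsp : 0 < Real.sqrt (y ⬝ᵥ y) := Real.sqrt_pos.2 h0
  have hbb : b ^ 2 * (y ⬝ᵥ y) = r ^ 2 := by
    rw [hb, div_pow, hsq]; field_simp
  have h1 := h.mem _ (hG (b • y) (by
    rw [smul_dotProduct, dotProduct_smul, smul_eq_mul, smul_eq_mul, ← mul_assoc, ← sq, hbb])) y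
  have h2 := h.mem _ (hG (-b • y) (by
    rw [smul_dotProduct, dotProduct_smul, smul_eq_mul, smul_eq_mul, ← mul_assoc, ← sq, neg_sq,
      hbb])) y
  have e1 : y ⬝ᵥ (p + b • y - c) = y ⬝ᵥ (p - c) + b * (y ⬝ᵥ y) := by
    rw [add_sub_right_comm, dotProduct_add, dotProduct_smul, smul_eq_mul]
  have e2 : y ⬝ᵥ (p + -b • y - c) = y ⬝ᵥ (p - c) - b * (y ⬝ᵥ y) := by
    rw [add_sub_right_comm, dotProduct_add, dotProduct_smul, smul_eq_mul]; ring
  rw [e1] at h1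
  rw [e2] at h2
  have e3 : (b * (y ⬝ᵥ y)) ^ 2 = r ^ 2 * (y ⬝ᵥ y) := by rw [← hbb]; ring
  nlinarith [sq_nonneg (y ⬝ᵥ (p - c))]

/-- Testing the form on unit eigenvectors bounds every eigenvalue below by `m`, and the determinant
is their product. -/
theorem pow_le_det {A : Matrix (Fin n) (Fin n) ℝ} (hA : Aᵀ = A) {m : ℝ} (hm : 0 ≤ m)
    (h : ∀ y : Fin n → ℝ, m * (y ⬝ᵥ y) ≤ y ⬝ᵥ A *ᵥ y) : m ^ n ≤ A.det := by
  have hH : A.IsHermitian := by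
    rw [IsHermitian, conjTranspose_eq_transpose_of_trivial, hA]
  rw [hH.det_eq_prod_eigenvalues]
  have : m ^ n = ∏ _i : Fin n, m := by simp
  rw [this]
  refine Finset.prod_le_prod (fun _ _ => hm) fun i _ => ?_
  have h1 := hH.eigenvalues_eq i
  have h2 := h (hH.eigenvectorBasis i)
  have h3 : (hH.eigenvectorBasis i : Fin n → ℝ) ⬝ᵥ (hH.eigenvectorBasis i : Fin n → ℝ) = 1 := by
    have := hH.eigenvectorBasis.orthonormal.1 i
    have h4 := EuclideanSpace.real_norm_sq_eq (hH.eigenvectorBasis i)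
    rw [this] at h4
    simp only [dotProduct, ← sq]
    rw [← h4]; norm_num
  rw [h3, mul_one] at h2
  refine h2.trans (le_of_eq ?_)
  rw [h1]
  simp

/-- The ellipsoid method cannot run for long if `G` contains a ball of radius `2 ^ (-e)`. -/
theorem EllipsoidInv.time_lt (hn : 1 ≤ n) {G : Set (Fin n → ℝ)} {t e : ℕ}
    {A : Matrix (Fin n) (Fin n) ℝ} {c p : Fin n → ℝ} (h : EllipsoidInv G t A c)
    (hG : ∀ u : Fin n → ℝ, u ⬝ᵥ u ≤ ((1 / 2) ^ e) ^ 2 → p + u ∈ G) :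
    t < 32 * n * (2 * n * e + 1) := by
  by_contra! ht
  have hn0 : (0 : ℝ) < n := by exact_mod_cast hn
  have h1 := pow_le_det h.symm (sq_nonneg _) (h.sq_mul_le hG)
  -- By Bernoulli's inequality `32 * n` cuts halve the determinant, whereas the ball keeps it at
  -- least `2 ^ (-(2 * n * e))`. One further halving gives the contradiction.
  have h2 : (2 : ℝ) ^ (2 * n * e + 1) ≤ (1 + 1 / (32 * n)) ^ t := by
    have h3 : (2 : ℝ) ≤ (1 + 1 / (32 * n : ℝ)) ^ (32 * n) := by
      have h4 := one_add_mul_le_pow (a := 1 / (32 * n : ℝ))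
        (le_trans (by norm_num) (by positivity : (0 : ℝ) ≤ 1 / (32 * n))) (32 * n)
      have h5 : 1 + ((32 * n : ℕ) : ℝ) * (1 / (32 * n : ℝ)) = 2 := by
        push_cast; field_simp; norm_num
      linarith
    calc (2 : ℝ) ^ (2 * n * e + 1) ≤ ((1 + 1 / (32 * n : ℝ)) ^ (32 * n)) ^ (2 * n * e + 1) :=
          pow_le_pow_left₀ (by norm_num) h3 _
      _ = (1 + 1 / (32 * n : ℝ)) ^ (32 * n * (2 * n * e + 1)) := (pow_mul _ _ _).symm
      _ ≤ _ := pow_le_pow_right₀ (by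
          have : (0 : ℝ) ≤ 1 / (32 * n) := by positivity
          linarith) ht
  have h6 := mul_le_mul h1 h2 (by positivity) h.det_pos.le
  have h7 := h6.trans h.det_le
  have h8 : ((((1 / 2 : ℝ) ^ e) ^ 2) ^ n) * 2 ^ (2 * n * e + 1) = 2 := by
    rw [← pow_mul, ← pow_mul, pow_succ, ← mul_assoc, show e * (2 * n) = 2 * n * e by ring, ← mul_pow]
    norm_num
  rw [h8] at h7
  norm_num at h7

end TropVN

/-! ### A ball inside the normalised feasible region -/

namespace TropVN

open Matrix

variable {n : ℕ}

/-- The normalised feasible region of the system of inequalities `a j ⬝ᵥ x ≥ 0`. -/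
def feasibleRegion {ι : Type*} (a : ι → Fin n → ℤ) : Set (Fin n → ℝ) :=
  {x | x ⬝ᵥ x ≤ 1 ∧ ∀ j, 0 ≤ (fun i => (a j i : ℝ)) ⬝ᵥ x}

/-- A bounded integer solution, scaled into the ball of radius `1 / 2`, still satisfies every
inequality with slack `1 / (2 * n * W)`. A perturbation of length `r` changes the left-hand sides by
at most `n * D * r`, which the choice of `e` keeps below the slack. -/
theorem ball_subset_feasibleRegion {ι : Type*} [Fintype ι] (hn : 1 ≤ n) (a : ι → Fin n → ℤ)
    (D e : ℕ) (h1 : 1 ≤ D) (hD : ∀ j i, |a j i| ≤ D) (w : Fin n → ℝ)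
    (hw : ∀ j, 0 < ∑ i, w i * (a j i : ℝ)) (he : 2 * n ^ 2 * n.factorial * D ^ (n + 1) ≤ 2 ^ e) :
    ∃ p : Fin n → ℝ, ∀ u : Fin n → ℝ, u ⬝ᵥ u ≤ ((1 / 2) ^ e) ^ 2 → p + u ∈ feasibleRegion a := by
  obtain ⟨z, hz1, hz2⟩ := exists_bounded_feasible a D h1 hD w hw
  have hn0 : (1 : ℝ) ≤ n := by exact_mod_cast hn
  have hD0 : (1 : ℝ) ≤ D := by exact_mod_cast h1
  set W : ℝ := n.factorial * D ^ n with hW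
  have hW1 : 1 ≤ W := by
    have h2 : (1 : ℝ) ≤ n.factorial := by exact_mod_cast Nat.succ_le_of_lt (Nat.factorial_pos n)
    have h3 : (1 : ℝ) ≤ (D : ℝ) ^ n := one_le_pow₀ hD0
    nlinarith
  set r : ℝ := (1 / 2) ^ e with hr
  have hr0 : 0 < r := by positivity
  have hrW : 2 * n ^ 2 * W * D * r ≤ 1 := by
    have h2 : (2 * n ^ 2 * W * D : ℝ) ≤ 2 ^ e := by
      have h3 : ((2 * n ^ 2 * n.factorial * D ^ (n + 1) : ℕ) : ℝ) ≤ ((2 ^ e : ℕ) : ℝ) := by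
        exact_mod_cast he
      push_cast at h3
      rw [hW]
      calc _ = (2 * n ^ 2 * n.factorial * D ^ (n + 1) : ℝ) := by ring
        _ ≤ _ := h3
    calc _ ≤ (2 : ℝ) ^ e * r := mul_le_mul_of_nonneg_right h2 hr0.le
      _ = 1 := by rw [hr, ← mul_pow]; norm_num
  have hWz : ∀ i, (z i : ℝ) ^ 2 ≤ W ^ 2 := by
    intro i
    have h2 : |(z i : ℝ)| ≤ W := by
      rw [hW]; exact_mod_cast hz2 i
    exact sq_le_sq' (by linarith [abs_le.1 h2]) (abs_le.1 h2).2
  set p : Fin n → ℝ := fun i => z i / (2 * n * W) with hp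
  have hpp : p ⬝ᵥ p ≤ 1 / 4 := by
    have h2 : ∀ i ∈ Finset.univ, p i * p i ≤ 1 / (4 * n ^ 2) := fun i _ => by
      rw [hp]
      simp only
      rw [← sq, div_pow, div_le_div_iff₀ (by positivity) (by positivity)]
      have := mul_le_mul_of_nonneg_right (hWz i) (show (0 : ℝ) ≤ 4 * n ^ 2 by positivity)
      linarith
    have h3 := Finset.sum_le_card_nsmul _ _ _ h2
    refine h3.trans ?_
    rw [Finset.card_univ, Fintype.card_fin, nsmul_eq_mul, mul_one_div,
      div_le_div_iff₀ (by positivity) (by norm_num)]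
    nlinarith
  have hr2 : r * r ≤ 1 / 4 := by
    have h2 : 1 * 1 ≤ (n : ℝ) ^ 2 * (W * D) :=
      mul_le_mul (by nlinarith) (by nlinarith) (by norm_num) (by positivity)
    have h3 : r ≤ 1 / 2 := by nlinarith
    nlinarith
  refine ⟨p, fun u hu => ⟨?_, fun j => ?_⟩⟩
  · have h2 : (p + u) ⬝ᵥ (p + u) ≤ 2 * (p ⬝ᵥ p) + 2 * (u ⬝ᵥ u) := by
      simp only [dotProduct, Finset.mul_sum, ← Finset.sum_add_distrib]
      refine Finset.sum_le_sum fun i _ => ?_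
      simp only [Pi.add_apply]
      nlinarith [sq_nonneg (p i - u i)]
    nlinarith
  · set v : Fin n → ℝ := fun i => (a j i : ℝ) with hv
    have hvp : 1 / (2 * n * W) ≤ v ⬝ᵥ p := by
      have h2 : (1 : ℝ) ≤ ∑ i, (z i : ℝ) * a j i := by exact_mod_cast hz1 j
      have h3 : v ⬝ᵥ p = (∑ i, (z i : ℝ) * a j i) / (2 * n * W) := by
        rw [Finset.sum_div]
        refine Finset.sum_congr rfl fun i _ => ?_
        simp only [hp, hv]; ring
      rw [h3]
      exact div_le_div_of_nonneg_right h2 (by positivity)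
    have hvv : v ⬝ᵥ v ≤ n * D ^ 2 := by
      have h2 : ∀ i ∈ Finset.univ, v i * v i ≤ (D : ℝ) ^ 2 := fun i _ => by
        have h3 : |v i| ≤ D := by
          have := hD j i
          simp only [hv]
          exact_mod_cast this
        rw [← sq]
        exact sq_le_sq' (by linarith [abs_le.1 h3]) (abs_le.1 h3).2
      refine (Finset.sum_le_card_nsmul _ _ _ h2).trans (le_of_eq ?_)
      simp
    have hvu : (v ⬝ᵥ u) ^ 2 ≤ (n * D * r) ^ 2 := by
      have h2 : (v ⬝ᵥ u) ^ 2 ≤ (v ⬝ᵥ v) * (u ⬝ᵥ u) := by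
        have := Finset.sum_mul_sq_le_sq_mul_sq Finset.univ v u
        simpa [dotProduct, sq] using this
      have h3 : 0 ≤ u ⬝ᵥ u := by
        simp only [dotProduct]; exact Finset.sum_nonneg fun i _ => mul_self_nonneg _
      calc _ ≤ _ := h2
        _ ≤ (n * D ^ 2) * r ^ 2 := mul_le_mul hvv hu h3 (by positivity)
        _ ≤ (n ^ 2 * D ^ 2) * r ^ 2 := by
            have : (n : ℝ) ≤ n ^ 2 := by nlinarith
            gcongr
        _ = _ := by ring
    have h4 := (abs_le_of_sq_le_sq' hvu (by positivity)).1
    have h5 : n * D * r ≤ 1 / (2 * n * W) := by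
      rw [le_div_iff₀ (by positivity)]
      linarith
    rw [dotProduct_add]
    linarith

/-- The crude estimate `m ≤ 2 ^ m` replaces logarithms. The exponent becomes a polynomial that the
program evaluates directly, and the number of iterations remains polynomial. -/
theorem radius_exponent_le (n D : ℕ) :
    2 * n ^ 2 * n.factorial * D ^ (n + 1) ≤ 2 ^ ((n + 2) * (n + D + 2)) := by
  have h1 : ∀ m : ℕ, m ≤ 2 ^ m := fun m => Nat.lt_two_pow_self.le
  calc 2 * n ^ 2 * n.factorial * D ^ (n + 1)
      ≤ 2 * (2 ^ n) ^ 2 * (2 ^ n) ^ n * (2 ^ D) ^ (n + 1) := by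
        gcongr
        · exact h1 n
        · exact (Nat.factorial_le_pow n).trans (Nat.pow_le_pow_left (h1 n) n)
        · exact h1 D
    _ = 2 ^ (1 + n * 2 + n * n + D * (n + 1)) := by
        rw [← pow_mul, ← pow_mul, ← pow_mul, pow_add, pow_add, pow_add, pow_one]
    _ ≤ _ := Nat.pow_le_pow_right (by norm_num) (by nlinarith)

end TropVN

namespace TropVN

/-! ### A small imperative language with bounded loops -/

/-- Program variables; `n` and `k` are the registers that hold the input. -/
inductive Var
  | n | k | i | p | q | c | e | t
  | cnt | len | off | bound | expo | iters | doublings | base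
  | found | viol | gam | del | quad | scale | den | out
  deriving DecidableEq

/-- The register that stores a variable. -/
def Var.idx : Var → ℕ
  | .n => 0 | .k => 1 | .i => 2 | .p => 3 | .q => 4 | .c => 5 | .e => 6 | .t => 7
  | .cnt => 8 | .len => 9 | .off => 10 | .bound => 11 | .expo => 12 | .iters => 13
  | .doublings => 14 | .base => 15 | .found => 16 | .viol => 17 | .gam => 18 | .del => 19
  | .quad => 20 | .scale => 21 | .den => 22 | .out => 23

theorem Var.idx_lt (x : Var) : x.idx < 24 := by cases x <;> decide

theorem Var.idx_injective : Function.Injective Var.idx := by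
  intro x y h
  cases x <;> cases y <;> first | rfl | exact absurd h (by decide)

/-- Values of the variables and contents of the arrays. -/
structure Env where
  reg : Var → ℤ
  arr : ℕ → ℕ → ℤ

/-- Assign a value to a variable. -/
def Env.set (s : Env) (x : Var) (v : ℤ) : Env := { s with reg := Function.update s.reg x v }

/-- Assign a value to an array cell. -/
def Env.setArr (s : Env) (a j : ℕ) (v : ℤ) : Env :=
  { s with arr := Function.update s.arr a (Function.update (s.arr a) j v) }

/-- Integer expressions; `sum x m f` is the sum of `f` for `x = 0, …, m - 1`. -/
inductive Expr
  | lit (c : ℤ)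
  | var (x : Var)
  | op (o : ArithOp) (f g : Expr)
  | get (a : ℕ) (f : Expr)
  | le (f g : Expr)
  | sum (x : Var) (m f : Expr)

/-- The value of an expression. -/
def Expr.eval : Expr → Env → ℤ
  | .lit c, _ => c
  | .var x, s => s.reg x
  | .op o f g, s => o.eval (f.eval s) (g.eval s)
  | .get a f, s => s.arr a (f.eval s).toNat
  | .le f g, s => if f.eval s ≤ g.eval s then 1 else 0
  | .sum x m f, s => ∑ j ∈ Finset.range (m.eval s).toNat, f.eval (s.set x j)

/-- The number of steps that the evaluation of an expression takes. -/
def Expr.cost : Expr → Env → ℕ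
  | .lit _, _ => 1
  | .var _, _ => 2
  | .op _ f g, s => f.cost s + (g.cost s + 1)
  | .get _ f, s => f.cost s + 1
  | .le f g, s => f.cost s + (g.cost s + 2)
  | .sum x m f, s =>
    m.cost s + (∑ j ∈ Finset.range (m.eval s).toNat, (f.cost (s.set x j) + 5 + 1) + 8)

/-- Commands; `loop x m c` runs `c` for `x = 0, …, m - 1`. -/
inductive Cmd
  | assign (x : Var) (f : Expr)
  | store (a : ℕ) (f g : Expr)
  | seq (c c' : Cmd)
  | ite (f g : Expr) (c c' : Cmd)
  | loop (x : Var) (m : Expr) (c : Cmd)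

/-- Run `F 0`, …, `F (m - 1)` one after the other. -/
def iter (F : ℕ → Env → Env) (m : ℕ) (s : Env) : Env := Nat.rec s (fun j s' => F j s') m

/-- The effect of a command. -/
def Cmd.eval : Cmd → Env → Env
  | .assign x f, s => s.set x (f.eval s)
  | .store a f g, s => s.setArr a (f.eval s).toNat (g.eval s)
  | .seq c c', s => c'.eval (c.eval s)
  | .ite f g c c', s => if f.eval s ≤ g.eval s then c.eval s else c'.eval s
  | .loop x m c, s => iter (fun j s' => c.eval (s'.set x j)) (m.eval s).toNat s

/-- The number of steps that a command takes. -/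
def Cmd.cost : Cmd → Env → ℕ
  | .assign _ f, s => f.cost s + 2
  | .store _ f g, s => f.cost s + (g.cost s + 1)
  | .seq c c', s => c.cost s + c'.cost (c.eval s)
  | .ite f g c c', s =>
    f.cost s + (g.cost s + ((if f.eval s ≤ g.eval s then c.cost s else c'.cost s) + 1))
  | .loop x m c, s => m.cost s + (∑ j ∈ Finset.range (m.eval s).toNat,
      (c.cost ((iter (fun j s' => c.eval (s'.set x j)) j s).set x j) + 4 + 1) + 2)

/-! ### Compilation -/

/-- Code that puts the value of an expression into register `b`, using only registers from `b`
on. -/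
def Expr.compile : Expr → ℕ → Prog
  | .lit c, b => .const b c
  | .var x, b => .seq (.const (b + 1) 0) (.arith .add b x.idx (b + 1))
  | .op o f g, b => .seq (f.compile b) (.seq (g.compile (b + 1)) (.arith o b b (b + 1)))
  | .get a f, b => .seq (f.compile b) (.load b a b)
  | .le f g, b => .seq (f.compile b) (.seq (g.compile (b + 1))
      (.cond b (b + 1) (.const b 1) (.const b 0)))
  | .sum x m f, b =>
    .seq (m.compile b) (.seq (.const (b + 1) 1) (.seq (.const (b + 2) 0) (.seq (.const (b + 4) 0)
      (.seq (.arith .add (b + 3) x.idx (b + 4)) (.seq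
        (.loop (b + 1) b
          (.seq (.const (b + 4) 1) (.seq (.arith .sub x.idx (b + 1) (b + 4))
            (.seq (f.compile (b + 4)) (.seq (.arith .add (b + 2) (b + 2) (b + 4))
              (.seq (.const (b + 4) 1) (.arith .add (b + 1) (b + 1) (b + 4))))))))
        (.seq (.const (b + 4) 0) (.seq (.arith .add x.idx (b + 3) (b + 4))
          (.arith .add b (b + 2) (b + 4)))))))))

/-- Code for a command that uses only the variables and registers from `b` on. -/
def Cmd.compile : Cmd → ℕ → Prog
  | .assign x f, b => .seq (f.compile b) (.seq (.const (b + 1) 0) (.arith .add x.idx b (b + 1)))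
  | .store a f g, b => .seq (f.compile b) (.seq (g.compile (b + 1)) (.store a b (b + 1)))
  | .seq c c', b => .seq (c.compile b) (c'.compile b)
  | .ite f g c c', b => .seq (f.compile b) (.seq (g.compile (b + 1))
      (.cond b (b + 1) (c.compile b) (c'.compile b)))
  | .loop x m c, b => .seq (m.compile b) (.seq (.const (b + 1) 1) (.loop (b + 1) b
      (.seq (.const (b + 2) 1) (.seq (.arith .sub x.idx (b + 1) (b + 2)) (.seq (c.compile (b + 2))
        (.seq (.const (b + 2) 1) (.arith .add (b + 1) (b + 1) (b + 2))))))))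

/-- With any random bits, `p` halts from `σ` after exactly `t` steps, in a state that satisfies
`Q` and does not depend on the random bits. -/
def Runs (p : Prog) (σ : State) (t : ℕ) (Q : State → Prop) : Prop :=
  ∃ τ, (∀ ω, Exec ω p σ τ t) ∧ Q τ

theorem Runs.seq {p q : Prog} {σ : State} {t u : ℕ} {Q : State → Prop}
    (h : Runs p σ t fun σ' => Runs q σ' u Q) : Runs (.seq p q) σ (t + u) Q := by
  obtain ⟨σ', h1, τ, h2, hQ⟩ := h
  exact ⟨τ, fun ω => (h1 ω).seq (h2 ω), hQ⟩

theorem Runs.mono {p : Prog} {σ : State} {t : ℕ} {Q Q' : State → Prop} (h : Runs p σ t Q)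
    (hQ : ∀ τ, Q τ → Q' τ) : Runs p σ t Q' := by
  obtain ⟨τ, h1, h2⟩ := h
  exact ⟨τ, h1, hQ τ h2⟩

theorem Runs.const {x : ℕ} {v : ℤ} {σ : State} {Q : State → Prop} (h : Q (σ.setReg x v)) :
    Runs (.const x v) σ 1 Q := ⟨_, fun _ => .const x v σ, h⟩

theorem Runs.arith {o : ArithOp} {x y z : ℕ} {σ : State} {Q : State → Prop}
    (h : Q (σ.setReg x (o.eval (σ.reg y) (σ.reg z)))) : Runs (.arith o x y z) σ 1 Q :=
  ⟨_, fun _ => .arith o x y z σ, h⟩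

theorem Runs.loop {p : Prog} {x y : ℕ} (I : ℕ → State → Prop) (m : ℕ) (cost : ℕ → ℕ)
    (hstep : ∀ j < m, ∀ σ, I j σ → σ.reg x ≤ σ.reg y ∧ Runs p σ (cost j) (I (j + 1)))
    (hexit : ∀ σ, I m σ → ¬ σ.reg x ≤ σ.reg y) {σ : State} (h0 : I 0 σ) :
    Runs (.loop x y p) σ (∑ j ∈ Finset.range m, (cost j + 1) + 1) (I m) := by
  -- Induction on the number `r` of remaining rounds, since the execution relation unfolds a loop
  -- from its first round.
  have key : ∀ r ≤ m, ∀ σ, I (m - r) σ →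
      Runs (.loop x y p) σ (∑ j ∈ Finset.Ico (m - r) m, (cost j + 1) + 1) (I m) := by
    intro r
    induction r with
    | zero =>
      intro _ σ hσ
      exact ⟨σ, fun ω => by simpa using Exec.loop_exit (hexit σ hσ), hσ⟩
    | succ r ih =>
      intro hr σ hσ
      obtain ⟨hle, σ', h1, h2⟩ := hstep (m - (r + 1)) (by omega) σ hσ
      have e : m - (r + 1) + 1 = m - r := by omega
      rw [e] at h2
      obtain ⟨τ, h3, h4⟩ := ih (by omega) σ' h2
      refine ⟨τ, fun ω => ?_, h4⟩
      have h5 := Exec.loop_step hle (h1 ω) (h3 ω)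
      rw [Finset.sum_eq_sum_Ico_succ_bot (by omega), e]
      convert h5 using 1
      ring
  have := key m le_rfl σ (by simpa using h0)
  simpa using this

/-- The machine state `σ` represents the environment `s`. -/
def Agree (σ : State) (s : Env) : Prop := (∀ x : Var, σ.reg x.idx = s.reg x) ∧ σ.arr = s.arr

/-- `τ` represents `s`, and agrees with `σ` on the hidden registers below `b`. -/
structure Sim (b : ℕ) (σ : State) (s : Env) (τ : State) : Prop where
  agree : Agree τ s
  frame : ∀ y, 24 ≤ y → y < b → τ.reg y = σ.reg y
  used : τ.used = σ.used

theorem State.reg_setReg (σ : State) (x y : ℕ) (v : ℤ) :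
    (σ.setReg x v).reg y = if y = x then v else σ.reg y := by
  simp [State.setReg, Function.update_apply]

theorem Sim.trans {b b' : ℕ} {σ σ' τ : State} {s s' : Env} (h : Sim b σ s σ')
    (h' : Sim b' σ' s' τ) (hb : b ≤ b') : Sim b σ s' τ :=
  ⟨h'.agree, fun y h1 h2 => (h'.frame y h1 (h2.trans_le hb)).trans (h.frame y h1 h2),
    h'.used.trans h.used⟩

theorem Sim.refl {b : ℕ} {σ : State} {s : Env} (h : Agree σ s) : Sim b σ s σ :=
  ⟨h, fun _ _ _ => rfl, rfl⟩

theorem Sim.setReg {b r : ℕ} {σ τ : State} {s : Env} (h : Sim b σ s τ) (hr : b ≤ r) (hb : 24 ≤ b)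
    (v : ℤ) : Sim b σ s (τ.setReg r v) where
  agree := ⟨fun x => by
    have := x.idx_lt
    rw [State.reg_setReg, if_neg (by omega)]
    exact h.agree.1 x, h.agree.2⟩
  frame y h1 h2 := by
    rw [State.reg_setReg, if_neg (by omega)]
    exact h.frame y h1 h2
  used := h.used

theorem Sim.setVar {b : ℕ} {σ τ : State} {s : Env} (h : Sim b σ s τ) (x : Var) (v : ℤ) :
    Sim b σ (s.set x v) (τ.setReg x.idx v) where
  agree := ⟨fun y => by
    simp only [State.setReg, Env.set, Function.update_apply, Var.idx_injective.eq_iff]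
    rw [h.agree.1 y], h.agree.2⟩
  frame y h1 h2 := by
    have := x.idx_lt
    rw [State.reg_setReg, if_neg (by omega)]
    exact h.frame y h1 h2
  used := h.used

theorem Env.set_set (s : Env) (x : Var) (v v' : ℤ) : (s.set x v).set x v' = s.set x v' := by
  simp [Env.set]

theorem Env.set_self (s : Env) (x : Var) : s.set x (s.reg x) = s := by
  simp [Env.set]

/-- Registers from `b` on are scratch space and those below belong to enclosing expressions and
commands, so the induction must preserve the latter. Variables keep their values as well: a sum
restores its summation variable at the end. -/
theorem Expr.compile_runs (f : Expr) : ∀ (b : ℕ) (σ : State) (s : Env), 24 ≤ b → Agree σ s →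
    Runs (f.compile b) σ (f.cost s) fun τ => Sim b σ s τ ∧ τ.reg b = f.eval s := by
  induction f with
  | lit c =>
    intro b σ s hb h
    exact Runs.const ⟨(Sim.refl h).setReg le_rfl hb _, by simp [State.reg_setReg, Expr.eval]⟩
  | var x =>
    intro b σ s hb h
    have hx := x.idx_lt
    refine Runs.seq (t := 1) (u := 1) (Runs.const (Runs.arith ⟨?_, ?_⟩))
    · exact ((Sim.refl h).setReg (by omega) hb _).setReg le_rfl hb _
    · simp only [State.reg_setReg, if_true, ArithOp.eval, Expr.eval]
      rw [if_neg (by omega), h.1 x, add_zero]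
  | op o f g ihf ihg =>
    intro b σ s hb h
    refine Runs.seq ((ihf b σ s hb h).mono fun σ₁ h1 => ?_)
    refine Runs.seq ((ihg (b + 1) σ₁ s (by omega) h1.1.agree).mono fun σ₂ h2 => ?_)
    refine Runs.arith ⟨(h1.1.trans h2.1 (by omega)).setReg le_rfl hb _, ?_⟩
    rw [State.reg_setReg, if_pos rfl, h2.2, h2.1.frame b hb (by omega), h1.2, Expr.eval]
  | get a f ih =>
    intro b σ s hb h
    refine Runs.seq ((ih b σ s hb h).mono fun σ₁ h1 => ⟨_, fun _ => .load b a b σ₁, ?_, ?_⟩)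
    · exact h1.1.setReg le_rfl hb _
    · rw [State.reg_setReg, if_pos rfl, h1.2, h1.1.agree.2, Expr.eval]
  | le f g ihf ihg =>
    intro b σ s hb h
    refine Runs.seq ((ihf b σ s hb h).mono fun σ₁ h1 => ?_)
    refine Runs.seq ((ihg (b + 1) σ₁ s (by omega) h1.1.agree).mono fun σ₂ h2 => ?_)
    have hb2 : σ₂.reg b = f.eval s := by rw [h2.1.frame b hb (by omega), h1.2]
    have hsim := h1.1.trans h2.1 (by omega)
    by_cases hle : f.eval s ≤ g.eval s
    · refine ⟨_, fun ω => .cond_true (by rw [hb2, h2.2]; exact hle) (.const b 1 σ₂),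
        hsim.setReg le_rfl hb _, ?_⟩
      rw [State.reg_setReg, if_pos rfl, Expr.eval, if_pos hle]
    · refine ⟨_, fun ω => .cond_false (by rw [hb2, h2.2]; exact hle) (.const b 0 σ₂),
        hsim.setReg le_rfl hb _, ?_⟩
      rw [State.reg_setReg, if_pos rfl, Expr.eval, if_neg hle]
  | sum x m f ihm ihf =>
    intro b σ s hb h
    have hx := x.idx_lt
    set M := (m.eval s).toNat with hM
    set S : ℕ → ℤ := fun j => ∑ i ∈ Finset.range j, f.eval (s.set x i) with hS
    have hcost : Expr.cost (.sum x m f) s = m.cost s + (1 + (1 + (1 + (1 +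
        ((∑ j ∈ Finset.range M, ((1 + (1 + (f.cost (s.set x j) + (1 + (1 + 1))))) + 1) + 1)
          + (1 + (1 + 1))))))) := by
      have : ∀ j, 1 + (1 + (f.cost (s.set x j) + (1 + (1 + 1)))) + 1 =
          f.cost (s.set x j) + 5 + 1 := fun j => by ring
      simp only [Expr.cost, this]
      ring
    rw [hcost]
    refine Runs.seq ((ihm b σ s hb h).mono fun σ₁ h1 => ?_)
    -- Register `b` holds the number of terms, `b + 1` the index plus one, `b + 2` the partial sum
    -- and `b + 3` the saved value of the summation variable. The shift by one turns the machine
    -- test `≤` into the strict test `j < m`, and a nonpositive `m` gives no rounds.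
    refine Runs.seq (Runs.const (Runs.seq (Runs.const (Runs.seq (Runs.const (Runs.seq
      (Runs.arith (Runs.seq (Runs.mono (Runs.loop (fun j τ => (∃ v, Sim b σ (s.set x v) τ) ∧
        τ.reg b = m.eval s ∧ τ.reg (b + 1) = j + 1 ∧ τ.reg (b + 2) = S j ∧
        τ.reg (b + 3) = s.reg x) M _ ?_ ?_ ?_) ?_)))))))))
    · rintro j hj τ ⟨⟨v, hv⟩, hb0, hb1, hb2, hb3⟩
      refine ⟨by omega, ?_⟩
      have hv' : Sim b σ (s.set x j) ((τ.setReg (b + 4) 1).setReg x.idx j) := by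
        have := (hv.setReg (r := b + 4) (by omega) hb 1).setVar x j
        rwa [Env.set_set] at this
      have hval : ArithOp.eval .sub ((τ.setReg (b + 4) 1).reg (b + 1))
          ((τ.setReg (b + 4) 1).reg (b + 4)) = j := by
        simp [State.reg_setReg, ArithOp.eval, hb1]
      refine Runs.seq (Runs.const (Runs.seq (Runs.arith ?_)))
      rw [hval]
      refine Runs.seq ((ihf (b + 4) _ (s.set x j) (by omega) hv'.agree).mono fun τ' h' => ?_)
      have hr : ∀ r, r < 4 → τ'.reg (b + r) = τ.reg (b + r) := fun r hr => by
        rw [h'.1.frame (b + r) (by omega) (by omega), State.reg_setReg, if_neg (by omega),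
          State.reg_setReg, if_neg (by omega)]
      have hr0 := hr 0 (by omega)
      rw [add_zero] at hr0
      refine Runs.seq (Runs.arith (Runs.seq (Runs.const (Runs.arith ⟨⟨j, ?_⟩, ?_⟩))))
      · exact (((hv'.trans h'.1 (by omega)).setReg (by omega) hb _).setReg (by omega) hb _).setReg
          (by omega) hb _
      · simp only [State.reg_setReg, ArithOp.eval]
        simp only [Nat.add_left_cancel_iff, Nat.reduceEqDiff, if_false, if_true,
          show b ≠ b + 1 by omega, show b ≠ b + 4 by omega, show b ≠ b + 2 by omega]
        rw [hr0, hr 1 (by omega), hr 2 (by omega), hr 3 (by omega), h'.2, hb0, hb1, hb2, hb3]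
        refine ⟨rfl, by push_cast; ring, ?_, rfl⟩
        simp only [hS, Finset.sum_range_succ]
    · rintro τ ⟨-, hb0, hb1, -, -⟩
      omega
    · refine ⟨⟨s.reg x, ?_⟩, ?_⟩
      · rw [Env.set_self]
        exact (((h1.1.setReg (by omega) hb _).setReg (by omega) hb _).setReg
          (by omega) hb _).setReg (by omega) hb _
      · simp [State.reg_setReg, ArithOp.eval, hS, h1.2, show x.idx ≠ b + 4 by omega,
          show x.idx ≠ b + 1 by omega, show x.idx ≠ b + 2 by omega, h1.1.agree.1 x]
    · rintro τ ⟨⟨v, hv⟩, hb0, hb1, hb2, hb3⟩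
      refine Runs.seq (Runs.const (Runs.seq (Runs.arith (Runs.arith ⟨?_, ?_⟩))))
      · have h3 := (hv.setReg (r := b + 4) (by omega) hb 0).setVar x (s.reg x)
        rw [Env.set_set, Env.set_self] at h3
        have hval : ArithOp.eval .add ((τ.setReg (b + 4) 0).reg (b + 3))
            ((τ.setReg (b + 4) 0).reg (b + 4)) = s.reg x := by
          simp [State.reg_setReg, ArithOp.eval, hb3]
        rw [hval]
        exact h3.setReg le_rfl hb _
      · simp [State.reg_setReg, ArithOp.eval, hb2,
          show b + 4 ≠ x.idx by omega, show b + 2 ≠ x.idx by omega, hS, Expr.eval, hM]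

/-- The cost function is exact, and the final state is the same for all random bits; this is what
makes the program deterministic. -/
theorem Cmd.compile_runs (c : Cmd) : ∀ (b : ℕ) (σ : State) (s : Env), 24 ≤ b → Agree σ s →
    Runs (c.compile b) σ (c.cost s) fun τ => Sim b σ (c.eval s) τ := by
  induction c with
  | assign x f =>
    intro b σ s hb h
    have hx := x.idx_lt
    refine Runs.seq ((f.compile_runs b σ s hb h).mono fun σ₁ h1 => ?_)
    refine Runs.seq (t := 1) (u := 1) (Runs.const (Runs.arith ?_))
    have hval : ArithOp.eval .add ((σ₁.setReg (b + 1) 0).reg b)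
        ((σ₁.setReg (b + 1) 0).reg (b + 1)) = f.eval s := by
      simp [State.reg_setReg, ArithOp.eval, h1.2]
    rw [hval]
    exact (h1.1.setReg (by omega) hb _).setVar x _
  | store a f g =>
    intro b σ s hb h
    refine Runs.seq ((f.compile_runs b σ s hb h).mono fun σ₁ h1 => ?_)
    refine Runs.seq ((g.compile_runs (b + 1) σ₁ s (by omega) h1.1.agree).mono fun σ₂ h2 => ?_)
    refine ⟨_, fun _ => .store a b (b + 1) σ₂, ?_⟩
    have hsim := h1.1.trans h2.1 (by omega)
    rw [h2.2, h2.1.frame b hb (by omega), h1.2]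
    refine ⟨⟨hsim.agree.1, ?_⟩, hsim.frame, hsim.used⟩
    simp only [State.setArr, Cmd.eval, Env.setArr, hsim.agree.2]
  | seq c c' ih ih' =>
    intro b σ s hb h
    exact Runs.seq ((ih b σ s hb h).mono fun σ₁ h1 =>
      (ih' b σ₁ _ hb h1.agree).mono fun τ h2 => h1.trans h2 le_rfl)
  | ite f g c c' ih ih' =>
    intro b σ s hb h
    refine Runs.seq ((f.compile_runs b σ s hb h).mono fun σ₁ h1 => ?_)
    refine Runs.seq ((g.compile_runs (b + 1) σ₁ s (by omega) h1.1.agree).mono fun σ₂ h2 => ?_)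
    have hb2 : σ₂.reg b = f.eval s := by rw [h2.1.frame b hb (by omega), h1.2]
    have hsim := h1.1.trans h2.1 (by omega)
    by_cases hle : f.eval s ≤ g.eval s
    · obtain ⟨τ, h3, h4⟩ := ih b σ₂ s hb hsim.agree
      refine ⟨τ, fun ω => ?_, ?_⟩
      · rw [if_pos hle]
        exact .cond_true (by rw [hb2, h2.2]; exact hle) (h3 ω)
      · rw [Cmd.eval, if_pos hle]; exact hsim.trans h4 le_rfl
    · obtain ⟨τ, h3, h4⟩ := ih' b σ₂ s hb hsim.agree
      refine ⟨τ, fun ω => ?_, ?_⟩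
      · rw [if_neg hle]
        exact .cond_false (by rw [hb2, h2.2]; exact hle) (h3 ω)
      · rw [Cmd.eval, if_neg hle]; exact hsim.trans h4 le_rfl
  | loop x m c ih =>
    intro b σ s hb h
    have hx := x.idx_lt
    set M := (m.eval s).toNat with hM
    set E : ℕ → Env := fun j => iter (fun j s' => c.eval (s'.set x j)) j s with hE
    have hcost : Cmd.cost (.loop x m c) s = m.cost s + (1 +
        (∑ j ∈ Finset.range M, ((1 + (1 + (c.cost ((E j).set x j) + (1 + 1)))) + 1) + 1)) := by
      have : ∀ j : ℕ, 1 + (1 + (c.cost ((E j).set x j) + (1 + 1))) + 1 =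
          c.cost ((E j).set x j) + 4 + 1 := fun j => by ring
      simp only [Cmd.cost, this]
      ring
    rw [hcost]
    refine Runs.seq ((m.compile_runs b σ s hb h).mono fun σ₁ h1 => ?_)
    refine Runs.seq (Runs.const (Runs.mono (Runs.loop (fun j τ => Sim b σ (E j) τ ∧
        τ.reg b = m.eval s ∧ τ.reg (b + 1) = j + 1) M _ ?_ ?_ ?_) fun τ hτ => hτ.1))
    · rintro j hj τ ⟨hv, hb0, hb1⟩
      refine ⟨by omega, ?_⟩
      have hv' := (hv.setReg (r := b + 2) (by omega) hb 1).setVar x j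
      have hval : ArithOp.eval .sub ((τ.setReg (b + 2) 1).reg (b + 1))
          ((τ.setReg (b + 2) 1).reg (b + 2)) = j := by
        simp [State.reg_setReg, ArithOp.eval, hb1]
      refine Runs.seq (Runs.const (Runs.seq (Runs.arith ?_)))
      rw [hval]
      refine Runs.seq ((ih (b + 2) _ ((E j).set x j) (by omega) hv'.agree).mono fun τ' h' => ?_)
      have hr : ∀ r, r < 2 → τ'.reg (b + r) = τ.reg (b + r) := fun r hr => by
        rw [h'.frame (b + r) (by omega) (by omega), State.reg_setReg, if_neg (by omega),
          State.reg_setReg, if_neg (by omega)]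
      have hr0 := hr 0 (by omega)
      rw [add_zero] at hr0
      refine Runs.seq (Runs.const (Runs.arith ⟨?_, ?_⟩))
      · exact ((hv'.trans h' (by omega)).setReg (by omega) hb _).setReg (by omega) hb _
      · simp only [State.reg_setReg, ArithOp.eval]
        simp only [Nat.add_left_cancel_iff, Nat.reduceEqDiff, if_false, if_true,
          show b ≠ b + 1 by omega, show b ≠ b + 2 by omega]
        rw [hr0, hr 1 (by omega), hb0, hb1]
        exact ⟨rfl, by push_cast; ring⟩
    · rintro τ ⟨-, hb0, hb1⟩
      omega
    · exact ⟨h1.1.setReg (by omega) hb _, by simp [State.reg_setReg, h1.2],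
        by simp [State.reg_setReg]⟩

end TropVN

namespace TropVN

/-! ### Reasoning about programs -/

instance : Add Expr := ⟨.op .add⟩
instance : Sub Expr := ⟨.op .sub⟩
instance : Mul Expr := ⟨.op .mul⟩

@[simp] theorem Expr.eval_add (f g : Expr) (s : Env) : (f + g).eval s = f.eval s + g.eval s := rfl
@[simp] theorem Expr.eval_sub (f g : Expr) (s : Env) : (f - g).eval s = f.eval s - g.eval s := rfl
@[simp] theorem Expr.eval_mul (f g : Expr) (s : Env) : (f * g).eval s = f.eval s * g.eval s := rfl
@[simp] theorem Expr.eval_lit (c : ℤ) (s : Env) : (Expr.lit c).eval s = c := rfl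
@[simp] theorem Expr.eval_var (x : Var) (s : Env) : (Expr.var x).eval s = s.reg x := rfl
@[simp] theorem Expr.eval_get (a : ℕ) (f : Expr) (s : Env) :
    (Expr.get a f).eval s = s.arr a (f.eval s).toNat := rfl
@[simp] theorem Expr.eval_le (f g : Expr) (s : Env) :
    (Expr.le f g).eval s = if f.eval s ≤ g.eval s then 1 else 0 := rfl
@[simp] theorem Expr.eval_sum (x : Var) (m f : Expr) (s : Env) : (Expr.sum x m f).eval s =
    ∑ j ∈ Finset.range (m.eval s).toNat, f.eval (s.set x j) := rfl

@[simp] theorem Expr.cost_add (f g : Expr) (s : Env) :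
    (f + g).cost s = f.cost s + (g.cost s + 1) := rfl
@[simp] theorem Expr.cost_sub (f g : Expr) (s : Env) :
    (f - g).cost s = f.cost s + (g.cost s + 1) := rfl
@[simp] theorem Expr.cost_mul (f g : Expr) (s : Env) :
    (f * g).cost s = f.cost s + (g.cost s + 1) := rfl
@[simp] theorem Expr.cost_lit (c : ℤ) (s : Env) : (Expr.lit c).cost s = 1 := rfl
@[simp] theorem Expr.cost_var (x : Var) (s : Env) : (Expr.var x).cost s = 2 := rfl
@[simp] theorem Expr.cost_get (a : ℕ) (f : Expr) (s : Env) :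
    (Expr.get a f).cost s = f.cost s + 1 := rfl
@[simp] theorem Expr.cost_le (f g : Expr) (s : Env) :
    (Expr.le f g).cost s = f.cost s + (g.cost s + 2) := rfl
@[simp] theorem Expr.cost_sum (x : Var) (m f : Expr) (s : Env) : (Expr.sum x m f).cost s =
    m.cost s + (∑ j ∈ Finset.range (m.eval s).toNat, (f.cost (s.set x j) + 5 + 1) + 8) := rfl

@[simp] theorem Env.reg_set (s : Env) (x y : Var) (v : ℤ) :
    (s.set x v).reg y = if y = x then v else s.reg y := by
  simp [Env.set, Function.update_apply]
@[simp] theorem Env.arr_set (s : Env) (x : Var) (v : ℤ) : (s.set x v).arr = s.arr := rfl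
theorem Env.arr_setArr (s : Env) (a j a' j' : ℕ) (v : ℤ) :
    (s.setArr a j v).arr a' j' = if a' = a ∧ j' = j then v else s.arr a' j' := by
  by_cases h : a' = a
  · subst h; simp [Env.setArr, Function.update_apply]
  · simp [Env.setArr, h]

@[simp] theorem Cmd.eval_assign (x : Var) (f : Expr) (s : Env) :
    (Cmd.assign x f).eval s = s.set x (f.eval s) := rfl
@[simp] theorem Cmd.eval_seq (c c' : Cmd) (s : Env) :
    (Cmd.seq c c').eval s = c'.eval (c.eval s) := rfl
@[simp] theorem Cmd.eval_ite (f g : Expr) (c c' : Cmd) (s : Env) : (Cmd.ite f g c c').eval s =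
    if f.eval s ≤ g.eval s then c.eval s else c'.eval s := rfl

theorem Cmd.cost_assign (x : Var) (f : Expr) (s : Env) :
    (Cmd.assign x f).cost s = f.cost s + 2 := rfl
theorem Cmd.cost_store (a : ℕ) (f g : Expr) (s : Env) :
    (Cmd.store a f g).cost s = f.cost s + (g.cost s + 1) := rfl
theorem Cmd.cost_seq (c c' : Cmd) (s : Env) :
    (Cmd.seq c c').cost s = c.cost s + c'.cost (c.eval s) := rfl
theorem Cmd.cost_ite (f g : Expr) (c c' : Cmd) (s : Env) : (Cmd.ite f g c c').cost s =
    f.cost s + (g.cost s + ((if f.eval s ≤ g.eval s then c.cost s else c'.cost s) + 1)) := rfl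

/-- The variables that a command may change. -/
def Cmd.vars : Cmd → List Var
  | .assign x _ => [x]
  | .store _ _ _ => []
  | .seq c c' => c.vars ++ c'.vars
  | .ite _ _ c c' => c.vars ++ c'.vars
  | .loop x _ c => x :: c.vars

/-- The arrays that a command may change. -/
def Cmd.arrs : Cmd → List ℕ
  | .assign _ _ => []
  | .store a _ _ => [a]
  | .seq c c' => c.arrs ++ c'.arrs
  | .ite _ _ c c' => c.arrs ++ c'.arrs
  | .loop _ _ c => c.arrs

/-- `s'` differs from `s` only in the variables `X` and the arrays `Y`. -/
def Frame (X : List Var) (Y : List ℕ) (s s' : Env) : Prop :=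
  (∀ x ∉ X, s'.reg x = s.reg x) ∧ ∀ a ∉ Y, s'.arr a = s.arr a

theorem Frame.refl (X : List Var) (Y : List ℕ) (s : Env) : Frame X Y s s :=
  ⟨fun _ _ => rfl, fun _ _ => rfl⟩

theorem Frame.trans {X : List Var} {Y : List ℕ} {s s' s'' : Env} (h : Frame X Y s s')
    (h' : Frame X Y s' s'') : Frame X Y s s'' :=
  ⟨fun x hx => (h'.1 x hx).trans (h.1 x hx), fun a ha => (h'.2 a ha).trans (h.2 a ha)⟩

theorem Frame.mono {X X' : List Var} {Y Y' : List ℕ} {s s' : Env} (h : Frame X Y s s')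
    (hX : X ⊆ X') (hY : Y ⊆ Y') : Frame X' Y' s s' :=
  ⟨fun x hx => h.1 x fun h' => hx (hX h'), fun a ha => h.2 a fun h' => ha (hY h')⟩

theorem Frame.set {X : List Var} {Y : List ℕ} {s s' : Env} (h : Frame X Y s s') {x : Var}
    (hx : x ∈ X) (v : ℤ) : Frame X Y s (s'.set x v) :=
  ⟨fun y hy => by
    rw [Env.reg_set, if_neg (fun h' : y = x => hy (h' ▸ hx))]
    exact h.1 y hy, h.2⟩

theorem iter_induct {F : ℕ → Env → Env} {m : ℕ} {s : Env} (I : ℕ → Env → Prop) (h0 : I 0 s)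
    (h : ∀ j < m, ∀ s', I j s' → I (j + 1) (F j s')) : I m (iter F m s) := by
  induction m with
  | zero => exact h0
  | succ m ih => exact h m (by omega) _ (ih fun j hj => h j (by omega))

theorem iter_frame {x : Var} {c : Cmd} {X : List Var} {Y : List ℕ} (hx : x ∈ X)
    (hc : ∀ s, Frame X Y s (c.eval s)) (m : ℕ) (s : Env) :
    Frame X Y s (iter (fun j s' => c.eval (s'.set x j)) m s) :=
  iter_induct (fun _ s' => Frame X Y s s') (Frame.refl _ _ _) fun _ _ _ h =>
    (h.set hx _).trans (hc _)

theorem Cmd.frame (c : Cmd) : ∀ s, Frame c.vars c.arrs s (c.eval s) := by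
  induction c with
  | assign x f => intro s; exact (Frame.refl _ _ _).set (by simp [Cmd.vars]) _
  | store a f g =>
    intro s
    refine ⟨fun _ _ => rfl, fun a' ha => ?_⟩
    funext j
    rw [Cmd.eval, Env.arr_setArr, if_neg]
    simp only [Cmd.arrs, List.mem_singleton] at ha
    exact fun h => ha h.1
  | seq c c' ih ih' =>
    intro s
    exact ((ih s).mono (List.subset_append_left _ _) (List.subset_append_left _ _)).trans
      ((ih' _).mono (List.subset_append_right _ _) (List.subset_append_right _ _))
  | ite f g c c' ih ih' =>
    intro s
    rw [Cmd.eval_ite]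
    split_ifs
    · exact (ih s).mono (List.subset_append_left _ _) (List.subset_append_left _ _)
    · exact (ih' s).mono (List.subset_append_right _ _) (List.subset_append_right _ _)
  | loop x m c ih =>
    intro s
    exact iter_frame List.mem_cons_self
      (fun s => (ih s).mono (List.subset_cons_self _ _) (List.Subset.refl _)) _ s

theorem Cmd.eval_reg (c : Cmd) {x : Var} (hx : x ∉ c.vars) (s : Env) :
    (c.eval s).reg x = s.reg x := (c.frame s).1 x hx

theorem Cmd.eval_arr (c : Cmd) {a : ℕ} (ha : a ∉ c.arrs) (s : Env) :
    (c.eval s).arr a = s.arr a := (c.frame s).2 a ha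

/-- Besides the invariant, every round may use that the untouched variables and arrays still have
their values from before the loop. Invariants then only mention what changes. -/
theorem Cmd.loop_induct {x : Var} {m : Expr} {c : Cmd} {s : Env} {N : ℕ} (I : ℕ → Env → Prop)
    (hN : (m.eval s).toNat = N) (h0 : I 0 s)
    (h : ∀ j < N, ∀ s', Frame (x :: c.vars) c.arrs s s' → I j s' →
      I (j + 1) (c.eval (s'.set x j))) : I N ((Cmd.loop x m c).eval s) := by
  subst hN
  have := iter_induct (F := fun j s' => c.eval (s'.set x j)) (m := (m.eval s).toNat) (s := s)
    (fun j s' => Frame (x :: c.vars) c.arrs s s' ∧ I j s') ⟨Frame.refl _ _ _, h0⟩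
    fun j hj s' hs' => ⟨(hs'.1.set (by simp) _).trans
      ((c.frame _).mono (List.subset_cons_self _ _) (List.Subset.refl _)), h j hj s' hs'.1 hs'.2⟩
  exact this.2

theorem Cmd.loop_cost_le {x : Var} {m : Expr} {c : Cmd} {s : Env} {N B M : ℕ}
    (hN : (m.eval s).toNat ≤ N) (hM : m.cost s ≤ M)
    (h : ∀ s', Frame (x :: c.vars) c.arrs s s' → c.cost s' ≤ B) :
    (Cmd.loop x m c).cost s ≤ N * (B + 5) + (M + 2) := by
  have h1 : ∀ j ∈ Finset.range (m.eval s).toNat,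
      c.cost ((iter (fun j s' => c.eval (s'.set x j)) j s).set x j) + 4 + 1 ≤ B + 5 := by
    intro j _
    have := h _ ((iter_frame (x := x) (X := x :: c.vars) (Y := c.arrs) List.mem_cons_self
      (fun s => (c.frame s).mono (List.subset_cons_self _ _) (List.Subset.refl _)) j s).set
        (x := x) List.mem_cons_self (j : ℤ))
    omega
  have h2 := Finset.sum_le_card_nsmul _ _ _ h1
  rw [Finset.card_range, smul_eq_mul] at h2
  have h3 : (m.eval s).toNat * (B + 5) ≤ N * (B + 5) := Nat.mul_le_mul_right _ hN
  rw [Cmd.cost]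
  omega

/-- `s'` arises from `s` by writing the values `V` into the cells `lo ≤ z < hi` of array `a`, and
by changing the variables `X`. -/
structure Fill (X : List Var) (a lo hi : ℕ) (V : ℕ → ℤ) (s s' : Env) : Prop where
  frame : Frame X [a] s s'
  mem : ∀ z, lo ≤ z → z < hi → s'.arr a z = V z
  out : ∀ z, z < lo ∨ hi ≤ z → s'.arr a z = s.arr a z

theorem Fill.mono {X X' : List Var} {a lo hi : ℕ} {V : ℕ → ℤ} {s s' : Env}
    (h : Fill X a lo hi V s s') (hX : X ⊆ X') : Fill X' a lo hi V s s' :=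
  ⟨h.frame.mono hX (List.Subset.refl _), h.mem, h.out⟩

theorem Fill.store {X : List Var} {a z : ℕ} {V : ℕ → ℤ} {s : Env} {f g : Expr}
    (hf : f.eval s = z) (hg : g.eval s = V z) :
    Fill X a z (z + 1) V s ((Cmd.store a f g).eval s) where
  frame := ((Cmd.store a f g).frame s).mono (List.nil_subset _) (List.Subset.refl _)
  mem z' h1 h2 := by
    have : z' = z := by omega
    subst this
    rw [Cmd.eval, Env.arr_setArr, hf, Int.toNat_natCast, if_pos ⟨rfl, rfl⟩, hg]
  out z' h := by
    rw [Cmd.eval, Env.arr_setArr, hf, Int.toNat_natCast, if_neg (by omega)]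

/-- Round `j` fills the `j`-th block of width `w`. Nested loops are handled by applying this to a
block that is itself filled by a loop. -/
theorem Fill.loop {X : List Var} {a lo w N : ℕ} {V : ℕ → ℤ} {s : Env} {x : Var} {m : Expr}
    {c : Cmd} (hx : x ∈ X) (hN : m.eval s = N)
    (h : ∀ j < N, ∀ s', Fill X a lo (lo + j * w) V s s' → s'.reg x = j →
      Fill X a (lo + j * w) (lo + (j + 1) * w) V s' (c.eval s')) :
    Fill X a lo (lo + N * w) V s ((Cmd.loop x m c).eval s) := by
  have hN' : (m.eval s).toNat = N := by rw [hN, Int.toNat_natCast]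
  refine Cmd.loop_induct (fun j s' => Fill X a lo (lo + j * w) V s s') hN' ?_ ?_
  · exact ⟨Frame.refl _ _ _, fun z h1 h2 => by omega, fun _ _ => rfl⟩
  · intro j hj s' _ hs'
    have h1 : Fill X a lo (lo + j * w) V s (s'.set x j) := ⟨hs'.frame.set hx _, hs'.mem, hs'.out⟩
    have h2 := h j hj _ h1 (by simp)
    refine ⟨h1.frame.trans h2.frame, fun z hz1 hz2 => ?_, fun z hz => ?_⟩
    · by_cases hz : z < lo + j * w
      · rw [h2.out z (Or.inl hz), h1.mem z hz1 hz]
      · exact h2.mem z (by omega) hz2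
    · have h3 : (j + 1) * w = j * w + w := by ring
      rw [h2.out z (by omega), h1.out z (by omega)]

/-- The `c`-th coordinate of an exponent vector. -/
def coord {n : ℕ} (μ : Fin n →₀ ℕ) (c : ℕ) : ℕ := if h : c < n then μ ⟨c, h⟩ else 0

@[simp] theorem coord_fin {n : ℕ} (μ : Fin n →₀ ℕ) (i : Fin n) : coord μ i = μ i := by
  simp [coord]

theorem coord_add {n : ℕ} (μ ν : Fin n →₀ ℕ) (c : ℕ) :
    coord (μ + ν) c = coord μ c + coord ν c := by
  by_cases h : c < n <;> simp [coord, h]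

theorem row_div {n p c : ℕ} (hc : c < n) : (p * n + c) / n = p := by
  rw [Nat.mul_comm, Nat.mul_add_div (by omega), Nat.div_eq_of_lt hc, add_zero]

theorem row_mod {n p c : ℕ} (hc : c < n) : (p * n + c) % n = c := by
  rw [Nat.mul_comm, Nat.mul_add_mod, Nat.mod_eq_of_lt hc]

/-- The cells of `A` hold the coordinates of `pts 0`, …, `pts (m - 1)`, row by row. -/
def Rows {n : ℕ} (A : ℕ → ℤ) (m : ℕ) (pts : ℕ → Fin n →₀ ℕ) : Prop :=
  ∀ p < m, ∀ c < n, A (p * n + c) = coord (pts p) c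

/-- The coordinates of `pts 0`, `pts 1`, … written out row by row. -/
def flat {n : ℕ} (pts : ℕ → Fin n →₀ ℕ) (z : ℕ) : ℤ := coord (pts (z / n)) (z % n)

theorem flat_row {n : ℕ} (pts : ℕ → Fin n →₀ ℕ) {p c : ℕ} (hc : c < n) :
    flat pts (p * n + c) = coord (pts p) c := by
  rw [flat, row_div hc, row_mod hc]

theorem row_lt {n p c m : ℕ} (hp : p < m) (hc : c < n) : p * n + c < m * n := by
  calc p * n + c < p * n + n := by omega
    _ = (p + 1) * n := by ring
    _ ≤ m * n := Nat.mul_le_mul_right _ hp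

theorem Fill.rows {n : ℕ} {X : List Var} {a m : ℕ} {pts : ℕ → Fin n →₀ ℕ} {s s' : Env}
    (h : Fill X a 0 (m * n) (flat pts) s s') : Rows (s'.arr a) m pts := by
  intro p hp c hc
  rw [h.mem _ (Nat.zero_le _) (row_lt hp hc), flat_row pts hc]

end TropVN

namespace TropVN

/-! ### All sums of monomials -/

/-- The entry in row `x` and column `y` of array `a`. -/
def entry (a : ℕ) (x y : Var) : Expr := .get a (.var x * .var .n + .var y)

/-- Add every vector of the current list to every sum found so far. -/
def addLists : Cmd :=
  .loop .p (.var .cnt) (.loop .q (.var .len) (.loop .c (.var .n)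
    (.store 3 ((.var .p * .var .len + .var .q) * .var .n + .var .c)
      (entry 2 .p .c + .get 1 ((.var .off + .var .q) * .var .n + .var .c)))))

/-- Copy the new sums to array `2`. -/
def copyBack : Cmd :=
  .loop .p (.var .cnt) (.loop .c (.var .n)
    (.store 2 (.var .p * .var .n + .var .c) (entry 3 .p .c)))

/-- Process one list. -/
def sumStep : Cmd :=
  .seq (.assign .len (.get 0 (.var .i))) (.seq addLists (.seq
    (.assign .cnt (.var .cnt * .var .len)) (.seq (.assign .off (.var .off + .var .len)) copyBack)))

/-- Put all sums of one vector from each list into array `2`. -/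
def sumset : Cmd := .seq (.assign .cnt (.lit 1)) (.loop .i (.var .k) sumStep)

/-- The pair `(p, q)` is written to row `p * b + q`, so row `r` holds the sum of the old row `r / b`
and the list entry `r % b`. -/
theorem addLists_fill {n a b o : ℕ} {s : Env} {pts : ℕ → Fin n →₀ ℕ} {l : List (Fin n →₀ ℕ)}
    (hn : s.reg .n = n) (ha : s.reg .cnt = a) (hb : s.reg .len = b) (ho : s.reg .off = o)
    (h2 : Rows (s.arr 2) a pts)
    (h1 : ∀ q < b, ∀ c < n, s.arr 1 ((o + q) * n + c) = coord (l.getD q 0) c) :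
    Fill [.p, .q, .c] 3 0 (a * b * n) (flat fun r => pts (r / b) + l.getD (r % b) 0) s
      (addLists.eval s) := by
  have key := Fill.loop (X := [.p, .q, .c]) (a := 3) (lo := 0) (w := b * n) (N := a)
    (V := flat fun r => pts (r / b) + l.getD (r % b) 0) (s := s) (x := .p) (m := .var .cnt)
    (c := .loop .q (.var .len) (.loop .c (.var .n)
      (.store 3 ((.var .p * .var .len + .var .q) * .var .n + .var .c)
        (entry 2 .p .c + .get 1 ((.var .off + .var .q) * .var .n + .var .c))))) (by simp)
    (by simpa using ha) ?_
  · rw [zero_add, ← mul_assoc] at key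
    exact key
  intro p hp s₁ hs₁ hp₁
  rw [zero_add, zero_add, show (p + 1) * (b * n) = p * (b * n) + b * n by ring]
  refine Fill.mono (X := [.q, .c]) ?_ (by simp)
  refine Fill.loop (by simp) (by simpa [hb] using hs₁.frame.1 .len (by simp)) ?_
  intro q hq s₂ hs₂ hq₂
  rw [show p * (b * n) + (q + 1) * n = p * (b * n) + q * n + n * 1 by ring]
  have hF₂ : Frame [.p, .q, .c] [3] s s₂ :=
    hs₁.frame.trans (hs₂.frame.mono (by simp) (by simp))
  refine Fill.mono (X := [.c]) ?_ (by simp)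
  refine Fill.loop (by simp) (by simpa [hn] using hF₂.1 .n (by simp)) ?_
  intro c hc s₃ hs₃ hc₃
  have hF₃ : Frame [.p, .q, .c] [3] s s₃ := hF₂.trans (hs₃.frame.mono (by simp) (by simp))
  have hp₃ : s₃.reg .p = p := by
    rw [hs₃.frame.1 .p (by simp), hs₂.frame.1 .p (by simp), hp₁]
  have hq₃ : s₃.reg .q = q := by rw [hs₃.frame.1 .q (by simp), hq₂]
  have hz : p * (b * n) + q * n + c = (p * b + q) * n + c := by ring
  have hdiv : (p * b + q) / b = p ∧ (p * b + q) % b = q := ⟨row_div hq, row_mod hq⟩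
  rw [mul_one, mul_one, ← add_assoc]
  refine Fill.store ?_ ?_
  · simp [hF₃.1 .n (by simp), hn, hp₃, hq₃, hc₃, hF₃.1 .len (by simp), hb, hz]
  · rw [hz, flat_row _ hc, hdiv.1, hdiv.2, coord_add]
    have e1 : ((p : ℤ) * n + c).toNat = p * n + c := by norm_cast
    have e2 : (((o : ℤ) + q) * n + c).toNat = (o + q) * n + c := by norm_cast
    simp [entry, hF₃.1 .n (by simp), hn, hp₃, hq₃, hc₃, hF₃.1 .off (by simp), ho, e1, e2,
      hF₃.2 2 (by simp), hF₃.2 1 (by simp), h2 p hp c hc, h1 q hq c hc]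

theorem copyBack_fill {n a : ℕ} {s : Env} {pts : ℕ → Fin n →₀ ℕ} (hn : s.reg .n = n)
    (ha : s.reg .cnt = a) (h3 : Rows (s.arr 3) a pts) :
    Fill [.p, .c] 2 0 (a * n) (flat pts) s (copyBack.eval s) := by
  have key := Fill.loop (X := [.p, .c]) (a := 2) (lo := 0) (w := n) (N := a)
    (V := flat pts) (s := s) (x := .p) (m := .var .cnt) (c := .loop .c (.var .n)
    (.store 2 (.var .p * .var .n + .var .c) (entry 3 .p .c))) (by simp) (by simpa using ha) ?_
  · rwa [zero_add] at key
  intro p hp s₁ hs₁ hp₁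
  rw [zero_add, zero_add, show (p + 1) * n = p * n + n * 1 by ring]
  refine Fill.mono (X := [.c]) ?_ (by simp)
  refine Fill.loop (by simp) (by simpa [hn] using hs₁.frame.1 .n (by simp)) ?_
  intro c hc s₂ hs₂ hc₂
  have hF : Frame [.p, .c] [2] s s₂ := hs₁.frame.trans (hs₂.frame.mono (by simp) (by simp))
  have hp₂ : s₂.reg .p = p := by rw [hs₂.frame.1 .p (by simp), hp₁]
  rw [mul_one, mul_one, ← add_assoc]
  refine Fill.store ?_ ?_
  · simp [hF.1 .n (by simp), hn, hp₂, hc₂]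
  · have e1 : ((p : ℤ) * n + c).toNat = p * n + c := by norm_cast
    rw [flat_row _ hc]
    simp [entry, hF.1 .n (by simp), hn, hp₂, hc₂, e1, hF.2 3 (by simp), h3 p hp c hc]

variable {n : ℕ}

/-- The number of sums of one vector from each of the first `i` lists. -/
def sumCount (L : ℕ → List (Fin n →₀ ℕ)) (i : ℕ) : ℕ := ∏ j ∈ Finset.range i, (L j).length

/-- The sums of one vector from each of the first `i` lists, in the order in which they are
computed. -/
noncomputable def sumPts (L : ℕ → List (Fin n →₀ ℕ)) : ℕ → ℕ → Fin n →₀ ℕ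
  | 0, _ => 0
  | i + 1, r => sumPts L i (r / (L i).length) + (L i).getD (r % (L i).length) 0

/-- The number of vectors in the first `i` lists. -/
def listOffset (L : ℕ → List (Fin n →₀ ℕ)) (i : ℕ) : ℕ := ∑ j ∈ Finset.range i, (L j).length

/-- The environment holds the input. -/
structure HoldsInput (L : ℕ → List (Fin n →₀ ℕ)) (k : ℕ) (s : Env) : Prop where
  reg_n : s.reg .n = n
  reg_k : s.reg .k = k
  len : ∀ i < k, s.arr 0 i = (L i).length
  vec : ∀ i < k, ∀ q < (L i).length, ∀ c < n,
    s.arr 1 ((listOffset L i + q) * n + c) = coord ((L i).getD q 0) c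

theorem HoldsInput.frame {L : ℕ → List (Fin n →₀ ℕ)} {k : ℕ} {s s' : Env} {X : List Var}
    {Y : List ℕ} (h : HoldsInput L k s) (hF : Frame X Y s s') (hX : Var.n ∉ X) (hX' : Var.k ∉ X)
    (hY : 0 ∉ Y) (hY' : 1 ∉ Y) : HoldsInput L k s' :=
  ⟨by rw [hF.1 _ hX, h.reg_n], by rw [hF.1 _ hX', h.reg_k], fun i hi => by
    rw [hF.2 _ hY, h.len i hi], fun i hi q hq c hc => by rw [hF.2 _ hY', h.vec i hi q hq c hc]⟩

/-- The state of the computation after `i` lists. -/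
structure SumInv (L : ℕ → List (Fin n →₀ ℕ)) (k i : ℕ) (s : Env) : Prop where
  input : HoldsInput L k s
  cnt : s.reg .cnt = sumCount L i
  off : s.reg .off = listOffset L i
  rows : Rows (s.arr 2) (sumCount L i) (sumPts L i)

theorem SumInv.set_i {L : ℕ → List (Fin n →₀ ℕ)} {k i : ℕ} {s : Env} (h : SumInv L k i s) (v : ℤ) :
    SumInv L k i (s.set .i v) :=
  ⟨h.input.frame ((Frame.refl [.i] [] s).set (by simp) v) (by simp) (by simp) (by simp) (by simp),
    by simpa using h.cnt, by simpa using h.off, h.rows⟩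

/-- The new sums are first collected in array `3`, because array `2` is still being read while they
are formed. -/
theorem SumInv.step {L : ℕ → List (Fin n →₀ ℕ)} {k i : ℕ} {s : Env} (h : SumInv L k i s)
    (hi : i < k) (hs : s.reg .i = i) : SumInv L k (i + 1) (sumStep.eval s) := by
  set s₁ := s.set .len (L i).length with hs₁
  have e₁ : (Cmd.assign .len (.get 0 (.var .i))).eval s = s₁ := by
    simp [hs, h.input.len i hi, hs₁]
  set s₂ := addLists.eval s₁ with hs₂
  have hfill := addLists_fill (s := s₁) (n := n) (a := sumCount L i) (b := (L i).length)
    (o := listOffset L i) (pts := sumPts L i) (l := L i) (by simpa [hs₁] using h.input.reg_n)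
    (by simpa [hs₁] using h.cnt) (by simp [hs₁]) (by simpa [hs₁] using h.off) h.rows
    (fun q hq c hc => h.input.vec i hi q hq c hc)
  have hc : sumCount L (i + 1) = sumCount L i * (L i).length := Finset.prod_range_succ _ _
  have hl : listOffset L (i + 1) = listOffset L i + (L i).length := Finset.sum_range_succ _ _
  rw [← hs₂, ← hc] at hfill
  set s₃ := (s₂.set .cnt (sumCount L (i + 1))).set .off (listOffset L (i + 1)) with hs₃
  have hF₂ := hfill.frame
  have e₃ : (Cmd.assign .off (.var .off + .var .len)).eval
      ((Cmd.assign .cnt (.var .cnt * .var .len)).eval s₂) = s₃ := by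
    simp [hs₃, hF₂.1 .cnt (by simp), hF₂.1 .len (by simp), hF₂.1 .off (by simp), hs₁, h.cnt,
      h.off, hc, hl]
  have e : sumStep.eval s = copyBack.eval s₃ := by
    rw [sumStep, Cmd.eval_seq, Cmd.eval_seq, Cmd.eval_seq, Cmd.eval_seq, e₁, ← hs₂, e₃]
  have hrows : Rows (s₃.arr 3) (sumCount L (i + 1)) (sumPts L (i + 1)) := hfill.rows
  have hn₃ : s₃.reg .n = n := by
    simp [hs₃, hF₂.1 .n (by simp), hs₁, h.input.reg_n]
  have hcopy := copyBack_fill (s := s₃) hn₃ (by simp [hs₃]) hrows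
  rw [e]
  have hF := sumStep.frame s
  rw [e] at hF
  refine ⟨h.input.frame hF (by decide) (by decide) (by decide) (by decide), ?_, ?_, hcopy.rows⟩
  · rw [hcopy.frame.1 .cnt (by simp)]; simp [hs₃]
  · rw [hcopy.frame.1 .off (by simp)]; simp [hs₃]

/-- A blank array `2` already holds the empty sum, the zero vector, as its only row; hence the count
starts at `1`. -/
theorem SumInv.init {L : ℕ → List (Fin n →₀ ℕ)} {k : ℕ} {s : Env} (h : HoldsInput L k s)
    (hoff : s.reg .off = 0) (h2 : ∀ z, s.arr 2 z = 0) : SumInv L k 0 (s.set .cnt 1) :=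
  ⟨h.frame ((Frame.refl [.cnt] [] s).set (by simp) _) (by simp) (by simp) (by simp) (by simp),
    by simp [sumCount], by simp [listOffset, hoff],
    fun p _ c _ => by simp [h2, sumPts, coord]⟩

theorem sumset_spec {L : ℕ → List (Fin n →₀ ℕ)} {k : ℕ} {s : Env} (h : HoldsInput L k s)
    (hoff : s.reg .off = 0) (h2 : ∀ z, s.arr 2 z = 0) : SumInv L k k (sumset.eval s) := by
  have h0 := SumInv.init h hoff h2
  exact Cmd.loop_induct (SumInv L k) (by simp [h.reg_k]) h0
    fun j hj s' _ hs' => (hs'.set_i j).step hj (by simp)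

/-- For loops whose rounds have a cost that depends on values changed by earlier rounds, as for the
growing number of sums. -/
theorem Cmd.loop_cost_le_of_inv {x : Var} {m : Expr} {c : Cmd} {s : Env} {N B M : ℕ}
    (I : ℕ → Env → Prop) (hN : (m.eval s).toNat = N) (hM : m.cost s ≤ M) (h0 : I 0 s)
    (h : ∀ j < N, ∀ s', I j s' → I (j + 1) (c.eval (s'.set x j)) ∧ c.cost (s'.set x j) ≤ B) :
    (Cmd.loop x m c).cost s ≤ N * (B + 5) + (M + 2) := by
  have h1 : ∀ j ∈ Finset.range N,
      c.cost ((iter (fun j s' => c.eval (s'.set x j)) j s).set x j) + 4 + 1 ≤ B + 5 := by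
    intro j hj
    rw [Finset.mem_range] at hj
    have := (h j hj _ (iter_induct (F := fun j s' => c.eval (s'.set x j)) I h0
      fun i hi s' hs' => (h i (hi.trans hj) s' hs').1)).2
    omega
  have h2 := Finset.sum_le_card_nsmul _ _ _ h1
  rw [Finset.card_range, smul_eq_mul] at h2
  rw [Cmd.cost, hN]
  omega

theorem addLists_cost_le {n a b : ℕ} {s : Env} (hn : s.reg .n = n) (ha : s.reg .cnt = a)
    (hb : s.reg .len = b) : addLists.cost s ≤ a * (b * (n * 50 + 9) + 9) + 4 := by
  refine Cmd.loop_cost_le (B := b * (n * 50 + 9) + 4) (M := 2) (by simp [ha]) (by simp) ?_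
  intro s₁ h1
  refine Cmd.loop_cost_le (B := n * 50 + 4) (M := 2) ?_ (by simp) ?_
  · simp [h1.1 .len (by decide), hb]
  intro s₂ h2
  refine Cmd.loop_cost_le (B := 45) (M := 2) ?_ (by simp) ?_
  · simp [h2.1 .n (by decide), h1.1 .n (by decide), hn]
  intro s₃ _
  simp [Cmd.cost, entry]

theorem copyBack_cost_le {n a : ℕ} {s : Env} (hn : s.reg .n = n) (ha : s.reg .cnt = a) :
    copyBack.cost s ≤ a * (n * 30 + 9) + 4 := by
  refine Cmd.loop_cost_le (B := n * 30 + 4) (M := 2) (by simp [ha]) (by simp) ?_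
  intro s₁ h1
  refine Cmd.loop_cost_le (B := 25) (M := 2) ?_ (by simp) ?_
  · simp [h1.1 .n (by decide), hn]
  intro s₃ _
  simp [Cmd.cost, entry]

theorem sumStep_cost_le {L : ℕ → List (Fin n →₀ ℕ)} {k i W : ℕ} {s : Env} (h : SumInv L k i s)
    (hi : i < k) (hs : s.reg .i = i) (hW : sumCount L i ≤ W) (hW' : sumCount L (i + 1) ≤ W) :
    sumStep.cost s ≤ 200 * (W * n + W + 1) := by
  have hc : sumCount L (i + 1) = sumCount L i * (L i).length := Finset.prod_range_succ _ _
  set s₁ := s.set .len (L i).length with hs₁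
  have e₁ : (Cmd.assign .len (.get 0 (.var .i))).eval s = s₁ := by
    simp [hs, h.input.len i hi, hs₁]
  set s₂ := addLists.eval s₁ with hs₂
  have hF : Frame addLists.vars addLists.arrs s₁ s₂ := addLists.frame s₁
  have h1 := addLists_cost_le (s := s₁) (n := n) (a := sumCount L i) (b := (L i).length)
    (by simpa [hs₁] using h.input.reg_n) (by simpa [hs₁] using h.cnt) (by simp [hs₁])
  have h2 := copyBack_cost_le (n := n) (a := sumCount L (i + 1))
    (s := (Cmd.assign .off (.var .off + .var .len)).eval
      ((Cmd.assign .cnt (.var .cnt * .var .len)).eval s₂))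
    (by simp [hF.1 .n (by decide), hs₁, h.input.reg_n])
    (by simp [hF.1 .cnt (by decide), hF.1 .len (by decide), hs₁, h.cnt, hc])
  have e : sumStep.cost s = (Cmd.assign .len (.get 0 (.var .i))).cost s + (addLists.cost s₁ +
      ((Cmd.assign .cnt (.var .cnt * .var .len)).cost s₂ +
      ((Cmd.assign .off (.var .off + .var .len)).cost
        ((Cmd.assign .cnt (.var .cnt * .var .len)).eval s₂) + copyBack.cost
        ((Cmd.assign .off (.var .off + .var .len)).eval
          ((Cmd.assign .cnt (.var .cnt * .var .len)).eval s₂))))) := by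
    rw [hs₂, ← e₁]; rfl
  have e2 : sumCount L i * ((L i).length * (n * 50 + 9) + 9) =
      sumCount L (i + 1) * (n * 50 + 9) + sumCount L i * 9 := by rw [hc]; ring
  have h3 : sumCount L (i + 1) * (n * 50 + 9) ≤ W * (n * 50 + 9) := Nat.mul_le_mul_right _ hW'
  have h4 : sumCount L (i + 1) * (n * 30 + 9) ≤ W * (n * 30 + 9) := Nat.mul_le_mul_right _ hW'
  rw [e]
  simp only [Cmd.cost, Expr.cost_get, Expr.cost_var, Expr.cost_mul, Expr.cost_add]
  nlinarith

theorem sumset_cost_le {L : ℕ → List (Fin n →₀ ℕ)} {k W : ℕ} {s : Env} (h : HoldsInput L k s)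
    (hoff : s.reg .off = 0) (h2 : ∀ z, s.arr 2 z = 0) (hW : ∀ i ≤ k, sumCount L i ≤ W) :
    sumset.cost s ≤ k * (200 * (W * n + W + 1) + 5) + 7 := by
  have h0 := SumInv.init h hoff h2
  have := Cmd.loop_cost_le_of_inv (x := .i) (m := .var .k) (c := sumStep) (N := k) (M := 2)
    (SumInv L k) (by simp [h.reg_k]) (by simp) h0 (B := 200 * (W * n + W + 1))
    fun j hj s' hs' => ⟨(hs'.set_i j).step hj (by simp),
      sumStep_cost_le (hs'.set_i j) hj (by simp) (hW j hj.le) (hW (j + 1) hj)⟩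
  simp only [sumset, Cmd.cost, Expr.cost_lit, Cmd.eval_assign, Expr.eval_lit] at this ⊢
  omega

/-! ### The sums are the monomials of the product -/

/-- Induction on the number of factors. The same exponent vector may be enumerated several times;
repetitions are removed only at output. -/
theorem exists_sumPts_iff (L : ℕ → List (Fin n →₀ ℕ)) (S : ℕ → TPoly n) (k : ℕ)
    (h : ∀ i < k, ∀ μ, μ ∈ L i ↔ μ ∈ (S i).support) (μ : Fin n →₀ ℕ) :
    (∃ p < sumCount L k, sumPts L k p = μ) ↔ μ ∈ (∏ i ∈ Finset.range k, S i).support := by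
  induction k generalizing μ with
  | zero =>
    have : (1 : TPoly n) = MvPolynomial.monomial 0 1 := rfl
    rw [Finset.prod_range_zero, this, MvPolynomial.support_monomial, if_neg trop_one_ne_zero]
    simp only [sumCount, Finset.prod_range_zero, sumPts, Finset.mem_singleton]
    exact ⟨fun ⟨_, _, h⟩ => h.symm, fun h => ⟨0, by simp, h.symm⟩⟩
  | succ k ih =>
    have hc : sumCount L (k + 1) = sumCount L k * (L k).length := Finset.prod_range_succ _ _
    rw [Finset.prod_range_succ, mem_support_mul]
    constructor
    · rintro ⟨r, hr, rfl⟩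
      rw [hc] at hr
      have hpos : 0 < (L k).length := Nat.pos_of_ne_zero fun h0 => by simp [h0] at hr
      have hmod := Nat.mod_lt r hpos
      refine ⟨_, (ih (fun i hi => h i (by omega)) _).1
        ⟨r / (L k).length, Nat.div_lt_of_lt_mul (by rwa [mul_comm] at hr), rfl⟩, _, ?_, rfl⟩
      rw [← h k (by omega), List.getD_eq_getElem _ _ hmod]
      exact List.getElem_mem hmod
    · rintro ⟨a, ha, b, hb, rfl⟩
      obtain ⟨p, hp, rfl⟩ := (ih (fun i hi => h i (by omega)) a).2 ha
      obtain ⟨q, hq, rfl⟩ := List.mem_iff_getElem.1 ((h k (by omega) b).2 hb)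
      refine ⟨p * (L k).length + q, ?_, ?_⟩
      · rw [hc]; exact row_lt hp hq
      · rw [sumPts, row_div hq, row_mod hq, List.getD_eq_getElem _ _ hq]

end TropVN

namespace TropVN

/-! ### The parameters of the ellipsoid method -/

/-- Compute a bound for the entries of the vectors. -/
def setBound : Cmd :=
  .seq (.assign .bound (.lit 1)) (.loop .p (.var .cnt) (.loop .c (.var .n)
    (.ite (.var .bound) (entry 2 .p .c) (.assign .bound (entry 2 .p .c))
      (.assign .bound (.var .bound)))))

/-- Compute `2 ^ expo`. -/
def setBase : Cmd :=
  .seq (.assign .base (.lit 1)) (.loop .t (.var .expo) (.assign .base (.var .base * .lit 2)))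

/-- Compute the number of iterations. -/
def setIters : Cmd :=
  .seq (.assign .expo ((.var .n + .lit 2) * (.var .n + .var .bound + .lit 2)))
    (.seq (.assign .iters (.lit 32 * .var .n * (.lit 2 * .var .n * .var .expo + .lit 1)))
      (.assign .doublings (.var .iters + .var .n + .var .bound + .var .expo)))

/-- Compute the parameters of the ellipsoid method. -/
def params : Cmd := .seq setBound (.seq setIters setBase)

/-- The exponent of the inverse radius of a ball in the feasible region. -/
def radiusExp (n D : ℕ) : ℕ := (n + 2) * (n + D + 2)

/-- The number of iterations of the ellipsoid method. -/
def iterCount (n D : ℕ) : ℕ := 32 * n * (2 * n * radiusExp n D + 1)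

/-- The number of doublings in the approximation of a square root. -/
def doublingCount (n D : ℕ) : ℕ := iterCount n D + n + D + radiusExp n D

variable {n : ℕ}

/-- The environment holds the vectors `pts 0`, …, `pts (m - 1)` and the parameters. -/
structure Ready (pts : ℕ → Fin n →₀ ℕ) (m D : ℕ) (s : Env) : Prop where
  reg_n : s.reg .n = n
  cnt : s.reg .cnt = m
  iters : s.reg .iters = iterCount n D
  doublings : s.reg .doublings = doublingCount n D
  base : s.reg .base = 2 ^ radiusExp n D
  rows : Rows (s.arr 2) m pts

theorem Ready.frame {pts : ℕ → Fin n →₀ ℕ} {m D : ℕ} {s s' : Env} {X : List Var}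
    {Y : List ℕ} (h : Ready pts m D s) (hF : Frame X Y s s') (h1 : Var.n ∉ X) (h2 : Var.cnt ∉ X)
    (h3 : Var.iters ∉ X) (h4 : Var.doublings ∉ X) (h5 : Var.base ∉ X) (hY : 2 ∉ Y) :
    Ready pts m D s' :=
  ⟨by rw [hF.1 _ h1, h.reg_n], by rw [hF.1 _ h2, h.cnt], by rw [hF.1 _ h3, h.iters],
    by rw [hF.1 _ h4, h.doublings], by rw [hF.1 _ h5, h.base], by rw [hF.2 _ hY]; exact h.rows⟩

theorem entry_eval {s : Env} {A : ℕ} {m p c : ℕ} {x y : Var} {pts : ℕ → Fin n →₀ ℕ}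
    (hn : s.reg .n = n) (hx : s.reg x = p) (hy : s.reg y = c) (hr : Rows (s.arr A) m pts)
    (hp : p < m) (hc : c < n) : (entry A x y).eval s = coord (pts p) c := by
  have e : ((p : ℤ) * n + c).toNat = p * n + c := by norm_cast
  simp [entry, hn, hx, hy, e, hr p hp c hc]

/-- That `D` is an upper bound is needed for correctness, that it is the least one above `1` for the
running time, since it yields `D ≤ k * d`. -/
theorem setBound_spec {pts : ℕ → Fin n →₀ ℕ} {m : ℕ} {s : Env} (hn : s.reg .n = n)
    (hm : s.reg .cnt = m) (hr : Rows (s.arr 2) m pts) :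
    ∃ D : ℕ, (setBound.eval s).reg .bound = D ∧ 1 ≤ D ∧ (∀ p < m, ∀ i, pts p i ≤ D) ∧
      ∀ B, 1 ≤ B → (∀ p < m, ∀ i, pts p i ≤ B) → D ≤ B := by
  set s₀ := s.set .bound 1 with hs₀
  have key : ∃ D : ℕ, (setBound.eval s).reg .bound = D ∧ 1 ≤ D ∧
      (∀ p < m, ∀ c < n, coord (pts p) c ≤ D) ∧
      ∀ B, 1 ≤ B → (∀ p < m, ∀ c < n, coord (pts p) c ≤ B) → D ≤ B := by
    refine Cmd.loop_induct (s := s₀) (x := .p) (m := .var .cnt) (N := m)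
      (fun p s' => ∃ D : ℕ, s'.reg .bound = D ∧ 1 ≤ D ∧ (∀ p' < p, ∀ c < n, coord (pts p') c ≤ D) ∧
        ∀ B, 1 ≤ B → (∀ p < m, ∀ c < n, coord (pts p) c ≤ B) → D ≤ B)
      (by simp [hs₀, hm]) ⟨1, by simp [hs₀], le_rfl, by simp, fun B hB _ => hB⟩ ?_
    rintro p hp s₁ hF₁ ⟨D, hD, h1, hle, hub⟩
    have hn₁ : s₁.reg .n = n := by rw [hF₁.1 .n (by decide)]; simp [hs₀, hn]
    have hA₁ : s₁.arr 2 = s.arr 2 := hF₁.2 2 (by decide)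
    have := Cmd.loop_induct (s := s₁.set .p p) (x := .c) (m := .var .n) (N := n)
      (c := .ite (.var .bound) (entry 2 .p .c) (.assign .bound (entry 2 .p .c))
        (.assign .bound (.var .bound)))
      (fun c s' => ∃ D : ℕ, s'.reg .bound = D ∧ 1 ≤ D ∧
        (∀ p' < p, ∀ c < n, coord (pts p') c ≤ D) ∧ (∀ c' < c, coord (pts p) c' ≤ D) ∧
        ∀ B, 1 ≤ B → (∀ p < m, ∀ c < n, coord (pts p) c ≤ B) → D ≤ B)
      (by simp [hn₁]) ⟨D, by simp [hD], h1, hle, by simp, hub⟩ ?_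
    · obtain ⟨D', hD', h1', hle', hc', hub'⟩ := this
      refine ⟨D', hD', h1', fun p' hp' => ?_, hub'⟩
      rcases Nat.lt_succ_iff_lt_or_eq.1 hp' with h | rfl
      · exact hle' p' h
      · exact hc'
    rintro c hc s₂ hF₂ ⟨D, hD, h1, hle, hc', hub⟩
    have hp₂ : s₂.reg .p = p := by rw [hF₂.1 .p (by decide)]; simp
    have hn₂ : s₂.reg .n = n := by rw [hF₂.1 .n (by decide)]; simp [hn₁]
    have hA₂ : s₂.arr 2 = s.arr 2 := by rw [hF₂.2 2 (by decide)]; exact hA₁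
    have hent : (entry 2 .p .c).eval (s₂.set .c c) = coord (pts p) c :=
      entry_eval (m := m) (by simp [hn₂]) (by simp [hp₂]) (by simp) (by simpa [hA₂] using hr) hp hc
    rw [Cmd.eval_ite, hent]
    simp only [Cmd.eval_assign, hent, Expr.eval_var, Env.reg_set, reduceCtorEq, if_false]
    split_ifs with h <;> rw [hD, Nat.cast_le] at h
    · refine ⟨coord (pts p) c, by simp, h1.trans h, fun p' hp' c' h' => (hle p' hp' c' h').trans h,
        fun c' h' => ?_, fun B _ h' => h' p hp c hc⟩
      rcases Nat.lt_succ_iff_lt_or_eq.1 h' with h'' | rfl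
      · exact (hc' c' h'').trans h
      · exact le_rfl
    · refine ⟨D, by simp [hD], h1, hle, fun c' h' => ?_, hub⟩
      rcases Nat.lt_succ_iff_lt_or_eq.1 h' with h'' | rfl
      · exact hc' c' h''
      · omega
  obtain ⟨D, h1, h2, h3, h4⟩ := key
  refine ⟨D, h1, h2, fun p hp i => by simpa using h3 p hp i i.2, fun B hB h => h4 B hB ?_⟩
  intro p hp c hc
  simpa [coord, hc] using h p hp ⟨c, hc⟩

theorem setBase_spec {e : ℕ} {s : Env} (h : s.reg .expo = e) :
    (setBase.eval s).reg .base = 2 ^ e :=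
  Cmd.loop_induct (fun j s' => s'.reg .base = 2 ^ j) (by simp [h]) (by simp)
    fun j _ s' _ hs' => by simp [hs', pow_succ]

theorem params_spec {pts : ℕ → Fin n →₀ ℕ} {m : ℕ} {s : Env} (hn : s.reg .n = n)
    (hm : s.reg .cnt = m) (hr : Rows (s.arr 2) m pts) :
    ∃ D : ℕ, Ready pts m D (params.eval s) ∧ (setBound.eval s).reg .bound = D ∧ 1 ≤ D ∧
      (∀ p < m, ∀ i, pts p i ≤ D) ∧ ∀ B, 1 ≤ B → (∀ p < m, ∀ i, pts p i ≤ B) → D ≤ B := by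
  obtain ⟨D, h1, h2⟩ := setBound_spec hn hm hr
  refine ⟨D, ?_, h1, h2⟩
  set s₁ := setBound.eval s with hs₁
  have hF₁ : Frame setBound.vars setBound.arrs s s₁ := setBound.frame s
  set s₂ := setIters.eval s₁ with hs₂
  have hF₂ : Frame setIters.vars setIters.arrs s₁ s₂ := setIters.frame s₁
  have hn₁ : s₁.reg .n = n := by rw [hF₁.1 .n (by decide), hn]
  have he : s₂.reg .expo = radiusExp n D := by simp [hs₂, setIters, hn₁, h1, radiusExp]
  have hF₃ : Frame setBase.vars setBase.arrs s₂ (setBase.eval s₂) := setBase.frame s₂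
  have e : params.eval s = setBase.eval s₂ := rfl
  rw [e]
  refine ⟨?_, ?_, ?_, ?_, setBase_spec he, ?_⟩
  · rw [hF₃.1 .n (by decide), hF₂.1 .n (by decide), hn₁]
  · rw [hF₃.1 .cnt (by decide), hF₂.1 .cnt (by decide), hF₁.1 .cnt (by decide), hm]
  · rw [hF₃.1 .iters (by decide)]
    simp [hs₂, setIters, hn₁, h1, radiusExp, iterCount]
  · rw [hF₃.1 .doublings (by decide)]
    simp [hs₂, setIters, hn₁, h1, radiusExp, iterCount, doublingCount]
  · rw [hF₃.2 2 (by decide), hF₂.2 2 (by decide), hF₁.2 2 (by decide)]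
    exact hr

theorem params_cost_le {m D : ℕ} {s : Env} (hn : s.reg .n = n) (hm : s.reg .cnt = m)
    (hD : (setBound.eval s).reg .bound = D) :
    params.cost s ≤ 100 * (m * n + m + radiusExp n D + 1) := by
  have h1 : setBound.cost s ≤ 40 * (m * n + m) + 10 := by
    have := Cmd.loop_cost_le (s := s.set .bound 1) (x := .p) (m := .var .cnt) (N := m)
      (B := n * 40 + 4) (M := 2) (c := .loop .c (.var .n)
        (.ite (.var .bound) (entry 2 .p .c) (.assign .bound (entry 2 .p .c))
          (.assign .bound (.var .bound)))) (by simp [hm]) (by simp) fun s₁ hF₁ => by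
      refine Cmd.loop_cost_le (B := 35) (M := 2) ?_ (by simp) ?_
      · simp [hF₁.1 .n (by decide), hn]
      · intro s₂ _
        simp only [Cmd.cost_ite, Cmd.cost_assign]
        split_ifs <;> simp [entry]
    simp only [setBound, Cmd.cost_seq, Cmd.cost_assign, Cmd.eval_assign, Expr.eval_lit,
      Expr.cost_lit]
    linarith
  have hn₁ : (setBound.eval s).reg .n = n := by rw [setBound.eval_reg (by decide), hn]
  have he : (setIters.eval (setBound.eval s)).reg .expo = radiusExp n D := by
    simp [setIters, hn₁, hD, radiusExp]
  have h2 : setIters.cost (setBound.eval s) ≤ 60 := by simp [setIters, Cmd.cost]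
  have h3 : setBase.cost (setIters.eval (setBound.eval s)) ≤ 20 * radiusExp n D + 10 := by
    have := Cmd.loop_cost_le (s := (setIters.eval (setBound.eval s)).set .base 1) (x := .t)
      (m := .var .expo) (N := radiusExp n D) (B := 10) (M := 2)
      (c := .assign .base (.var .base * .lit 2)) (by simp [he]) (by simp) fun s₁ _ => by
        simp [Cmd.cost]
    simp only [setBase, Cmd.cost_seq, Cmd.cost_assign, Cmd.eval_assign, Expr.eval_lit,
      Expr.cost_lit]
    omega
  simp only [params, Cmd.cost_seq]
  omega

end TropVN

namespace TropVN

open Matrix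

/-! ### The vertex test -/

/-- A coordinate of the difference of the vectors number `x` and number `p`. -/
def delta (x y : Var) : Expr := entry 2 x y - entry 2 .p y

/-- Look for a vector whose difference with vector number `p` is not positive at the centre. -/
def findViol : Cmd :=
  .seq (.assign .viol (.lit (-1))) (.loop .q (.var .cnt) (.ite (.lit 1)
    (.le (.lit 1) (.sum .c (.var .n) (delta .q .c * delta .q .c)) *
      .le (.sum .c (.var .n) (delta .q .c * .get 5 (.var .c))) (.lit 0))
    (.assign .viol (.var .q)) (.assign .viol (.var .viol))))

/-- Multiply the matrix with the cut vector. -/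
def applyMatrix : Cmd :=
  .loop .c (.var .n) (.store 7 (.var .c) (.sum .e (.var .n) (entry 6 .c .e * delta .viol .e)))

/-- Approximate a square root by a power of two. -/
def setScale : Cmd :=
  .seq (.assign .scale (.lit 1)) (.loop .e (.var .doublings)
    (.ite (.var .scale * .var .scale * .var .del + .lit 1)
      (.var .quad * .var .base * .var .base)
      (.assign .scale (.var .scale * .lit 2)) (.assign .scale (.var .scale))))

/-- The numbers that govern the update of the ellipsoid. -/
def setDen : Cmd :=
  .seq applyMatrix (.seq (.assign .quad (.sum .c (.var .n) (.get 7 (.var .c) * delta .viol .c)))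
    (.seq setScale (.assign .den (.lit 2 * .var .n * .var .del * .var .scale * .var .scale +
      .var .base * .var .base * .var .quad))))

/-- Update the centre. -/
def moveCentre : Cmd :=
  .loop .c (.var .n) (.store 5 (.var .c) (.lit 2 * .var .den * .get 5 (.var .c) +
    .var .gam * .var .scale * .var .base * .get 7 (.var .c)))

/-- Update the matrix. -/
def shrinkMatrix : Cmd :=
  .loop .c (.var .n) (.loop .e (.var .n) (.store 6 (.var .c * .var .n + .var .e)
    ((.lit 16 * .var .n * .var .n + .lit 1) * (.var .den * entry 6 .c .e -
      .var .base * .var .base * .get 7 (.var .c) * .get 7 (.var .e)))))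

/-- Replace the ellipsoid by a smaller one. -/
def cut : Cmd :=
  .seq setDen (.seq moveCentre (.seq shrinkMatrix
    (.seq (.assign .gam (.lit 2 * .var .den * .var .gam))
      (.assign .del (.lit 16 * .var .n * .var .n * .var .del * .var .den)))))

/-- One iteration of the ellipsoid method. -/
def ellipsoidStep : Cmd :=
  .seq findViol (.ite (.var .viol + .lit 1) (.lit 0) (.assign .found (.lit 1)) cut)

/-- Start with the unit ball. -/
def unitBall : Cmd :=
  .seq (.assign .found (.lit 0)) (.seq (.assign .gam (.lit 1)) (.seq (.assign .del (.lit 1))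
    (.seq (.loop .c (.var .n) (.store 5 (.var .c) (.lit 0)))
      (.loop .c (.var .n) (.loop .e (.var .n) (.store 6 (.var .c * .var .n + .var .e)
        (.le (.var .c) (.var .e) * .le (.var .e) (.var .c))))))))

/-- Decide whether vector number `p` is a vertex. -/
def vertexTest : Cmd := .seq unitBall (.loop .t (.var .iters) ellipsoidStep)

variable {n : ℕ}

/-- The difference of two vectors. -/
def dvec (pts : ℕ → Fin n →₀ ℕ) (p q : ℕ) : Fin n → ℤ := fun i => (pts q i : ℤ) - pts p i

/-- The integer vector in array `a`. -/
def arrVec (n : ℕ) (A : ℕ → ℤ) : Fin n → ℤ := fun i => A i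

/-- The integer matrix in array `a`. -/
def arrMat (n : ℕ) (A : ℕ → ℤ) : Matrix (Fin n) (Fin n) ℤ := Matrix.of fun i j => A (i * n + j)

theorem delta_eval {s : Env} {m p q c : ℕ} {x y : Var} {pts : ℕ → Fin n →₀ ℕ}
    (hn : s.reg .n = n) (hx : s.reg x = q) (hy : s.reg y = c) (hp : s.reg .p = p)
    (hr : Rows (s.arr 2) m pts) (hpm : p < m) (hqm : q < m) (hc : c < n) :
    (delta x y).eval s = (coord (pts q) c : ℤ) - coord (pts p) c := by
  rw [delta, Expr.eval_sub, entry_eval hn hx hy hr hqm hc, entry_eval hn hp hy hr hpm hc]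

theorem sum_eval_eq {s : Env} {x : Var} {f : Expr} {F : Fin n → ℤ} (hn : s.reg .n = n)
    (h : ∀ i : Fin n, f.eval (s.set x (i : ℕ)) = F i) :
    (Expr.sum x (.var .n) f).eval s = ∑ i, F i := by
  rw [Expr.eval_sum, Expr.eval_var, hn, Int.toNat_natCast, Finset.sum_range]
  exact Finset.sum_congr rfl fun i _ => h i

/-- Vector number `q` shows that the point `C` does not separate vector number `p` from the
others. -/
def Violated (pts : ℕ → Fin n →₀ ℕ) (C : Fin n → ℤ) (p q : ℕ) : Prop :=
  pts q ≠ pts p ∧ ∑ i, dvec pts p q i * C i ≤ 0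

theorem dvec_eq_zero {pts : ℕ → Fin n →₀ ℕ} {p q : ℕ} : dvec pts p q = 0 ↔ pts q = pts p := by
  constructor
  · intro h
    ext i
    have := congrFun h i
    simp only [dvec, Pi.zero_apply] at this
    omega
  · intro h
    funext i
    simp [dvec, h]

/-- The squared distance of integer vectors is an integer, so distinctness becomes a comparison with
`1`. The test is needed because the list of sums has repetitions. The same bound keeps cut vectors
from being short. -/
theorem one_le_sum_sq {pts : ℕ → Fin n →₀ ℕ} {p q : ℕ} :
    1 ≤ ∑ i, dvec pts p q i * dvec pts p q i ↔ pts q ≠ pts p := by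
  have h0 : 0 ≤ ∑ i, dvec pts p q i * dvec pts p q i :=
    Finset.sum_nonneg fun i _ => mul_self_nonneg _
  rw [Ne, ← dvec_eq_zero, funext_iff]
  have := Finset.sum_eq_zero_iff_of_nonneg (s := Finset.univ)
    (f := fun i => dvec pts p q i * dvec pts p q i) fun i _ => mul_self_nonneg _
  simp only [Finset.mem_univ, forall_const, mul_self_eq_zero] at this
  rw [Pi.zero_def, ← this]
  omega

theorem findViol_spec {pts : ℕ → Fin n →₀ ℕ} {m D p : ℕ} {s : Env} (h : Ready pts m D s)
    (hp : p < m) (hs : s.reg .p = p) :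
    ((findViol.eval s).reg .viol = -1 ∧
      ∀ q < m, ¬ Violated pts (arrVec n (s.arr 5)) p q) ∨
    ∃ v < m, (findViol.eval s).reg .viol = v ∧ Violated pts (arrVec n (s.arr 5)) p v := by
  set C := arrVec n (s.arr 5) with hC
  refine Cmd.loop_induct (s := s.set .viol (-1)) (x := .q) (m := .var .cnt) (N := m)
    (fun j s' => (s'.reg .viol = -1 ∧ ∀ q < j, ¬ Violated pts C p q) ∨
      ∃ v < m, s'.reg .viol = v ∧ Violated pts C p v) (by simp [h.cnt]) ?_ ?_
  · left; simp
  intro q hq s₁ hF₁ hs₁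
  have hr : Ready pts m D (s₁.set .q q) :=
    h.frame (X := [.q, .viol]) (Y := [])
      ((((Frame.refl _ _ s).set (by simp) (-1)).trans (hF₁.mono (by decide) (by decide))).set
        (by simp) _) (by decide) (by decide) (by decide) (by decide) (by decide) (by decide)
  have hp₁ : s₁.reg .p = p := by rw [hF₁.1 .p (by decide)]; simp [hs]
  have hA₁ : s₁.arr 5 = s.arr 5 := hF₁.2 5 (by decide)
  have hd : ∀ i : Fin n, (delta .q .c).eval ((s₁.set .q q).set .c (i : ℕ)) = dvec pts p q i := by
    intro i
    rw [delta_eval (m := m) (q := q) (p := p) (c := i) (pts := pts) (by simpa using hr.reg_n)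
      (by simp) (by simp) (by simpa using hp₁) (by simpa using hr.rows) hp hq i.2]
    simp [dvec]
  have e1 : (Expr.sum .c (.var .n) (delta .q .c * delta .q .c)).eval (s₁.set .q q) =
      ∑ i, dvec pts p q i * dvec pts p q i :=
    sum_eval_eq hr.reg_n fun i => by rw [Expr.eval_mul, hd]
  have e2 : (Expr.sum .c (.var .n) (delta .q .c * .get 5 (.var .c))).eval (s₁.set .q q) =
      ∑ i, dvec pts p q i * C i :=
    sum_eval_eq hr.reg_n fun i => by rw [Expr.eval_mul, hd]; simp [hC, arrVec, hA₁]
  -- A product of two comparison values `0` or `1` serves as a conjunction.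
  have hcond : (Expr.lit 1).eval (s₁.set .q q) ≤ (Expr.le (.lit 1) (.sum .c (.var .n)
      (delta .q .c * delta .q .c)) * .le (.sum .c (.var .n)
      (delta .q .c * .get 5 (.var .c))) (.lit 0)).eval (s₁.set .q q) ↔ Violated pts C p q := by
    rw [Expr.eval_mul, Expr.eval_le, Expr.eval_le, e1, e2, Expr.eval_lit, Expr.eval_lit,
      Violated, ← one_le_sum_sq]
    by_cases h1 : 1 ≤ ∑ i, dvec pts p q i * dvec pts p q i <;>
      by_cases h2 : ∑ i, dvec pts p q i * C i ≤ 0 <;> simp [h1, h2]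
  rw [Cmd.eval_ite]
  by_cases hv : Violated pts C p q
  · rw [if_pos (hcond.2 hv)]
    exact Or.inr ⟨q, hq, by simp, hv⟩
  · rw [if_neg (fun h' => hv (hcond.1 h'))]
    rcases hs₁ with ⟨h1, h2⟩ | ⟨v, h1, h2, h3⟩
    · refine Or.inl ⟨by simp [h1], fun q' hq' => ?_⟩
      rcases Nat.lt_succ_iff_lt_or_eq.1 hq' with h' | rfl
      · exact h2 q' h'
      · exact hv
    · exact Or.inr ⟨v, h1, by simp [h2], h3⟩

/-- `sc` is the smallest power of two with `Q ≤ sc² P`, among the first `K`. -/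
def IsScale (K : ℕ) (P Q sc : ℤ) : Prop :=
  ∃ j ≤ K, sc = 2 ^ j ∧ (j = 0 ∨ sc * sc * P < 4 * Q) ∧ (Q ≤ sc * sc * P ∨ j = K)

/-- The scale is doubled only while `sc * sc * P < Q`, so after any doubling `sc * sc * P < 4 * Q`.
Either the target is reached, or all `K` rounds doubled and `sc = 2 ^ K`. -/
theorem setScale_spec {K : ℕ} {s : Env} (h : s.reg .doublings = K) :
    IsScale K (s.reg .del) (s.reg .quad * s.reg .base * s.reg .base)
      ((setScale.eval s).reg .scale) := by
  refine Cmd.loop_induct (s := s.set .scale 1) (x := .e) (m := .var .doublings) (N := K)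
    (fun j s' => IsScale j (s.reg .del) (s.reg .quad * s.reg .base * s.reg .base)
      (s'.reg .scale)) (by simp [h]) ?_ ?_
  · exact ⟨0, le_rfl, by simp, Or.inl rfl, Or.inr rfl⟩
  rintro i _ s₁ hF₁ ⟨j, hj, hsc, h1, h2⟩
  have hd : s₁.reg .del = s.reg .del := by rw [hF₁.1 .del (by decide)]; simp
  have hq : s₁.reg .quad = s.reg .quad := by rw [hF₁.1 .quad (by decide)]; simp
  have hb : s₁.reg .base = s.reg .base := by rw [hF₁.1 .base (by decide)]; simp
  rw [Cmd.eval_ite]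
  simp only [Expr.eval_add, Expr.eval_mul, Expr.eval_var, Env.reg_set, reduceCtorEq, if_false,
    Expr.eval_lit, Cmd.eval_assign, hd, hq, hb]
  split_ifs with hc
  · rcases h2 with h2 | rfl
    · omega
    refine ⟨j + 1, le_rfl, by simp [hsc, pow_succ], Or.inr ?_, Or.inr rfl⟩
    simp only [Env.reg_set, if_true]
    linarith
  · exact ⟨j, by omega, by simp [hsc], by simpa using h1, Or.inl (by simp; omega)⟩

end TropVN

/-! ### The integer arithmetic of one cut -/

namespace TropVN

open Matrix

variable {n : ℕ}

/-- Extend a vector by zeros. -/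
def ofVec (F : Fin n → ℤ) (z : ℕ) : ℤ := if h : z < n then F ⟨z, h⟩ else 0

theorem ofVec_fin (F : Fin n → ℤ) (i : Fin n) : ofVec F i = F i := by simp [ofVec]

/-- The expression may read the very cell that is about to be overwritten. The last premise
available for it, that this cell still has its old value, is what permits updates in place. -/
theorem fillVec {a : ℕ} {f : Expr} {s : Env} {F : Fin n → ℤ} (hn : s.reg .n = n)
    (h : ∀ (i : Fin n) (s' : Env), Frame [.c] [a] s s' → s'.reg .c = (i : ℕ) →
      s'.arr a i = s.arr a i → f.eval s' = F i) :
    arrVec n (((Cmd.loop .c (.var .n) (.store a (.var .c) f)).eval s).arr a) = F := by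
  have key := Fill.loop (X := [.c]) (a := a) (lo := 0) (w := 1) (N := n) (V := ofVec F) (s := s)
    (x := .c) (m := .var .n) (c := .store a (.var .c) f) (by simp) (by simpa using hn) ?_
  · funext i
    rw [arrVec, key.mem _ (Nat.zero_le _) (by have := i.2; omega), ofVec_fin]
  intro c hc s' hs' hc'
  simp only [zero_add, mul_one] at hs' ⊢
  refine Fill.store (by simpa using hc') ?_
  rw [h ⟨c, hc⟩ s' hs'.frame hc' (hs'.out _ (Or.inr le_rfl)), ofVec, dif_pos hc]

theorem fillMat {a : ℕ} {f : Expr} {s : Env} {M : Matrix (Fin n) (Fin n) ℤ} (hn : s.reg .n = n)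
    (h : ∀ (i j : Fin n) (s' : Env), Frame [.c, .e] [a] s s' → s'.reg .c = (i : ℕ) →
      s'.reg .e = (j : ℕ) → s'.arr a (i * n + j) = s.arr a (i * n + j) → f.eval s' = M i j) :
    arrMat n (((Cmd.loop .c (.var .n) (.loop .e (.var .n)
      (.store a (.var .c * .var .n + .var .e) f))).eval s).arr a) = M := by
  have key := Fill.loop (X := [.c, .e]) (a := a) (lo := 0) (w := n) (N := n)
    (V := fun z => ofVec (fun i => ofVec (M i) (z % n)) (z / n)) (s := s) (x := .c)
    (m := .var .n) (c := .loop .e (.var .n) (.store a (.var .c * .var .n + .var .e) f))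
    (by simp) (by simpa using hn) ?_
  · ext i j
    rw [arrMat, of_apply, key.mem _ (Nat.zero_le _) (by
      rw [zero_add]; exact row_lt i.2 j.2), row_div j.2, row_mod j.2, ofVec_fin, ofVec_fin]
  intro c hc s₁ hs₁ hc₁
  rw [zero_add, zero_add, show (c + 1) * n = c * n + n * 1 by ring]
  refine Fill.mono (X := [.e]) ?_ (by simp)
  rw [zero_add] at hs₁
  refine Fill.loop (by simp) (by simpa [hn] using hs₁.frame.1 .n (by simp)) ?_
  intro e he s₂ hs₂ he₂
  rw [mul_one] at hs₂
  rw [mul_one, mul_one, ← add_assoc]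
  have hF : Frame [.c, .e] [a] s s₂ := hs₁.frame.trans (hs₂.frame.mono (by simp) (by simp))
  have hc₂ : s₂.reg .c = c := by rw [hs₂.frame.1 .c (by simp), hc₁]
  refine Fill.store (by simp [hF.1 .n (by simp), hn, hc₂, he₂]) ?_
  rw [h ⟨c, hc⟩ ⟨e, he⟩ s₂ hF hc₂ he₂
    (by rw [hs₂.out _ (Or.inr le_rfl), hs₁.out _ (Or.inr (by simp))]), row_div he, row_mod he,
    ofVec, dif_pos hc, ofVec, dif_pos he]

theorem unitBall_spec {s : Env} (hn : s.reg .n = n) :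
    (unitBall.eval s).reg .found = 0 ∧ (unitBall.eval s).reg .gam = 1 ∧
      (unitBall.eval s).reg .del = 1 ∧ arrVec n ((unitBall.eval s).arr 5) = 0 ∧
      arrMat n ((unitBall.eval s).arr 6) = 1 := by
  set s₁ := ((s.set .found 0).set .gam 1).set .del 1 with hs₁
  set c₁ : Cmd := .loop .c (.var .n) (.store 5 (.var .c) (.lit 0)) with hc₁
  set c₂ : Cmd := .loop .c (.var .n) (.loop .e (.var .n) (.store 6 (.var .c * .var .n + .var .e)
        (.le (.var .c) (.var .e) * .le (.var .e) (.var .c)))) with hc₂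
  have e : unitBall.eval s = c₂.eval (c₁.eval s₁) := rfl
  have hF : Frame [.c, .e] [5, 6] s₁ (c₂.eval (c₁.eval s₁)) :=
    ((c₁.frame s₁).mono (by decide) (by decide)).trans
      ((c₂.frame _).mono (by decide) (by decide))
  have hn₁ : s₁.reg .n = n := by simp [hs₁, hn]
  rw [e]
  refine ⟨?_, ?_, ?_, ?_, ?_⟩
  · rw [hF.1 _ (by decide)]; simp [hs₁]
  · rw [hF.1 _ (by decide)]; simp [hs₁]
  · rw [hF.1 _ (by decide)]; simp [hs₁]
  · rw [c₂.eval_arr (by decide)]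
    exact fillVec hn₁ fun i s' _ _ _ => rfl
  · refine fillMat (by rw [c₁.eval_reg (by decide), hn₁]) fun i j s' _ h1 h2 _ => ?_
    simp only [Expr.eval_mul, Expr.eval_le, Expr.eval_var, h1, h2, Nat.cast_le, one_apply,
      Fin.ext_iff]
    split_ifs <;> first | rfl | omega

theorem applyMatrix_spec {pts : ℕ → Fin n →₀ ℕ} {m D p v : ℕ} {s : Env} (h : Ready pts m D s)
    (hp : p < m) (hv : v < m) (hsp : s.reg .p = p) (hsv : s.reg .viol = v) :
    arrVec n ((applyMatrix.eval s).arr 7) = arrMat n (s.arr 6) *ᵥ dvec pts p v := by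
  refine fillVec h.reg_n fun i s' hF hi _ => ?_
  have hr : Ready pts m D s' := h.frame hF (by decide) (by decide) (by decide) (by decide)
    (by decide) (by decide)
  refine sum_eval_eq hr.reg_n fun j => ?_
  have e : ((i : ℕ) * (n : ℤ) + (j : ℕ)).toNat = i * n + j := by norm_cast
  rw [Expr.eval_mul, delta_eval (m := m) (q := v) (p := p) (c := j) (pts := pts)
    (by simpa using hr.reg_n) (by simp [hF.1 .viol (by decide), hsv]) (by simp)
    (by simp [hF.1 .p (by decide), hsp]) (by simpa using hr.rows) hp hv j.2]
  simp [entry, hr.reg_n, hi, e, hF.2 6 (by decide), arrMat, dvec]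

theorem setDen_spec {pts : ℕ → Fin n →₀ ℕ} {m D p v : ℕ} {s : Env} (h : Ready pts m D s)
    (hp : p < m) (hv : v < m) (hsp : s.reg .p = p) (hsv : s.reg .viol = v) :
    arrVec n ((setDen.eval s).arr 7) = arrMat n (s.arr 6) *ᵥ dvec pts p v ∧
    IsScale (doublingCount n D) (s.reg .del)
      ((dvec pts p v ⬝ᵥ arrMat n (s.arr 6) *ᵥ dvec pts p v) * s.reg .base * s.reg .base)
      ((setDen.eval s).reg .scale) ∧
    (setDen.eval s).reg .den = 2 * n * s.reg .del * (setDen.eval s).reg .scale *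
      (setDen.eval s).reg .scale + s.reg .base * s.reg .base *
      (dvec pts p v ⬝ᵥ arrMat n (s.arr 6) *ᵥ dvec pts p v) := by
  set g := arrMat n (s.arr 6) *ᵥ dvec pts p v with hg
  set s₁ := applyMatrix.eval s with hs₁
  have hF₁ : Frame applyMatrix.vars applyMatrix.arrs s s₁ := applyMatrix.frame s
  have hg₁ : arrVec n (s₁.arr 7) = g := applyMatrix_spec h hp hv hsp hsv
  have hr₁ : Ready pts m D s₁ := h.frame hF₁ (by decide) (by decide) (by decide) (by decide)
    (by decide) (by decide)
  set Q := dvec pts p v ⬝ᵥ g with hQ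
  have e₂ : (Expr.sum .c (.var .n) (.get 7 (.var .c) * delta .viol .c)).eval s₁ = Q := by
    refine sum_eval_eq hr₁.reg_n fun i => ?_
    rw [Expr.eval_mul, delta_eval (m := m) (q := v) (p := p) (c := i) (pts := pts)
      (by simpa using hr₁.reg_n) (by simp [hF₁.1 .viol (by decide), hsv]) (by simp)
      (by simp [hF₁.1 .p (by decide), hsp]) (by simpa using hr₁.rows) hp hv i.2, ← hg₁]
    simp [dvec, arrVec]
    ring
  set s₂ := s₁.set .quad Q with hs₂
  set s₃ := setScale.eval s₂ with hs₃
  have hF₃ : Frame setScale.vars setScale.arrs s₂ s₃ := setScale.frame s₂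
  have hsc := setScale_spec (s := s₂) (K := doublingCount n D) (by simpa [hs₂] using hr₁.doublings)
  have e : setDen.eval s = s₃.set .den (2 * n * s.reg .del * s₃.reg .scale * s₃.reg .scale +
      s.reg .base * s.reg .base * Q) := by
    have e' : setDen.eval s = (Cmd.assign .den (.lit 2 * .var .n * .var .del * .var .scale *
        .var .scale + .var .base * .var .base * .var .quad)).eval s₃ := by
      rw [hs₃, hs₂, ← e₂]; rfl
    rw [e', Cmd.eval_assign]
    simp [hF₃.1 .n (by decide), hF₃.1 .del (by decide), hF₃.1 .base (by decide),
      hF₃.1 .quad (by decide), hs₂, hF₁.1 .n (by decide), hF₁.1 .del (by decide),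
      hF₁.1 .base (by decide), h.reg_n]
  rw [e]
  refine ⟨?_, ?_, by simp⟩
  · rw [Env.arr_set, hF₃.2 7 (by decide)]; exact hg₁
  · simpa [hs₂, hF₁.1 .del (by decide), hF₁.1 .base (by decide)] using hsc

theorem cut_spec {pts : ℕ → Fin n →₀ ℕ} {m D p v : ℕ} {s : Env} (h : Ready pts m D s)
    (hp : p < m) (hv : v < m) (hsp : s.reg .p = p) (hsv : s.reg .viol = v)
    {A : Matrix (Fin n) (Fin n) ℤ} (hA : arrMat n (s.arr 6) = A) {C : Fin n → ℤ}
    (hC : arrVec n (s.arr 5) = C) {g : Fin n → ℤ} (hg : A *ᵥ dvec pts p v = g) {Q b : ℤ}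
    (hQ : dvec pts p v ⬝ᵥ g = Q) (hb : s.reg .base = b) :
    ∃ sc den : ℤ, IsScale (doublingCount n D) (s.reg .del) (Q * b * b) sc ∧
      den = 2 * n * s.reg .del * sc * sc + b * b * Q ∧
      (cut.eval s).reg .gam = 2 * den * s.reg .gam ∧
      (cut.eval s).reg .del = 16 * n * n * s.reg .del * den ∧
      arrVec n ((cut.eval s).arr 5) = (fun i => 2 * den * C i + s.reg .gam * sc * b * g i) ∧
      arrMat n ((cut.eval s).arr 6) =
        of fun i j => (16 * n * n + 1) * (den * A i j - b * b * g i * g j) := by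
  subst hA hC hg hQ hb
  obtain ⟨h7, hsc, hden⟩ := setDen_spec h hp hv hsp hsv
  set g := arrMat n (s.arr 6) *ᵥ dvec pts p v
  set Q := dvec pts p v ⬝ᵥ g
  set s₁ := setDen.eval s with hs₁
  have hF₁ : Frame setDen.vars setDen.arrs s s₁ := setDen.frame s
  have hr₁ : Ready pts m D s₁ := h.frame hF₁ (by decide) (by decide) (by decide) (by decide)
    (by decide) (by decide)
  set s₂ := moveCentre.eval s₁ with hs₂
  have hF₂ : Frame moveCentre.vars moveCentre.arrs s₁ s₂ := moveCentre.frame s₁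
  have hr₂ : Ready pts m D s₂ := hr₁.frame hF₂ (by decide) (by decide) (by decide) (by decide)
    (by decide) (by decide)
  set s₃ := shrinkMatrix.eval s₂ with hs₃
  have hF₃ : Frame shrinkMatrix.vars shrinkMatrix.arrs s₂ s₃ := shrinkMatrix.frame s₂
  have e : cut.eval s = (s₃.set .gam (2 * s₃.reg .den * s₃.reg .gam)).set .del
      (16 * s₃.reg .n * s₃.reg .n * s₃.reg .del * s₃.reg .den) := by
    have e' : cut.eval s = (Cmd.assign .del (.lit 16 * .var .n * .var .n * .var .del *
      .var .den)).eval ((Cmd.assign .gam (.lit 2 * .var .den * .var .gam)).eval s₃) := rfl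
    rw [e']; simp
  have hg7 : ∀ i : Fin n, s₁.arr 7 i = g i := fun i => congrFun h7 i
  refine ⟨s₁.reg .scale, s₁.reg .den, hsc, hden, ?_, ?_, ?_, ?_⟩
  · rw [e]
    simp [hF₃.1 .den (by decide), hF₃.1 .gam (by decide), hF₂.1 .den (by decide),
      hF₂.1 .gam (by decide), hF₁.1 .gam (by decide)]
  · rw [e]
    simp [hF₃.1 .den (by decide), hF₃.1 .n (by decide), hF₃.1 .del (by decide), hr₂.reg_n,
      hF₂.1 .den (by decide), hF₂.1 .del (by decide), hF₁.1 .del (by decide)]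
  · rw [e, Env.arr_set, Env.arr_set, hF₃.2 5 (by decide)]
    refine fillVec hr₁.reg_n fun i s' hF hi h5 => ?_
    simp [hF.1 .den (by decide), hF.1 .gam (by decide), hF.1 .scale (by decide),
      hF.1 .base (by decide), hF.2 7 (by decide), hi, h5, hF₁.1 .gam (by decide),
      hF₁.1 .base (by decide), hg7, arrVec, hF₁.2 5 (by decide)]
  · rw [e, Env.arr_set, Env.arr_set]
    refine fillMat hr₂.reg_n fun i j s' hF hi hj h6 => ?_
    have e6 : ((i : ℕ) * (n : ℤ) + (j : ℕ)).toNat = i * n + j := by norm_cast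
    simp [entry, hF.1 .den (by decide), hF.1 .n (by decide), hF.1 .base (by decide),
      hF.2 7 (by decide), hi, hj, e6, h6, hr₂.reg_n, hF₂.1 .den (by decide),
      hF₂.1 .base (by decide), hF₂.2 7 (by decide), hF₁.1 .base (by decide), hg7, arrMat,
      hF₂.2 6 (by decide), hF₁.2 6 (by decide)]

/-! ### Correctness of the vertex test -/

/-- The rational matrix with numerators `A` and denominator `d`. -/
noncomputable def ratMat (A : Matrix (Fin n) (Fin n) ℤ) (d : ℤ) : Matrix (Fin n) (Fin n) ℝ :=
  of fun i j => (A i j : ℝ) / d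

/-- The rational vector with numerators `C` and denominator `d`. -/
noncomputable def ratVec (C : Fin n → ℤ) (d : ℤ) : Fin n → ℝ := fun i => (C i : ℝ) / d

theorem ratMat_mulVec (A : Matrix (Fin n) (Fin n) ℤ) (a : Fin n → ℤ) (d : ℤ) :
    ratMat A d *ᵥ (fun i => (a i : ℝ)) = ratVec (A *ᵥ a) d := by
  funext i
  simp only [mulVec, dotProduct, ratMat, ratVec, of_apply, Int.cast_sum, Int.cast_mul,
    Finset.sum_div]
  exact Finset.sum_congr rfl fun j _ => by ring

theorem dotProduct_ratVec (a g : Fin n → ℤ) (d : ℤ) :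
    (fun i => (a i : ℝ)) ⬝ᵥ ratVec g d = ((a ⬝ᵥ g : ℤ) : ℝ) / d := by
  simp only [dotProduct, ratVec, Int.cast_sum, Int.cast_mul, Finset.sum_div]
  exact Finset.sum_congr rfl fun j _ => by ring

/-- For `s = sc / b` and `l = 1 / (2 * n)` one has `s ^ 2 + l * q = den / (2 * n * d * b ^ 2)` with
`q = Q / d`. The other factors come from `1 + l ^ 2 / 4 = (16 * n ^ 2 + 1) / (16 * n ^ 2)`. -/
theorem ratMat_cut (hn : 1 ≤ n) (A : Matrix (Fin n) (Fin n) ℤ) (a : Fin n → ℤ) {d sc b den Q : ℤ}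
    {g : Fin n → ℤ} (hg : A *ᵥ a = g) (hQ : a ⬝ᵥ g = Q) (hd : 0 < d) (hb : 0 < b)
    (hden : den = 2 * n * d * sc * sc + b * b * Q) (hpos : 0 < den) :
    cutMatrix (ratMat A d) (fun i => (a i : ℝ)) (1 / (2 * n)) (sc / b) =
      ratMat (of fun i j => (16 * n * n + 1) * (den * A i j - b * b * g i * g j))
        (16 * n * n * d * den) := by
  have hn0 : (n : ℝ) ≠ 0 := by positivity
  have hd0 : (d : ℝ) ≠ 0 := by exact_mod_cast hd.ne'
  have hb0 : (b : ℝ) ≠ 0 := by exact_mod_cast hb.ne'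
  have hp0 : (den : ℝ) ≠ 0 := by exact_mod_cast hpos.ne'
  have hs : ((sc : ℝ) / b) ^ 2 + 1 / (2 * n) * ((Q : ℝ) / d) = den / (2 * n * d * b ^ 2) := by
    rw [hden]; push_cast; field_simp
  rw [cutMatrix, ratMat_mulVec, dotProduct_ratVec, hg, hQ, hs]
  ext i j
  simp only [Matrix.smul_apply, Matrix.sub_apply, vecMulVec_apply, ratMat, ratVec, of_apply, smul_eq_mul]
  push_cast
  field_simp
  ring

theorem ratVec_cut (hn : 1 ≤ n) (A : Matrix (Fin n) (Fin n) ℤ) (C a : Fin n → ℤ)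
    {d γ sc b den Q : ℤ} {g : Fin n → ℤ} (hg : A *ᵥ a = g) (hQ : a ⬝ᵥ g = Q) (hd : 0 < d)
    (hγ : 0 < γ) (hb : 0 < b) (hden : den = 2 * n * d * sc * sc + b * b * Q) (hpos : 0 < den) :
    cutCentre (ratMat A d) (ratVec C γ) (fun i => (a i : ℝ)) (1 / (2 * n)) (sc / b) =
      ratVec (fun i => 2 * den * C i + γ * sc * b * g i) (2 * den * γ) := by
  have hn0 : (n : ℝ) ≠ 0 := by positivity
  have hd0 : (d : ℝ) ≠ 0 := by exact_mod_cast hd.ne'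
  have hγ0 : (γ : ℝ) ≠ 0 := by exact_mod_cast hγ.ne'
  have hb0 : (b : ℝ) ≠ 0 := by exact_mod_cast hb.ne'
  have hp0 : (den : ℝ) ≠ 0 := by exact_mod_cast hpos.ne'
  have hs : ((sc : ℝ) / b) ^ 2 + 1 / (2 * n) * ((Q : ℝ) / d) = den / (2 * n * d * b ^ 2) := by
    rw [hden]; push_cast; field_simp
  rw [cutCentre, ratMat_mulVec, dotProduct_ratVec, hg, hQ, hs]
  funext i
  simp only [Pi.add_apply, Pi.smul_apply, ratVec, smul_eq_mul]
  push_cast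
  field_simp

end TropVN

/-! ### Correctness of the separability test -/

namespace TropVN

open Matrix

variable {n : ℕ}

/-- Some linear functional is smaller at `pts p` than at all other vectors. -/
def Separable (pts : ℕ → Fin n →₀ ℕ) (m p : ℕ) : Prop :=
  ∃ w : Fin n → ℝ, ∀ q < m, pts q ≠ pts p → 0 < ∑ i, w i * ((pts q i : ℝ) - pts p i)

/-- The centre itself is the functional. Only its numerators are tested, since a positive
denominator does not affect signs. -/
theorem separable_of_not_violated {pts : ℕ → Fin n →₀ ℕ} {m p : ℕ} {C : Fin n → ℤ}
    (h : ∀ q < m, ¬ Violated pts C p q) : Separable pts m p := by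
  refine ⟨fun i => C i, fun q hq hne => ?_⟩
  have h1 : 0 < ∑ i, dvec pts p q i * C i := by
    by_contra h2
    exact h q hq ⟨hne, not_lt.1 h2⟩
  have h2 : ((∑ i, dvec pts p q i * C i : ℤ) : ℝ) = ∑ i, (C i : ℝ) * ((pts q i : ℝ) - pts p i) := by
    push_cast [dvec]
    exact Finset.sum_congr rfl fun i _ => mul_comm _ _
  rw [← h2]
  exact_mod_cast h1

/-- The region that the ellipsoid method searches. -/
def searchRegion (pts : ℕ → Fin n →₀ ℕ) (m p : ℕ) : Set (Fin n → ℝ) :=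
  feasibleRegion fun j : {q : Fin m // pts q ≠ pts p} => dvec pts p j.1

theorem ball_subset_searchRegion (hn : 1 ≤ n) {pts : ℕ → Fin n →₀ ℕ} {m p D : ℕ} (h1 : 1 ≤ D)
    (hD : ∀ q < m, ∀ i, pts q i ≤ D) (hp : p < m) (h : Separable pts m p) :
    ∃ c : Fin n → ℝ, ∀ u : Fin n → ℝ, u ⬝ᵥ u ≤ ((1 / 2) ^ radiusExp n D) ^ 2 →
      c + u ∈ searchRegion pts m p := by
  classical
  obtain ⟨w, hw⟩ := h
  refine ball_subset_feasibleRegion hn _ D _ h1 (fun j i => ?_) w (fun j => ?_)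
    (radius_exponent_le n D)
  · have e1 := hD j.1 j.1.2 i
    have e2 := hD p hp i
    rw [abs_le, dvec]
    omega
  · have := hw j.1 j.1.2 j.2
    simpa [dvec] using this

theorem sum_sq_le {pts : ℕ → Fin n →₀ ℕ} {m p v D : ℕ} (hD : ∀ q < m, ∀ i, pts q i ≤ D)
    (hp : p < m) (hv : v < m) : dvec pts p v ⬝ᵥ dvec pts p v ≤ n * D ^ 2 := by
  have h : ∀ i ∈ Finset.univ, dvec pts p v i * dvec pts p v i ≤ (D : ℤ) ^ 2 := by
    intro i _
    have e1 := hD v hv i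
    have e2 := hD p hp i
    rw [← sq]
    refine sq_le_sq' ?_ ?_ <;> rw [dvec] <;> omega
  simpa [dotProduct] using Finset.sum_le_card_nsmul _ _ _ h

theorem cast_dotProduct (a c : Fin n → ℤ) :
    (fun i => (a i : ℝ)) ⬝ᵥ (fun i => (c i : ℝ)) = ((a ⬝ᵥ c : ℤ) : ℝ) := by
  simp [dotProduct]

/-- After `t` cuts the form at a cut vector is at most `2 ^ t * (n * D ^ 2)`. The number of
doublings is chosen so that the scale always reaches the root of this, in units of `1 / 2 ^
radiusExp n D`. -/
theorem doubling_bound {t D : ℕ} (ht : t < iterCount n D) :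
    2 ^ t * (n * D ^ 2) * (2 ^ radiusExp n D * 2 ^ radiusExp n D) ≤
      2 ^ doublingCount n D * 2 ^ doublingCount n D := by
  have h1 : ∀ m : ℕ, m ≤ 2 ^ m := fun m => Nat.lt_two_pow_self.le
  calc 2 ^ t * (n * D ^ 2) * (2 ^ radiusExp n D * 2 ^ radiusExp n D)
      ≤ 2 ^ t * (2 ^ n * (2 ^ D) ^ 2) * (2 ^ radiusExp n D * 2 ^ radiusExp n D) := by
        gcongr
        · exact h1 n
        · exact h1 D
    _ = 2 ^ (t + (n + D * 2) + (radiusExp n D + radiusExp n D)) := by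
        rw [← pow_mul, ← pow_add, ← pow_add, ← pow_add, ← pow_add]
    _ ≤ 2 ^ (doublingCount n D + doublingCount n D) :=
        Nat.pow_le_pow_right (by norm_num) (by unfold doublingCount; omega)
    _ = _ := pow_add _ _ _

/-- One cut of the ellipsoid method, in terms of numerators and denominators. -/
theorem ellipsoid_cut (hn : 1 ≤ n) {pts : ℕ → Fin n →₀ ℕ} {m p v D t : ℕ} (h1 : 1 ≤ D)
    (hD : ∀ q < m, ∀ i, pts q i ≤ D) (hp : p < m) (hv : v < m) (hsep : Separable pts m p)
    {A : Matrix (Fin n) (Fin n) ℤ} {C g : Fin n → ℤ} {d γ sc b den Q : ℤ} (hd : 0 < d) (hγ : 0 < γ)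
    (hinv : EllipsoidInv (searchRegion pts m p) t (ratMat A d) (ratVec C γ))
    (ht : t < iterCount n D) (hviol : Violated pts C p v)
    (hg : A *ᵥ dvec pts p v = g) (hQ : dvec pts p v ⬝ᵥ g = Q) (hb : b = 2 ^ radiusExp n D)
    (hsc : IsScale (doublingCount n D) d (Q * b * b) sc)
    (hden : den = 2 * n * d * sc * sc + b * b * Q) :
    0 < den ∧ EllipsoidInv (searchRegion pts m p) (t + 1)
      (ratMat (of fun i j => (16 * n * n + 1) * (den * A i j - b * b * g i * g j))
        (16 * n * n * d * den))
      (ratVec (fun i => 2 * den * C i + γ * sc * b * g i) (2 * den * γ)) := by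
  obtain ⟨c, hball⟩ := ball_subset_searchRegion hn h1 hD hp hsep
  set a := dvec pts p v with ha
  set r : ℝ := (1 / 2) ^ radiusExp n D with hr
  have hd' : (0 : ℝ) < d := by exact_mod_cast hd
  have hγ' : (0 : ℝ) < γ := by exact_mod_cast hγ
  have hb0 : 0 < b := by rw [hb]; positivity
  have hb' : (0 : ℝ) < b := by exact_mod_cast hb0
  have hrb : r ^ 2 = 1 / (b : ℝ) ^ 2 := by
    rw [hr, hb]; push_cast; rw [div_pow, one_pow, div_pow, one_pow]
  have hq : (fun i => (a i : ℝ)) ⬝ᵥ ratMat A d *ᵥ (fun i => (a i : ℝ)) = (Q : ℝ) / d := by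
    rw [ratMat_mulVec, hg, dotProduct_ratVec, hQ]
  have haa : 1 ≤ a ⬝ᵥ a := one_le_sum_sq.2 hviol.1
  have haa' : (1 : ℝ) ≤ (a ⬝ᵥ a : ℤ) := by exact_mod_cast haa
  -- The ball of radius `1 / b` in the search region bounds the width of the ellipsoid below, and
  -- the cut vector is a nonzero integer vector. Hence `1 / b` is a fine enough unit for the square
  -- root.
  have hlow : 1 / (b : ℝ) ^ 2 ≤ Q / d := by
    have := hinv.sq_mul_le hball (fun i => (a i : ℝ))
    rw [hq, cast_dotProduct, hrb] at this
    refine le_trans ?_ this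
    exact le_mul_of_one_le_right (by positivity) haa'
  have hqpos : (0 : ℝ) < Q / d := lt_of_lt_of_le (by positivity) hlow
  have hQ' : (0 : ℝ) < Q := by
    rw [div_pos_iff_of_pos_right hd'] at hqpos; exact hqpos
  have hQ0 : 0 < Q := by exact_mod_cast hQ'
  obtain ⟨j, hj, hscj, hs1, hs2⟩ := hsc
  have hsc0 : 0 < sc := by rw [hscj]; positivity
  have hsc' : (0 : ℝ) < sc := by exact_mod_cast hsc0
  have hn0 : (0 : ℤ) < n := by exact_mod_cast hn
  have hden0 : 0 < den := by rw [hden]; positivity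
  -- If the scale stopped because all doublings were used, the growth bound on the ellipsoid shows
  -- that it has still reached its target.
  have hup : Q * b * b ≤ sc * sc * d := by
    rcases hs2 with h | h
    · exact h
    have hle := hinv.le (fun i => (a i : ℝ))
    rw [hq, cast_dotProduct, div_le_iff₀ hd'] at hle
    have hle' : Q ≤ 2 ^ t * (a ⬝ᵥ a) * d := by exact_mod_cast hle
    have hsq := sum_sq_le hD hp hv
    have hdb : ((2 ^ t * (n * D ^ 2) * (2 ^ radiusExp n D * 2 ^ radiusExp n D) : ℕ) : ℤ) ≤
        ((2 ^ doublingCount n D * 2 ^ doublingCount n D : ℕ) : ℤ) := by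
      exact_mod_cast doubling_bound ht
    push_cast at hdb
    rw [hscj, h]
    calc Q * b * b ≤ (2 ^ t * (n * D ^ 2) * d) * b * b := by
          have : Q ≤ 2 ^ t * (n * D ^ 2) * d := by
            refine hle'.trans ?_
            gcongr
          gcongr
      _ = (2 ^ t * (n * D ^ 2) * (2 ^ radiusExp n D * 2 ^ radiusExp n D)) * d := by
          rw [hb]; ring
      _ ≤ _ := by gcongr
  have hup' : (Q : ℝ) * b * b ≤ sc * sc * d := by exact_mod_cast hup
  refine ⟨hden0, ?_⟩
  rw [← ratMat_cut hn A a hg hQ hd hb0 hden hden0,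
    ← ratVec_cut hn A C a hg hQ hd hγ hb0 hden hden0]
  refine hinv.step hn ⟨c + 0, hball 0 (by simpa using sq_nonneg r)⟩ ?_ (by positivity) ?_ ?_ ?_ ?_
  · rw [hq]; exact hqpos
  · rw [hq, div_pow, div_le_div_iff₀ hd' (by positivity)]
    linarith
  · rw [hq, div_pow]
    rcases hs1 with h | h
    -- Without any doubling, `s = 1 / b`, and the lower bound on the width already gives `s ^ 2 ≤
    -- q`.
    · have : sc = 1 := by rw [hscj, h, pow_zero]
      rw [this]
      push_cast
      linarith
    · have h' : (sc : ℝ) * sc * d < 4 * (Q * b * b) := by exact_mod_cast h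
      rw [mul_div_assoc', div_le_div_iff₀ (by positivity) hd']
      linarith
  · intro x hx
    exact hx.2 ⟨⟨v, hv⟩, hviol.1⟩
  · rw [dotProduct_ratVec]
    refine div_nonpos_of_nonpos_of_nonneg ?_ hγ'.le
    exact_mod_cast hviol.2

/-- The state of the vertex test after `t` iterations. -/
def TestInv (pts : ℕ → Fin n →₀ ℕ) (m p t : ℕ) (s : Env) : Prop :=
  (s.reg .found = 1 ∧ Separable pts m p) ∨ (s.reg .found = 0 ∧ (Separable pts m p →
    0 < s.reg .del ∧ 0 < s.reg .gam ∧ EllipsoidInv (searchRegion pts m p) t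
      (ratMat (arrMat n (s.arr 6)) (s.reg .del)) (ratVec (arrVec n (s.arr 5)) (s.reg .gam))))

/-- The flag `found` is raised only at a centre that separates, and the rounds never lower it. The
claims about the ellipsoid are made only under separability; without it the denominators may have
any sign, which does no harm. -/
theorem TestInv.step (hn : 1 ≤ n) {pts : ℕ → Fin n →₀ ℕ} {m p D t : ℕ} (h1 : 1 ≤ D)
    (hD : ∀ q < m, ∀ i, pts q i ≤ D) (hp : p < m) {s : Env} (hr : Ready pts m D s)
    (hsp : s.reg .p = p) (ht : t < iterCount n D) (h : TestInv pts m p t s) :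
    TestInv pts m p (t + 1) (ellipsoidStep.eval s) := by
  set s₁ := findViol.eval s with hs₁
  have hF : Frame findViol.vars findViol.arrs s s₁ := findViol.frame s
  have hr₁ : Ready pts m D s₁ := hr.frame hF (by decide) (by decide) (by decide) (by decide)
    (by decide) (by decide)
  have e : ellipsoidStep.eval s =
      if s₁.reg .viol + 1 ≤ 0 then s₁.set .found 1 else cut.eval s₁ := rfl
  have hfound : s₁.reg .found = s.reg .found := hF.1 .found (by decide)
  rw [e]
  rcases h with ⟨hf, hsep⟩ | ⟨hf, hinv⟩
  · left
    refine ⟨?_, hsep⟩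
    split_ifs
    · simp
    · rw [cut.eval_reg (by decide), hfound, hf]
  rcases findViol_spec hr hp hsp with ⟨hv, hall⟩ | ⟨v, hvm, hv, hviol⟩
  · left
    rw [← hs₁] at hv
    rw [hv, if_pos (by norm_num)]
    exact ⟨by simp, separable_of_not_violated hall⟩
  · right
    rw [← hs₁] at hv
    rw [hv, if_neg (by omega)]
    refine ⟨by rw [cut.eval_reg (by decide), hfound, hf], fun hsep => ?_⟩
    obtain ⟨hd, hγ, hE⟩ := hinv hsep
    obtain ⟨sc, den, hsc, hden, e1, e2, e3, e4⟩ := cut_spec hr₁ hp hvm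
      (by rw [hF.1 .p (by decide), hsp]) hv rfl rfl rfl rfl hr₁.base
    rw [hF.1 .del (by decide)] at hsc hden e2
    rw [hF.1 .gam (by decide)] at e1 e3
    rw [hF.2 6 (by decide)] at hsc hden e3 e4
    rw [hF.2 5 (by decide)] at e3
    obtain ⟨hpos, hE'⟩ := ellipsoid_cut hn h1 hD hp hvm hsep hd hγ hE ht hviol rfl rfl rfl hsc hden
    have hn0 : (0 : ℤ) < n := by exact_mod_cast hn
    rw [e1, e2, e3, e4]
    exact ⟨by positivity, by positivity, hE'⟩

/-- If the flag were still down for a separable vector, `iterCount n D` cuts would have been made,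
and this is exactly the number excluded by `EllipsoidInv.time_lt`. -/
theorem vertexTest_spec (hn : 1 ≤ n) {pts : ℕ → Fin n →₀ ℕ} {m p D : ℕ} (h1 : 1 ≤ D)
    (hD : ∀ q < m, ∀ i, pts q i ≤ D) (hp : p < m) {s : Env} (hr : Ready pts m D s)
    (hsp : s.reg .p = p) :
    ((vertexTest.eval s).reg .found = 1 ∧ Separable pts m p) ∨
      ((vertexTest.eval s).reg .found = 0 ∧ ¬ Separable pts m p) := by
  set s₀ := unitBall.eval s with hs₀
  have hF₀ : Frame unitBall.vars unitBall.arrs s s₀ := unitBall.frame s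
  have hr₀ : Ready pts m D s₀ := hr.frame hF₀ (by decide) (by decide) (by decide) (by decide)
    (by decide) (by decide)
  obtain ⟨i1, i2, i3, i4, i5⟩ := unitBall_spec hr.reg_n
  have key : TestInv pts m p (iterCount n D) (vertexTest.eval s) := by
    refine Cmd.loop_induct (s := s₀) (x := .t) (m := .var .iters) (c := ellipsoidStep)
      (TestInv pts m p) (by simp [hr₀.iters]) (Or.inr ⟨i1, fun _ => ?_⟩) ?_
    · rw [i2, i3, i4, i5]
      refine ⟨one_pos, one_pos, ?_⟩
      have e1 : ratMat (1 : Matrix (Fin n) (Fin n) ℤ) 1 = 1 := by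
        ext i j
        by_cases h : i = j <;> simp [ratMat, one_apply, h]
      have e2 : ratVec (0 : Fin n → ℤ) 1 = 0 := by
        funext i; simp [ratVec]
      rw [e1, e2]
      exact EllipsoidInv.init fun x hx => hx.1
    · intro t ht s' hF hs'
      refine TestInv.step hn h1 hD hp (hr₀.frame (hF.set (x := .t) List.mem_cons_self t) (by decide)
        (by decide) (by decide) (by decide) (by decide) (by decide)) ?_ ht ?_
      · simp [hF.1 .p (by decide), hF₀.1 .p (by decide), hsp]
      · simpa [TestInv] using hs'
  rcases key with h | ⟨h, hE⟩
  · exact Or.inl h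
  · refine Or.inr ⟨h, fun hsep => ?_⟩
    obtain ⟨-, -, hE'⟩ := hE hsep
    obtain ⟨c, hball⟩ := ball_subset_searchRegion hn h1 hD hp hsep
    exact lt_irrefl _ (hE'.time_lt hn hball)

end TropVN

namespace TropVN

/-! ### The minimal vertices -/

/-- Decide for every vector whether it is a vertex. -/
def markVertices : Cmd :=
  .loop .p (.var .cnt) (.seq vertexTest (.store 4 (.var .p) (.var .found)))

/-- The number of vertices that are below vector number `p`, or equal to it and earlier. -/
def dominators : Expr :=
  .sum .q (.var .cnt) (.get 4 (.var .q) *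
    (.le (.var .n) (.sum .c (.var .n) (.le (entry 2 .q .c) (entry 2 .p .c))) *
      .le (.var .q + .lit 1)
        (.var .p + .var .cnt * .sum .c (.var .n) (entry 2 .p .c - entry 2 .q .c))))

/-- Append vector number `p` to the output. -/
def emit : Cmd :=
  .seq (.loop .c (.var .n) (.store 0 (.var .out * .var .n + .var .c) (entry 2 .p .c)))
    (.assign .out (.var .out + .lit 1))

/-- Write all minimal vertices to the output. -/
def emitAll : Cmd :=
  .seq (.assign .out (.lit 0)) (.seq (.loop .p (.var .cnt)
    (.ite (.lit 1) (.get 4 (.var .p) * .le dominators (.lit 0)) emit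
      (.assign .out (.var .out)))) (.assign .n (.var .out)))

/-- The whole algorithm. -/
def mainCmd : Cmd := .seq sumset (.seq params (.seq markVertices emitAll))

variable {n : ℕ}

/-- The cells of `A` tell which vectors are vertices. -/
def Marked (pts : ℕ → Fin n →₀ ℕ) (m : ℕ) (A : ℕ → ℤ) (p : ℕ) : Prop :=
  (A p = 1 ∧ Separable pts m p) ∨ (A p = 0 ∧ ¬ Separable pts m p)

theorem markVertices_spec (hn : 1 ≤ n) {pts : ℕ → Fin n →₀ ℕ} {m D : ℕ} (h1 : 1 ≤ D)
    (hD : ∀ q < m, ∀ i, pts q i ≤ D) {s : Env} (hr : Ready pts m D s) :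
    ∀ p < m, Marked pts m ((markVertices.eval s).arr 4) p := by
  refine Cmd.loop_induct (s := s) (x := .p) (m := .var .cnt) (N := m)
    (c := .seq vertexTest (.store 4 (.var .p) (.var .found)))
    (fun j s' => ∀ p < j, Marked pts m (s'.arr 4) p) (by simp [hr.cnt]) (by simp) ?_
  intro p hp s₁ hF hs₁ p' hp'
  set s₂ := s₁.set .p p with hs₂
  have hr₂ : Ready pts m D s₂ := hr.frame (hF.set (x := .p) List.mem_cons_self p) (by decide)
        (by decide) (by decide) (by decide) (by decide) (by decide)
  have hspec := vertexTest_spec hn h1 hD hp hr₂ (by simp [hs₂])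
  have h4 : (vertexTest.eval s₂).arr 4 = s₁.arr 4 := vertexTest.eval_arr (by decide) s₂
  have hpr : (vertexTest.eval s₂).reg .p = p := by
    rw [vertexTest.eval_reg (by decide)]; simp [hs₂]
  have e : ∀ z, ((Cmd.seq vertexTest (.store 4 (.var .p) (.var .found))).eval s₂).arr 4 z =
      if z = p then (vertexTest.eval s₂).reg .found else s₁.arr 4 z := by
    intro z
    rw [Cmd.eval_seq, Cmd.eval, Env.arr_setArr, Expr.eval_var, Expr.eval_var, hpr, h4]
    simp
  rw [Marked, e]
  by_cases h : p' = p
  · subst h; simpa using hspec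
  · rw [if_neg h]
    exact hs₁ p' (by omega)

/-- Vector number `p` is a vertex, and no vertex is below it, or equal to it and earlier. -/
def Kept (pts : ℕ → Fin n →₀ ℕ) (m p : ℕ) : Prop :=
  Separable pts m p ∧
    ∀ q < m, Separable pts m q → pts q ≤ pts p → ¬ (q < p ∨ pts q ≠ pts p)

theorem sum_indicator_eq_iff {f : Fin n → Prop} [DecidablePred f] :
    (n : ℤ) ≤ ∑ i, (if f i then 1 else 0 : ℤ) ↔ ∀ i, f i := by
  have h1 : ∑ i, (if f i then 1 else 0 : ℤ) = ((Finset.univ.filter f).card : ℤ) := by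
    rw [Finset.sum_boole]
  rw [h1]
  constructor
  · intro h i
    have h2 : (Finset.univ.filter f).card = (Finset.univ : Finset (Fin n)).card :=
      le_antisymm (Finset.card_filter_le _ _) (by simpa using h)
    exact Finset.card_filter_eq_iff.1 h2 i (Finset.mem_univ i)
  · intro h
    rw [Finset.filter_true_of_mem fun i _ => h i]
    simp

/-- Given `pts q ≤ pts p`, the sum vanishes for equal vectors, which leaves the comparison of
indices. Otherwise it is at least `1`, and the factor `m > q` makes the inequality hold. Thus one
comparison encodes the disjunction. -/
theorem dominated_iff {pts : ℕ → Fin n →₀ ℕ} {m p q : ℕ} (hq : q < m) (hle : pts q ≤ pts p) :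
    (q : ℤ) + 1 ≤ p + m * ∑ i, ((pts p i : ℤ) - pts q i) ↔ q < p ∨ pts q ≠ pts p := by
  have h0 : ∀ i ∈ Finset.univ, 0 ≤ (pts p i : ℤ) - pts q i := fun i _ => by
    have := hle i
    omega
  have hsum := Finset.sum_eq_zero_iff_of_nonneg h0
  by_cases he : pts q = pts p
  · rw [he]; simp
  · have hne : ∑ i, ((pts p i : ℤ) - pts q i) ≠ 0 := by
      intro h
      refine he ?_
      ext i
      have := hsum.1 h i (Finset.mem_univ i)
      omega
    have hpos : 1 ≤ ∑ i, ((pts p i : ℤ) - pts q i) := by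
      have := Finset.sum_nonneg h0
      omega
    simp only [Ne, he, not_false_eq_true, or_true, iff_true]
    nlinarith

theorem keep_cond {pts : ℕ → Fin n →₀ ℕ} {m D p : ℕ} {s : Env} (hr : Ready pts m D s)
    (hA : ∀ p < m, Marked pts m (s.arr 4) p) (hp : p < m) (hs : s.reg .p = p) :
    (Expr.lit 1).eval s ≤ (Expr.get 4 (.var .p) * Expr.le dominators (.lit 0)).eval s ↔
      Kept pts m p := by
  classical
  have hterm : ∀ q < m, ∀ s' : Env, s' = s.set .q q →
      (Expr.get 4 (.var .q) *
        (Expr.le (.var .n) (.sum .c (.var .n) (.le (entry 2 .q .c) (entry 2 .p .c))) *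
        .le (.var .q + .lit 1)
        (.var .p + .var .cnt * .sum .c (.var .n) (entry 2 .p .c - entry 2 .q .c)))).eval s' =
      if Separable pts m q ∧ pts q ≤ pts p ∧ (q < p ∨ pts q ≠ pts p) then 1 else 0 := by
    rintro q hq s' rfl
    set s' := s.set .q q with hs'
    have hn' : s'.reg .n = n := by simp [hs', hr.reg_n]
    have ent : ∀ (i : Fin n) (x : Var) (v : ℕ), v < m → x ≠ .c → s'.reg x = v →
        (entry 2 x .c).eval (s'.set .c (i : ℕ)) = pts v i := by
      intro i x v hv hx hxv
      have := entry_eval (s := s'.set .c (i : ℕ)) (A := 2) (m := m) (p := v) (c := i) (x := x)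
        (y := .c) (pts := pts) (by simp [hn']) (by simp [hx, hxv]) (by simp) hr.rows hv i.2
      rw [this, coord_fin]
    have e1 : (Expr.sum .c (.var .n) (.le (entry 2 .q .c) (entry 2 .p .c))).eval s' =
        ∑ i, (if pts q i ≤ pts p i then 1 else 0 : ℤ) :=
      sum_eval_eq hn' fun i => by
        rw [Expr.eval_le, ent i .q q hq (by decide) (by simp [hs']),
          ent i .p p hp (by decide) (by simp [hs', hs])]
        simp
    have e2 : (Expr.sum .c (.var .n) (entry 2 .p .c - entry 2 .q .c)).eval s' =
        ∑ i, ((pts p i : ℤ) - pts q i) :=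
      sum_eval_eq hn' fun i => by
        rw [Expr.eval_sub, ent i .q q hq (by decide) (by simp [hs']),
          ent i .p p hp (by decide) (by simp [hs', hs])]
    rw [Expr.eval_mul, Expr.eval_mul, Expr.eval_le, Expr.eval_le, Expr.eval_add, Expr.eval_add,
      Expr.eval_mul, e1, e2]
    have e3 : (Expr.get 4 (.var .q)).eval s' = s.arr 4 q := by simp [hs']
    have e4 : (Expr.var .cnt).eval s' = m := by simp [hs', hr.cnt]
    have e5 : (Expr.var .p).eval s' = p := by simp [hs', hs]
    have e6 : (Expr.var .q).eval s' = q := by simp [hs']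
    rw [e3, e4, e5, e6, Expr.eval_var, hn', Expr.eval_lit]
    by_cases hle : pts q ≤ pts p
    · have h1 : ∀ i, pts q i ≤ pts p i := fun i => hle i
      rw [if_pos (sum_indicator_eq_iff.2 h1), one_mul]
      simp only [dominated_iff hq hle]
      rcases hA q hq with ⟨ha, hsep⟩ | ⟨ha, hsep⟩ <;> simp [ha, hsep, hle]
    · have h1 : ¬ ∀ i, pts q i ≤ pts p i := fun h => hle fun i => h i
      rw [if_neg fun h => h1 (sum_indicator_eq_iff.1 h)]
      simp [hle]
  have hdom : dominators.eval s = ∑ q ∈ Finset.range m,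
      (if Separable pts m q ∧ pts q ≤ pts p ∧ (q < p ∨ pts q ≠ pts p) then 1 else 0 : ℤ) := by
    rw [dominators, Expr.eval_sum, Expr.eval_var, hr.cnt, Int.toNat_natCast]
    exact Finset.sum_congr rfl fun q hq => hterm q (Finset.mem_range.1 hq) _ rfl
  have hdom' : dominators.eval s ≤ 0 ↔
      ∀ q < m, Separable pts m q → pts q ≤ pts p → ¬ (q < p ∨ pts q ≠ pts p) := by
    have h0 : ∀ q ∈ Finset.range m, (0 : ℤ) ≤
        (if Separable pts m q ∧ pts q ≤ pts p ∧ (q < p ∨ pts q ≠ pts p) then 1 else 0 : ℤ) :=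
      fun q _ => by split_ifs <;> norm_num
    rw [hdom, (Finset.sum_nonneg h0).ge_iff_eq', Finset.sum_eq_zero_iff_of_nonneg h0]
    simp only [Finset.mem_range, ite_eq_right_iff, one_ne_zero, imp_false, not_and]
  rw [Expr.eval_mul, Expr.eval_le, Expr.eval_lit, Expr.eval_lit, Kept, ← hdom']
  have e3 : (Expr.get 4 (.var .p)).eval s = s.arr 4 p := by simp [hs]
  rw [e3]
  by_cases hd : dominators.eval s ≤ 0
  · rcases hA p hp with ⟨ha, hsep⟩ | ⟨ha, hsep⟩ <;> simp [ha, hsep, hd]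
  · rcases hA p hp with ⟨ha, hsep⟩ | ⟨ha, hsep⟩ <;> simp [ha, hsep, hd]

open Classical in
/-- The vectors that are kept, among the first `j`. -/
noncomputable def keptList (pts : ℕ → Fin n →₀ ℕ) (m j : ℕ) : List (Fin n →₀ ℕ) :=
  ((List.range j).filter fun p => Kept pts m p).map pts

theorem keptList_succ_pos {pts : ℕ → Fin n →₀ ℕ} {m j : ℕ} (h : Kept pts m j) :
    keptList pts m (j + 1) = keptList pts m j ++ [pts j] := by
  simp [keptList, List.range_succ, h]

theorem keptList_succ_neg {pts : ℕ → Fin n →₀ ℕ} {m j : ℕ} (h : ¬ Kept pts m j) :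
    keptList pts m (j + 1) = keptList pts m j := by
  simp [keptList, List.range_succ, h]

theorem mem_keptList {pts : ℕ → Fin n →₀ ℕ} {m j : ℕ} {μ : Fin n →₀ ℕ} :
    μ ∈ keptList pts m j ↔ ∃ p < j, Kept pts m p ∧ pts p = μ := by
  simp [keptList, and_assoc]

/-- Of two equal kept vectors, the earlier one would dominate the later one. -/
theorem nodup_keptList (pts : ℕ → Fin n →₀ ℕ) (m : ℕ) : (keptList pts m m).Nodup := by
  classical
  refine List.Nodup.map_on ?_ (List.nodup_range.filter _)
  intro p hp q hq he
  simp only [List.mem_filter, List.mem_range, decide_eq_true_eq] at hp hq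
  by_contra hne
  rcases lt_or_gt_of_ne hne with h | h
  · exact hq.2.2 p hp.1 hp.2.1 he.le (Or.inl h)
  · exact hp.2.2 q hq.1 hq.2.1 he.ge (Or.inl h)

/-- The first rows of `A` are the vectors in `l`. -/
def HoldsList (A : ℕ → ℤ) (l : List (Fin n →₀ ℕ)) : Prop :=
  ∀ r < l.length, ∀ c < n, A (r * n + c) = coord (l.getD r 0) c

theorem emit_spec {pts : ℕ → Fin n →₀ ℕ} {m D p : ℕ} {s : Env} (hr : Ready pts m D s)
    (hp : p < m) (hs : s.reg .p = p) {l : List (Fin n →₀ ℕ)} (hl : s.reg .out = l.length)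
    (h0 : HoldsList (s.arr 0) l) :
    (emit.eval s).reg .out = (l ++ [pts p]).length ∧
      HoldsList ((emit.eval s).arr 0) (l ++ [pts p]) := by
  set c : Cmd := .loop .c (.var .n) (.store 0 (.var .out * .var .n + .var .c) (entry 2 .p .c))
  have key : Fill [.c] 0 (l.length * n) (l.length * n + n * 1)
      (fun z => coord (pts p) (z % n)) s (c.eval s) := by
    refine Fill.loop (by simp) (by simpa using hr.reg_n) ?_
    intro c hc s' hs' hc'
    rw [mul_one, mul_one, ← add_assoc]
    have hr' : Ready pts m D s' := hr.frame hs'.frame (by decide) (by decide) (by decide)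
      (by decide) (by decide) (by decide)
    refine Fill.store ?_ ?_
    · simp [hs'.frame.1 .out (by decide), hl, hr'.reg_n, hc']
    · rw [entry_eval (m := m) (p := p) (pts := pts) hr'.reg_n
        (by rw [hs'.frame.1 .p (by decide), hs]) hc' hr'.rows hp hc, row_mod hc]
  have e : emit.eval s = (c.eval s).set .out ((c.eval s).reg .out + 1) := rfl
  rw [e]
  refine ⟨by simp [key.frame.1 .out (by decide), hl], ?_⟩
  intro r hrl i hi
  rw [List.length_append, List.length_singleton] at hrl
  rw [Env.arr_set]
  rcases Nat.lt_succ_iff_lt_or_eq.1 hrl with h | h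
  · rw [key.out _ (Or.inl (row_lt h hi)), h0 r h i hi, List.getD_append _ _ _ _ h]
  · rw [h, key.mem _ (by omega) (by omega), row_mod hi, List.getD_append_right _ _ _ _ le_rfl]
    simp

/-- The output overwrites array `0` and, at the very end, register `n`. The list lengths stored in
the former are no longer needed, and the latter is register `0`, where the count is expected. -/
theorem emitAll_spec {pts : ℕ → Fin n →₀ ℕ} {m D : ℕ} {s : Env} (hr : Ready pts m D s)
    (hA : ∀ p < m, Marked pts m (s.arr 4) p) :
    (emitAll.eval s).reg .n = (keptList pts m m).length ∧
      HoldsList ((emitAll.eval s).arr 0) (keptList pts m m) := by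
  set c : Cmd := .ite (.lit 1) (.get 4 (.var .p) * .le dominators (.lit 0)) emit
      (.assign .out (.var .out)) with hc
  set s₀ := s.set .out 0 with hs₀
  have e : emitAll.eval s = ((Cmd.loop .p (.var .cnt) c).eval s₀).set .n
    (((Cmd.loop .p (.var .cnt) c).eval s₀).reg .out) := rfl
  have key : ((Cmd.loop .p (.var .cnt) c).eval s₀).reg .out = (keptList pts m m).length ∧
      HoldsList (((Cmd.loop .p (.var .cnt) c).eval s₀).arr 0) (keptList pts m m) := by
    refine Cmd.loop_induct (s := s₀) (N := m) (fun j s' => s'.reg .out = (keptList pts m j).length ∧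
      HoldsList (s'.arr 0) (keptList pts m j)) (by simp [hs₀, hr.cnt]) ?_ ?_
    · exact ⟨by simp [hs₀, keptList], fun r h => by simp [keptList] at h⟩
    · rintro p hp s' hF ⟨h1, h2⟩
      have hF' : Frame [.p, .c, .out] [0] s (s'.set .p p) :=
        (((Frame.refl _ _ s).set (by simp) 0).trans (hF.mono (by decide) (by decide))).set
          (by simp) _
      have hr' : Ready pts m D (s'.set .p p) := hr.frame hF' (by decide) (by decide) (by decide)
        (by decide) (by decide) (by decide)
      have hcond := keep_cond hr' (by rw [hF'.2 4 (by decide)]; exact hA) hp (by simp)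
      rw [hc, Cmd.eval_ite]
      by_cases hk : Kept pts m p
      · rw [if_pos (hcond.2 hk), keptList_succ_pos hk]
        exact emit_spec hr' hp (by simp) (by simpa using h1) h2
      · rw [if_neg fun h => hk (hcond.1 h), keptList_succ_neg hk]
        exact ⟨by simpa using h1, h2⟩
  rw [e]
  exact ⟨by simpa using key.1, key.2⟩

/-! ### The kept vectors are the minimal vertices -/

theorem separable_iff_mem_vertNP {pts : ℕ → Fin n →₀ ℕ} {m p : ℕ} {s : TPoly n}
    (hs : ∀ μ, (∃ q < m, pts q = μ) ↔ μ ∈ s.support) (hp : p < m) :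
    Separable pts m p ↔ pts p ∈ vertNP s := by
  rw [mem_vertNP_iff, and_iff_right ((hs _).1 ⟨p, hp, rfl⟩), Separable]
  refine exists_congr fun w => ⟨fun h ν hν hne => ?_, fun h q hq hne => ?_⟩
  · obtain ⟨q, hq, rfl⟩ := (hs ν).2 hν
    exact h q hq hne
  · exact h (pts q) ((hs _).1 ⟨q, hq, rfl⟩) hne

theorem mem_keptList_iff {pts : ℕ → Fin n →₀ ℕ} {m : ℕ} {s : TPoly n}
    (hs : ∀ μ, (∃ q < m, pts q = μ) ↔ μ ∈ s.support) (μ : Fin n →₀ ℕ) :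
    μ ∈ keptList pts m m ↔ μ ∈ vertNPmin s := by
  rw [mem_keptList]
  constructor
  · rintro ⟨p, hp, hk, rfl⟩
    refine ⟨(separable_iff_mem_vertNP hs hp).1 hk.1, fun ν hν hle => ?_⟩
    obtain ⟨q, hq, rfl⟩ := (hs ν).2 (vertNP_subset_support s hν)
    have h1 := hk.2 q hq ((separable_iff_mem_vertNP hs hq).2 hν) hle
    have h2 : pts q = pts p := by
      by_contra h
      exact h1 (Or.inr h)
    exact h2.ge
  · intro hμ
    have hex := (hs μ).2 (vertNP_subset_support s hμ.1)
    classical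
    -- The first occurrence of the vertex is the copy that survives.
    obtain ⟨hp, he⟩ := Nat.find_spec hex
    refine ⟨Nat.find hex, hp, ⟨(separable_iff_mem_vertNP hs hp).2 (by rw [he]; exact hμ.1), ?_⟩, he⟩
    intro q hq hsep hle hor
    have h1 : pts q = μ := by
      have hν := (separable_iff_mem_vertNP hs hq).1 hsep
      rw [he] at hle
      exact le_antisymm hle (hμ.2 hν hle)
    rcases hor with h | h
    · exact Nat.find_min hex h ⟨hq, h1⟩
    · exact h (h1.trans he.symm)

end TropVN

namespace TropVN

/-! ### Running times -/

theorem Expr.cost_sum_le {x : Var} {m f : Expr} {s : Env} {N B M : ℕ}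
    (hN : (m.eval s).toNat ≤ N) (hM : m.cost s ≤ M) (h : ∀ j : ℕ, f.cost (s.set x j) ≤ B) :
    (Expr.sum x m f).cost s ≤ N * (B + 6) + (M + 8) := by
  have h1 : ∀ j ∈ Finset.range (m.eval s).toNat, f.cost (s.set x j) + 5 + 1 ≤ B + 6 := by
    intro j _
    have := h j
    omega
  have h2 := Finset.sum_le_card_nsmul _ _ _ h1
  rw [Finset.card_range, smul_eq_mul] at h2
  have h3 : (m.eval s).toNat * (B + 6) ≤ N * (B + 6) := Nat.mul_le_mul_right _ hN
  rw [Expr.cost_sum]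
  omega

theorem findViol_cost_le {n m : ℕ} {s : Env} (hn : s.reg .n = n) (hm : s.reg .cnt = m) :
    findViol.cost s ≤ m * (n * 80 + 80) + 10 := by
  rw [findViol, Cmd.cost_seq, Cmd.cost_assign, Cmd.eval_assign, Expr.cost_lit]
  refine (Nat.add_le_add_left (Cmd.loop_cost_le (N := m) (M := 2) (B := n * 80 + 75)
    (by simp [hm]) (by simp) fun s' hs' => ?_) _).trans (by linarith)
  have hn' : s'.reg .n = n := by rw [hs'.1 .n (by decide)]; simp [hn]
  have h1 := Expr.cost_sum_le (x := .c) (m := .var .n) (f := delta .q .c * delta .q .c) (s := s')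
    (N := n) (B := 39) (M := 2) (by simp [hn']) (by simp) fun j => by simp [delta, entry]
  have h2 := Expr.cost_sum_le (x := .c) (m := .var .n) (f := delta .q .c * .get 5 (.var .c))
    (s := s') (N := n) (B := 25) (M := 2) (by simp [hn']) (by simp) fun j => by
      simp [delta, entry]
  rw [Cmd.cost_ite, Expr.cost_mul, Expr.cost_le, Expr.cost_le, Expr.cost_lit, Expr.cost_lit,
    Cmd.cost_assign, Cmd.cost_assign, Expr.cost_var, Expr.cost_var, ite_self]
  omega

theorem applyMatrix_cost_le {n : ℕ} {s : Env} (hn : s.reg .n = n) :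
    applyMatrix.cost s ≤ n * (n * 40 + 30) + 10 := by
  refine (Cmd.loop_cost_le (N := n) (M := 2) (B := n * 40 + 25) (by simp [hn]) (by simp)
    fun s' hs' => ?_).trans (by linarith)
  have hn' : s'.reg .n = n := by rw [hs'.1 .n (by decide), hn]
  have h1 := Expr.cost_sum_le (x := .e) (m := .var .n) (f := entry 6 .c .e * delta .viol .e)
    (s := s') (N := n) (B := 30) (M := 2) (by simp [hn']) (by simp) fun j => by
      simp [delta, entry]
  rw [Cmd.cost_store, Expr.cost_var]
  omega

theorem setScale_cost_le {K : ℕ} {s : Env} (hK : s.reg .doublings = K) :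
    setScale.cost s ≤ K * 50 + 10 := by
  rw [setScale, Cmd.cost_seq, Cmd.cost_assign, Cmd.eval_assign, Expr.cost_lit]
  refine (Nat.add_le_add_left (Cmd.loop_cost_le (N := K) (M := 2) (B := 40)
    (by simp [hK]) (by simp) fun s' _ => ?_) _).trans (by omega)
  simp only [Cmd.cost_ite, Cmd.cost_assign]
  split_ifs <;> simp

theorem setDen_cost_le {n K : ℕ} {s : Env} (hn : s.reg .n = n) (hK : s.reg .doublings = K) :
    setDen.cost s ≤ n * (n * 40 + 70) + K * 50 + 80 := by
  have h1 := applyMatrix_cost_le hn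
  have hn₁ : (applyMatrix.eval s).reg .n = n := by rw [applyMatrix.eval_reg (by decide), hn]
  have hK₁ : (applyMatrix.eval s).reg .doublings = K := by
    rw [applyMatrix.eval_reg (by decide), hK]
  have h2 := Expr.cost_sum_le (x := .c) (m := .var .n) (f := .get 7 (.var .c) * delta .viol .c)
    (s := applyMatrix.eval s) (N := n) (B := 30) (M := 2) (by simp [hn₁]) (by simp) fun j => by
      simp [delta, entry]
  have h3 := fun v => setScale_cost_le (K := K) (s := (applyMatrix.eval s).set .quad v)
    (by simp [hK₁])
  simp only [setDen, Cmd.cost_seq, Cmd.cost_assign, Cmd.eval_assign, Expr.cost_add,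
    Expr.cost_mul, Expr.cost_lit, Expr.cost_var]
  have h4 := h3 (Expr.eval (.sum .c (.var .n) (.get 7 (.var .c) * delta .viol .c))
    (applyMatrix.eval s))
  have h5 : n * (n * 40 + 70) = n * (n * 40 + 30) + n * 40 := by ring
  omega

theorem moveCentre_cost_le {n : ℕ} {s : Env} (hn : s.reg .n = n) :
    moveCentre.cost s ≤ n * 50 + 10 :=
  (Cmd.loop_cost_le (N := n) (M := 2) (B := 40) (by simp [hn]) (by simp) fun s' _ => by
    simp [Cmd.cost_store]).trans (by omega)

theorem shrinkMatrix_cost_le {n : ℕ} {s : Env} (hn : s.reg .n = n) :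
    shrinkMatrix.cost s ≤ n * (n * 80 + 20) + 10 :=
  (Cmd.loop_cost_le (N := n) (M := 2) (B := n * 80 + 10) (by simp [hn]) (by simp) fun s' hs' => by
    have hn' : s'.reg .n = n := by rw [hs'.1 .n (by decide), hn]
    exact (Cmd.loop_cost_le (N := n) (M := 2) (B := 75) (by simp [hn']) (by simp) fun s' _ => by
      simp [Cmd.cost_store, entry]).trans (by omega)).trans (by linarith)

theorem cut_cost_le {n K : ℕ} {s : Env} (hn : s.reg .n = n) (hK : s.reg .doublings = K) :
    cut.cost s ≤ n * (n * 120 + 150) + K * 50 + 150 := by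
  have h1 := setDen_cost_le hn hK
  have hn₁ : (setDen.eval s).reg .n = n := by rw [setDen.eval_reg (by decide), hn]
  have hn₂ : (moveCentre.eval (setDen.eval s)).reg .n = n := by
    rw [moveCentre.eval_reg (by decide), hn₁]
  have h2 := moveCentre_cost_le hn₁
  have h3 := shrinkMatrix_cost_le hn₂
  simp only [cut, Cmd.cost_seq, Cmd.cost_assign, Expr.cost_mul, Expr.cost_lit, Expr.cost_var]
  have h5 : n * (n * 120 + 150) = n * (n * 40 + 70) + n * 50 + n * (n * 80 + 20) + n * 10 := by
    ring
  omega

theorem ellipsoidStep_cost_le {n m K : ℕ} {s : Env} (hn : s.reg .n = n) (hm : s.reg .cnt = m)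
    (hK : s.reg .doublings = K) :
    ellipsoidStep.cost s ≤ 200 * (m * n + m + n * n + n + K + 1) := by
  have h1 := findViol_cost_le hn hm
  have h2 := cut_cost_le (s := findViol.eval s) (n := n) (K := K)
    (by rw [findViol.eval_reg (by decide), hn]) (by rw [findViol.eval_reg (by decide), hK])
  have h3 : ∀ P : Prop, ∀ _ : Decidable P, (if P then (Cmd.assign .found (.lit 1)).cost
      (findViol.eval s) else cut.cost (findViol.eval s)) ≤
        n * (n * 120 + 150) + K * 50 + 150 := by
    intro P _
    split_ifs
    · simp only [Cmd.cost_assign, Expr.cost_lit]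
      omega
    · exact h2
  have h4 := h3 ((Expr.var .viol + .lit 1).eval (findViol.eval s) ≤
    (Expr.lit 0).eval (findViol.eval s)) inferInstance
  simp only [ellipsoidStep, Cmd.cost_seq, Cmd.cost_ite]
  simp only [Expr.cost_add, Expr.cost_var, Expr.cost_lit]
  nlinarith

theorem unitBall_cost_le {n : ℕ} {s : Env} (hn : s.reg .n = n) :
    unitBall.cost s ≤ 50 * (n * n + n + 1) := by
  have h1 : ∀ s : Env, s.reg .n = n →
      (Cmd.loop .c (.var .n) (.store 5 (.var .c) (.lit 0))).cost s ≤ n * 10 + 4 := fun s hn =>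
    (Cmd.loop_cost_le (N := n) (M := 2) (B := 5) (by simp [hn]) (by simp) fun s' _ => by
      simp [Cmd.cost_store]).trans (by omega)
  have h2 : ∀ s : Env, s.reg .n = n → (Cmd.loop .c (.var .n) (.loop .e (.var .n)
      (.store 6 (.var .c * .var .n + .var .e)
        (.le (.var .c) (.var .e) * .le (.var .e) (.var .c))))).cost s ≤
          n * (n * 40 + 10) + 4 := fun s hn =>
    (Cmd.loop_cost_le (N := n) (M := 2) (B := n * 40 + 4) (by simp [hn]) (by simp)
      fun s' hs' => by
        have hn' : s'.reg .n = n := by rw [hs'.1 .n (by decide), hn]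
        exact (Cmd.loop_cost_le (N := n) (M := 2) (B := 35) (by simp [hn']) (by simp)
          fun s' _ => by simp [Cmd.cost_store]).trans (by omega)).trans (by linarith)
  set s₁ := ((s.set .found 0).set .gam 1).set .del 1 with hs₁
  have hn₁ : s₁.reg .n = n := by simp [hs₁, hn]
  have h3 := h1 s₁ hn₁
  have h4 := h2 ((Cmd.loop .c (.var .n) (.store 5 (.var .c) (.lit 0))).eval s₁)
    (by rw [Cmd.eval_reg _ (by decide), hn₁])
  simp only [unitBall, Cmd.cost_seq, Cmd.cost_assign, Cmd.eval_assign, Expr.cost_lit,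
    Expr.eval_lit]
  rw [← hs₁]
  nlinarith

theorem vertexTest_cost_le {n m K N : ℕ} {s : Env} (hn : s.reg .n = n) (hm : s.reg .cnt = m)
    (hK : s.reg .doublings = K) (hN : s.reg .iters = N) :
    vertexTest.cost s ≤ 210 * (N + 1) * (m * n + m + n * n + n + K + 1) := by
  have h1 := unitBall_cost_le hn
  have h2 := Cmd.loop_cost_le (x := .t) (m := .var .iters) (c := ellipsoidStep)
    (s := unitBall.eval s) (N := N) (M := 2) (B := 200 * (m * n + m + n * n + n + K + 1))
    (by simp [unitBall.eval_reg (x := .iters) (by decide), hN]) (by simp) fun s' hs' =>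
      ellipsoidStep_cost_le (by rw [hs'.1 .n (by decide), unitBall.eval_reg (by decide), hn])
        (by rw [hs'.1 .cnt (by decide), unitBall.eval_reg (by decide), hm])
        (by rw [hs'.1 .doublings (by decide), unitBall.eval_reg (by decide), hK])
  rw [vertexTest, Cmd.cost_seq]
  set W := m * n + m + n * n + n + K + 1 with hW
  have h3 : 1 ≤ W := by omega
  have h4 : N ≤ N * W := Nat.le_mul_of_pos_right _ h3
  have h5 : 50 * (n * n + n + 1) ≤ 50 * W := by
    have : 0 ≤ m * n := Nat.zero_le _
    omega
  nlinarith

theorem markVertices_cost_le {n m K N : ℕ} {s : Env} (hn : s.reg .n = n) (hm : s.reg .cnt = m)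
    (hK : s.reg .doublings = K) (hN : s.reg .iters = N) :
    markVertices.cost s ≤ m * (210 * (N + 1) * (m * n + m + n * n + n + K + 1) + 10) + 4 := by
  refine Cmd.loop_cost_le (N := m) (M := 2)
    (B := 210 * (N + 1) * (m * n + m + n * n + n + K + 1) + 5) (by simp [hm]) (by simp)
    fun s' hs' => ?_
  have := vertexTest_cost_le (s := s') (by rw [hs'.1 .n (by decide), hn])
    (by rw [hs'.1 .cnt (by decide), hm]) (by rw [hs'.1 .doublings (by decide), hK])
    (by rw [hs'.1 .iters (by decide), hN])
  simp only [Cmd.cost_seq, Cmd.cost_store, Expr.cost_var]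
  omega

theorem dominators_cost_le {n m : ℕ} {s : Env} (hn : s.reg .n = n) (hm : s.reg .cnt = m) :
    dominators.cost s ≤ m * (n * 60 + 60) + 10 := by
  refine (Expr.cost_sum_le (N := m) (M := 2) (B := n * 60 + 54) (by simp [hm]) (by simp)
    fun j => ?_).trans (by linarith)
  have h1 := Expr.cost_sum_le (x := .c) (m := .var .n) (f := .le (entry 2 .q .c) (entry 2 .p .c))
    (s := s.set .q j) (N := n) (B := 22) (M := 2) (by simp [hn]) (by simp) fun j => by
      simp [entry]
  have h2 := Expr.cost_sum_le (x := .c) (m := .var .n) (f := entry 2 .p .c - entry 2 .q .c)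
    (s := s.set .q j) (N := n) (B := 22) (M := 2) (by simp [hn]) (by simp) fun j => by
      simp [entry]
  rw [Expr.cost_mul, Expr.cost_mul, Expr.cost_le, Expr.cost_le, Expr.cost_add, Expr.cost_add,
    Expr.cost_mul, Expr.cost_get]
  simp only [Expr.cost_var, Expr.cost_lit]
  omega

theorem emit_cost_le {n : ℕ} {s : Env} (hn : s.reg .n = n) : emit.cost s ≤ n * 40 + 20 := by
  have h1 := Cmd.loop_cost_le (x := .c) (m := .var .n) (s := s)
    (c := .store 0 (.var .out * .var .n + .var .c) (entry 2 .p .c))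
    (N := n) (M := 2) (B := 35) (by simp [hn]) (by simp) fun s' _ => by
      simp [Cmd.cost_store, entry]
  simp only [emit, Cmd.cost_seq, Cmd.cost_assign, Expr.cost_add, Expr.cost_var, Expr.cost_lit]
  omega

theorem emitAll_cost_le {n m : ℕ} {s : Env} (hn : s.reg .n = n) (hm : s.reg .cnt = m) :
    emitAll.cost s ≤ m * (m * (n * 60 + 60) + n * 40 + 70) + 20 := by
  set c : Cmd := .ite (.lit 1) (.get 4 (.var .p) * .le dominators (.lit 0)) emit
      (.assign .out (.var .out)) with hc
  have h1 := Cmd.loop_cost_le (x := .p) (m := .var .cnt) (c := c) (s := s.set .out 0)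
    (N := m) (M := 2) (B := m * (n * 60 + 60) + n * 40 + 60) (by simp [hm]) (by simp) ?_
  · simp only [emitAll, Cmd.cost_seq, Cmd.cost_assign, Cmd.eval_assign, Expr.cost_lit,
      Expr.eval_lit, Expr.cost_var]
    rw [← hc]
    have : m * (m * (n * 60 + 60) + n * 40 + 60 + 5) ≤
      m * (m * (n * 60 + 60) + n * 40 + 70) := Nat.mul_le_mul_left _ (by omega)
    omega
  intro s' hs'
  have hn' : s'.reg .n = n := by rw [hs'.1 .n (by decide)]; simp [hn]
  have hm' : s'.reg .cnt = m := by rw [hs'.1 .cnt (by decide)]; simp [hm]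
  have h2 := emit_cost_le hn'
  have h3 := dominators_cost_le hn' hm'
  have h4 : ∀ P : Prop, ∀ _ : Decidable P, (if P then emit.cost s' else
      (Cmd.assign .out (.var .out)).cost s') ≤ n * 40 + 20 := by
    intro P _
    split_ifs
    · exact h2
    · simp only [Cmd.cost_assign, Expr.cost_var]
      omega
  have h5 := h4 ((Expr.lit 1).eval s' ≤
    (Expr.get 4 (.var .p) * .le dominators (.lit 0)).eval s') inferInstance
  rw [hc, Cmd.cost_ite, Expr.cost_mul, Expr.cost_le]
  simp only [Expr.cost_lit, Expr.cost_get, Expr.cost_var]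
  omega

/-- At most `U` vectors are tested, each by `N` iterations. Searching for a violated inequality
costs order `U * n` per iteration and gives the first term; a cut costs order `n ^ 2` plus the
doublings, hence order `N`, and gives the second. The remaining phases fit into these two terms. -/
theorem mainCmd_cost_le {n : ℕ} (hn : 1 ≤ n) {L : ℕ → List (Fin n →₀ ℕ)} {k U D : ℕ} {s : Env}
    (h : HoldsInput L k s) (hoff : s.reg .off = 0) (h2 : ∀ z, s.arr 2 z = 0)
    (hU : ∀ i ≤ k, sumCount L i ≤ U)
    (hr : Ready (sumPts L k) (sumCount L k) D (params.eval (sumset.eval s)))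
    (hD : (setBound.eval (sumset.eval s)).reg .bound = D) :
    mainCmd.cost s ≤ 20000 * (U ^ 2 * n * iterCount n D + (k + 1) * U * iterCount n D ^ 2) := by
  set N := iterCount n D with hN
  have hS := sumset_spec h hoff h2
  have c1 := sumset_cost_le h hoff h2 hU
  have c2 := params_cost_le hS.input.reg_n hS.cnt hD
  have c3 := markVertices_cost_le hr.reg_n hr.cnt hr.doublings hr.iters
  set s₃ := markVertices.eval (params.eval (sumset.eval s)) with hs₃
  have hr₃ : Ready (sumPts L k) (sumCount L k) D s₃ := hr.frame (markVertices.frame _)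
    (by decide) (by decide) (by decide) (by decide) (by decide) (by decide)
  have c4 := emitAll_cost_le hr₃.reg_n hr₃.cnt
  have hm : sumCount L k ≤ U := hU k le_rfl
  have hU1 : 1 ≤ U := by simpa [sumCount] using hU 0 (Nat.zero_le _)
  set m := sumCount L k with hm_def
  -- All auxiliary quantities are dominated by the number of iterations, so only `U`, `n`, `k` and
  -- `N` survive in the estimate.
  have hR : n + D + radiusExp n D + n * n + 1 ≤ N := by
    rw [hN, iterCount, radiusExp]
    nlinarith [Nat.zero_le D, Nat.zero_le (n * D), Nat.zero_le (n * n * D),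
      Nat.zero_le (n * n * n * D), Nat.mul_le_mul hn hn, Nat.zero_le (n * n * n)]
  have hK : doublingCount n D ≤ 2 * N := by
    rw [doublingCount, ← hN]
    omega
  have hcost : mainCmd.cost s = sumset.cost s + (params.cost (sumset.eval s) +
      (markVertices.cost (params.eval (sumset.eval s)) + emitAll.cost s₃)) := by
    simp only [mainCmd, Cmd.cost_seq, hs₃]
  have hN1 : 1 ≤ N := by omega
  have hnN : n ≤ N := by omega
  set R := radiusExp n D
  set K := doublingCount n D
  set X := U ^ 2 * n * N with hX
  set Y := (k + 1) * U * N ^ 2 with hY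
  have a1 : m * n ≤ U * n := Nat.mul_le_mul_right _ hm
  have a2 : U ≤ U * n := Nat.le_mul_of_pos_right _ hn
  have a3 : m * n + m + n * n + n + K + 1 ≤ 2 * (U * n) + 4 * N := by omega
  have b1 : 200 * (U * n + U + 1) + 5 ≤ 605 * (U * N) := by
    have : U * n ≤ U * N := Nat.mul_le_mul_left _ hnN
    have : 1 ≤ U * N := Nat.mul_pos hU1 hN1
    omega
  have b2 : (k + 1) * (U * N) ≤ Y := by
    rw [hY, pow_two, ← mul_assoc, ← mul_assoc]
    exact Nat.le_mul_of_pos_right _ hN1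
  have b0 : U * N ≤ (k + 1) * (U * N) := Nat.le_mul_of_pos_left _ (by omega)
  have e1 : sumset.cost s ≤ 612 * Y := by
    have h3 : k * (200 * (U * n + U + 1) + 5) ≤ k * (605 * (U * N)) := Nat.mul_le_mul_left _ b1
    have h4 : 1 ≤ U * N := Nat.mul_pos hU1 hN1
    nlinarith
  have b3 : U * n ≤ U * N := Nat.mul_le_mul_left _ hnN
  have b4 : N ≤ U * N := Nat.le_mul_of_pos_left _ hU1
  have e2 : params.cost (sumset.eval s) ≤ 400 * Y := by omega
  have e3 : markVertices.cost (params.eval (sumset.eval s)) ≤ 850 * X + 1700 * Y := by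
    have h3 : 210 * (N + 1) * (m * n + m + n * n + n + K + 1) ≤
        210 * (2 * N) * (2 * (U * n) + 4 * N) := Nat.mul_le_mul (by omega) a3
    have h4 : m * (210 * (N + 1) * (m * n + m + n * n + n + K + 1) + 10) ≤
        U * (210 * (2 * N) * (2 * (U * n) + 4 * N) + 10) := Nat.mul_le_mul hm (by omega)
    have h5 : U * (210 * (2 * N) * (2 * (U * n) + 4 * N) + 10) =
        840 * X + 1680 * (U * N * N) + 10 * U := by rw [hX]; ring
    have h6 : U * N * N ≤ Y := by
      rw [hY, pow_two, ← mul_assoc, mul_assoc (k + 1), mul_assoc (k + 1)]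
      exact Nat.le_mul_of_pos_left _ (by omega)
    have h7 : U ≤ U * N := Nat.le_mul_of_pos_right _ hN1
    have h8 : U * N ≤ Y := b0.trans b2
    have h9 := c3.trans (Nat.add_le_add_right (h4.trans h5.le) 4)
    omega
  have e4 : emitAll.cost s₃ ≤ 300 * X := by
    have h3 : m * (m * (n * 60 + 60) + n * 40 + 70) ≤ U * (U * (n * 60 + 60) + n * 40 + 70) :=
      Nat.mul_le_mul hm (by have := Nat.mul_le_mul_right (n * 60 + 60) hm; omega)
    have h4 : U * U * n ≤ X := by
      rw [hX, pow_two]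
      exact Nat.le_mul_of_pos_right _ hN1
    have h5 : U * (U * (n * 60 + 60) + n * 40 + 70) =
      60 * (U * U * n) + 60 * (U * U) + 40 * (U * n) + 70 * U := by ring
    have h6 : U * U ≤ U * U * n := Nat.le_mul_of_pos_right _ hn
    have h7 : U ≤ U * U := Nat.le_mul_of_pos_right _ hU1
    have h8 : U * n ≤ U * U * n := Nat.mul_le_mul_right _ h7
    omega
  rw [hcost]
  omega

end TropVN

namespace TropVN

/-! ### The running time in terms of the degree -/

/-- A polynomial times a convergent geometric sequence tends to zero and is therefore bounded. The
index is shifted by one, and the factor `a / b` in the constant compensates for this. -/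
theorem exists_pow_mul_pow_le (e : ℕ) {a b : ℕ} (hb : 1 ≤ b) (hab : b < a) :
    ∃ C : ℕ, ∀ p : ℕ, (p + 1) ^ e * b ^ p ≤ C * a ^ p := by
  have ha : (0 : ℝ) < a := by exact_mod_cast (show 0 < a by omega)
  have hb' : (0 : ℝ) < b := by exact_mod_cast hb
  have hr : |(b : ℝ) / a| < 1 := by
    rw [abs_of_pos (by positivity), div_lt_one ha]
    exact_mod_cast hab
  obtain ⟨B, hB⟩ := (tendsto_pow_const_mul_const_pow_of_abs_lt_one e hr).bddAbove_range
  obtain ⟨C, hC⟩ := exists_nat_ge (B * (a / b))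
  refine ⟨C, fun p => ?_⟩
  have h1 : ((p + 1 : ℕ) : ℝ) ^ e * ((b : ℝ) / a) ^ (p + 1) ≤ B := hB ⟨p + 1, rfl⟩
  have h2 : ((p + 1 : ℕ) : ℝ) ^ e * ((b : ℝ) / a) ^ p ≤ C := by
    refine le_trans ?_ hC
    have : ((p + 1 : ℕ) : ℝ) ^ e * ((b : ℝ) / a) ^ p =
        ((p + 1 : ℕ) : ℝ) ^ e * ((b : ℝ) / a) ^ (p + 1) * (a / b) := by
      rw [pow_succ]
      field_simp
    rw [this]
    exact mul_le_mul_of_nonneg_right h1 (by positivity)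
  rw [div_pow, ← mul_div_assoc, div_le_iff₀ (by positivity)] at h2
  exact_mod_cast h2

theorem iterCount_le {n D : ℕ} (hn : 1 ≤ n) : iterCount n D ≤ 608 * n ^ 3 * (n + D) := by
  rw [iterCount, radiusExp]
  have h1 : (n + 2) * (n + D + 2) ≤ 3 * n * (3 * (n + D)) :=
    Nat.mul_le_mul (by omega) (by omega)
  have h2 : 1 ≤ n * n * (n + D) := Nat.mul_pos (Nat.mul_pos hn hn) (by omega)
  calc 32 * n * (2 * n * ((n + 2) * (n + D + 2)) + 1)
      ≤ 32 * n * (2 * n * (3 * n * (3 * (n + D))) + n * n * (n + D)) := by gcongr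
    _ = 608 * n ^ 3 * (n + D) := by ring

/-- With `p = n - 1`, the estimate `d + 1 ≤ d ^ 2` gives `U ^ 2 ≤ d ^ (4 * p * k)`. Even with the
factor `2` in place of `max 2 n`, the target exponent exceeds this by `2 * k`. -/
theorem exists_time_le_of_le : ∃ C : ℕ, ∀ p k d D U : ℕ, p + 1 ≤ k → 2 ≤ k → 2 ≤ d →
    D ≤ k * d → U ≤ (d + 1) ^ (p * k) →
    U ^ 2 * (p + 1) * iterCount (p + 1) D + (k + 1) * U * iterCount (p + 1) D ^ 2 ≤
      C * ((p + 1) * d ^ (k * (2 * (p + 1) - 1) * max 2 (p + 1))) := by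
  obtain ⟨C, hC⟩ := exists_pow_mul_pow_le 9 (a := 4) (b := 1) le_rfl (by norm_num)
  refine ⟨(1216 + 1216 ^ 2) * (4 * C), fun p k d D U hp hk hd hD hU => ?_⟩
  set N := iterCount (p + 1) D
  have hN : N ≤ 1216 * k ^ 4 * d := by
    have h1 : k ≤ k * d := Nat.le_mul_of_pos_right _ (by omega)
    calc N ≤ 608 * (p + 1) ^ 3 * (p + 1 + D) := iterCount_le (by omega)
      _ ≤ 608 * k ^ 3 * (2 * (k * d)) :=
        Nat.mul_le_mul (Nat.mul_le_mul_left _ (Nat.pow_le_pow_left hp 3)) (by omega)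
      _ = 1216 * k ^ 4 * d := by ring
  have hU1 : U ≤ d ^ (2 * (p * k)) := hU.trans <| by
    rw [pow_mul d 2]
    exact Nat.pow_le_pow_left (by nlinarith) _
  have hU2 : U ^ 2 ≤ d ^ (4 * (p * k)) := by
    calc U ^ 2 ≤ (d ^ (2 * (p * k))) ^ 2 := Nat.pow_le_pow_left hU1 2
      _ = d ^ (4 * (p * k)) := by rw [← pow_mul]; congr 1; ring
  have hU3 : U ≤ d ^ (4 * (p * k)) := hU1.trans (Nat.pow_le_pow_right (by omega) (by omega))
  -- The spare power of `d` absorbs the polynomial in `k`. The exponent `9` comes from `(k + 1) * (k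
  -- ^ 4) ^ 2`; two factors `d` are set aside first because `N ^ 2` contributes `d ^ 2`.
  have key : (k + 1) ^ 9 * d ^ 2 ≤ 4 * C * d ^ (2 * k) := by
    obtain ⟨j, rfl⟩ : ∃ j, k = j + 1 := ⟨k - 1, by omega⟩
    have h1 := hC (j + 1)
    rw [one_pow, mul_one] at h1
    have h2 : 4 ^ j ≤ d ^ (2 * j) := by
      rw [pow_mul]
      exact Nat.pow_le_pow_left (by nlinarith) _
    calc (j + 1 + 1) ^ 9 * d ^ 2 ≤ C * 4 ^ (j + 1) * d ^ 2 := Nat.mul_le_mul_right _ h1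
      _ = 4 * C * 4 ^ j * d ^ 2 := by ring
      _ ≤ 4 * C * d ^ (2 * j) * d ^ 2 := by gcongr
      _ = 4 * C * d ^ (2 * (j + 1)) := by ring
  have hk9 : k ^ 4 * d ≤ (k + 1) ^ 9 * d ^ 2 := by
    refine Nat.mul_le_mul ?_ (by nlinarith)
    exact (Nat.pow_le_pow_left (by omega) 4).trans (Nat.pow_le_pow_right (by omega) (by omega))
  have hk9' : (k + 1) * (k ^ 4 * d) ^ 2 ≤ (k + 1) ^ 9 * d ^ 2 := by
    calc (k + 1) * (k ^ 4 * d) ^ 2 = (k + 1) * k ^ 8 * d ^ 2 := by ring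
      _ ≤ (k + 1) * (k + 1) ^ 8 * d ^ 2 := by gcongr; omega
      _ = (k + 1) ^ 9 * d ^ 2 := by ring
  have hE : 4 * (p * k) + 2 * k ≤ k * (2 * (p + 1) - 1) * max 2 (p + 1) := by
    have h1 : 2 * (p + 1) - 1 = 2 * p + 1 := by omega
    rw [h1]
    calc 4 * (p * k) + 2 * k = k * (2 * p + 1) * 2 := by ring
      _ ≤ _ := Nat.mul_le_mul_left _ (le_max_left _ _)
  have hd : d ^ (4 * (p * k)) * d ^ (2 * k) ≤ d ^ (k * (2 * (p + 1) - 1) * max 2 (p + 1)) := by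
    rw [← pow_add]
    exact Nat.pow_le_pow_right (by omega) hE
  set E := d ^ (k * (2 * (p + 1) - 1) * max 2 (p + 1))
  set A := d ^ (4 * (p * k))
  set B := d ^ (2 * k)
  have t1 : U ^ 2 * (p + 1) * N ≤ 1216 * (4 * C) * ((p + 1) * E) := by
    calc U ^ 2 * (p + 1) * N ≤ A * (p + 1) * (1216 * k ^ 4 * d) := by gcongr
      _ = 1216 * (p + 1) * A * (k ^ 4 * d) := by ring
      _ ≤ 1216 * (p + 1) * A * (4 * C * B) := Nat.mul_le_mul_left _ (hk9.trans key)
      _ = 1216 * (4 * C) * ((p + 1) * (A * B)) := by ring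
      _ ≤ _ := by gcongr
  have t2 : (k + 1) * U * N ^ 2 ≤ 1216 ^ 2 * (4 * C) * ((p + 1) * E) := by
    calc (k + 1) * U * N ^ 2 ≤ (k + 1) * A * (1216 * k ^ 4 * d) ^ 2 := by gcongr
      _ = 1216 ^ 2 * A * ((k + 1) * (k ^ 4 * d) ^ 2) := by ring
      _ ≤ 1216 ^ 2 * A * (4 * C * B) := Nat.mul_le_mul_left _ (hk9'.trans key)
      _ = 1216 ^ 2 * (4 * C) * (A * B) := by ring
      _ ≤ 1216 ^ 2 * (4 * C) * E := by gcongr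
      _ ≤ _ := Nat.mul_le_mul_left _ (Nat.le_mul_of_pos_left _ (by omega))
  calc _ ≤ _ := Nat.add_le_add t1 t2
    _ = _ := by ring

/-- Once the base of the `k`-th power is below `1`, this power is at most the base itself, whose
exponential decay in `p` beats the polynomial. -/
theorem exists_pow_mul_le_of_gt : ∃ C : ℕ, ∀ p k : ℕ, 2 ≤ k → k ≤ p →
    ((p : ℝ) + 1) ^ 5 * (128 * (4 / 9) ^ p) ^ k ≤ C ∧ ((p : ℝ) + 1) ^ 8 * (8 * (1 / 3) ^ p) ^ k ≤ C := by
  obtain ⟨C₁, hC₁⟩ := exists_pow_mul_pow_le 5 (a := 9) (b := 4) (by norm_num) (by norm_num)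
  obtain ⟨C₂, hC₂⟩ := exists_pow_mul_pow_le 8 (a := 3) (b := 1) (by norm_num) (by norm_num)
  refine ⟨6 ^ 5 * 128 ^ 5 + 128 * C₁ + 8 * C₂, fun p k hk hkp => ⟨?_, ?_⟩⟩
  · push_cast
    have hq : (0 : ℝ) ≤ 128 * (4 / 9) ^ p := by positivity
    -- `6` is the first exponent with `128 * (4 / 9) ^ p < 1`. Below it `k ≤ p ≤ 5`, so everything
    -- is bounded by constants.
    rcases Nat.lt_or_ge p 6 with h | h
    · have h1 : ((4 : ℝ) / 9) ^ p ≤ 1 := pow_le_one₀ (by norm_num) (by norm_num)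
      have h2 : (p : ℝ) + 1 ≤ 6 := by
        have : (p : ℝ) ≤ 5 := by exact_mod_cast (show p ≤ 5 by omega)
        linarith
      have h3 : (128 * (4 / 9 : ℝ) ^ p) ^ k ≤ 128 ^ 5 :=
        (pow_le_pow_left₀ hq (by linarith) k).trans
          (pow_le_pow_right₀ (by norm_num) (by omega))
      have h4 : ((p : ℝ) + 1) ^ 5 ≤ 6 ^ 5 := pow_le_pow_left₀ (by positivity) h2 5
      have := mul_le_mul h4 h3 (by positivity) (by positivity)
      have h5 : (0 : ℝ) ≤ C₁ := Nat.cast_nonneg _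
      have h6 : (0 : ℝ) ≤ C₂ := Nat.cast_nonneg _
      linarith
    · have h1 : ((4 : ℝ) / 9) ^ p ≤ (4 / 9) ^ 6 :=
        pow_le_pow_of_le_one (by norm_num) (by norm_num) h
      have h2 : (128 * (4 / 9 : ℝ) ^ p) ^ k ≤ 128 * (4 / 9) ^ p :=
        pow_le_of_le_one hq (by norm_num at h1 ⊢; linarith) (by omega)
      have h3 : ((p : ℝ) + 1) ^ 5 * 4 ^ p ≤ C₁ * 9 ^ p := by exact_mod_cast hC₁ p
      have h4 : ((p : ℝ) + 1) ^ 5 * (4 / 9) ^ p ≤ C₁ := by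
        rw [div_pow, ← mul_div_assoc, div_le_iff₀ (by positivity)]
        exact h3
      have h5 := mul_le_mul_of_nonneg_left h2 (show (0 : ℝ) ≤ ((p : ℝ) + 1) ^ 5 by positivity)
      have h6 : (0 : ℝ) ≤ C₂ := Nat.cast_nonneg _
      linarith
  · push_cast
    have hq : (0 : ℝ) ≤ 8 * (1 / 3) ^ p := by positivity
    have h1 : ((1 : ℝ) / 3) ^ p ≤ (1 / 3) ^ 2 :=
      pow_le_pow_of_le_one (by norm_num) (by norm_num) (by omega)
    have h2 : (8 * (1 / 3 : ℝ) ^ p) ^ k ≤ 8 * (1 / 3) ^ p :=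
      pow_le_of_le_one hq (by norm_num at h1 ⊢; linarith) (by omega)
    have h3 : ((p : ℝ) + 1) ^ 8 * 1 ^ p ≤ C₂ * 3 ^ p := by exact_mod_cast hC₂ p
    have h4 : ((p : ℝ) + 1) ^ 8 * (1 / 3) ^ p ≤ C₂ := by
      rw [div_pow, ← mul_div_assoc, div_le_iff₀ (by positivity)]
      exact h3
    have h5 := mul_le_mul_of_nonneg_left h2 (show (0 : ℝ) ≤ ((p : ℝ) + 1) ^ 8 by positivity)
    have h6 : (0 : ℝ) ≤ C₁ := Nat.cast_nonneg _
    linarith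

/-- Here `d ^ (2 * p * k)` of the target is used up by `U ^ 2` and only `d ^ k` is spare. It pays
for the factor `d` from `N`, and the polynomials in `p` are paid for by the factor `(4 / 9) ^ (p *
k)` contained in `U ^ 2`. -/
theorem exists_time_le_of_lt : ∃ C : ℕ, ∀ p k d D U : ℕ, k < p + 1 → 2 ≤ k → 2 ≤ d →
    D ≤ k * d → (U : ℝ) ≤ (16 * (2 * d / 3) ^ p) ^ k →
    U ^ 2 * (p + 1) * iterCount (p + 1) D + (k + 1) * U * iterCount (p + 1) D ^ 2 ≤
      C * ((1 + k) * d ^ (k * (2 * (p + 1) - 1))) := by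
  obtain ⟨C, hC⟩ := exists_pow_mul_le_of_gt
  refine ⟨(2 * 1216 + 4 * 1216 ^ 2) * C, fun p k d D U hp hk hd hD hU => ?_⟩
  obtain ⟨hC₁, hC₂⟩ := hC p k hk (by omega)
  set N := iterCount (p + 1) D
  have hN : N ≤ 1216 * (p + 1) ^ 4 * d := by
    have h1 : p + 1 ≤ (p + 1) * d := Nat.le_mul_of_pos_right _ (by omega)
    have h2 : k * d ≤ (p + 1) * d := Nat.mul_le_mul_right _ hp.le
    calc N ≤ 608 * (p + 1) ^ 3 * (p + 1 + D) := iterCount_le (by omega)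
      _ ≤ 608 * (p + 1) ^ 3 * (2 * ((p + 1) * d)) := Nat.mul_le_mul_left _ (by omega)
      _ = 1216 * (p + 1) ^ 4 * d := by ring
  have hN' : (N : ℝ) ≤ 1216 * ((p : ℝ) + 1) ^ 4 * d := by exact_mod_cast hN
  have hd2 : (2 : ℝ) ≤ d := by exact_mod_cast hd
  have hd0 : (0 : ℝ) < d := by linarith
  have hE : k * (2 * (p + 1) - 1) = 2 * (p * k) + k := by
    have h1 : 2 * (p + 1) - 1 = 2 * p + 1 := by omega
    rw [h1]; ring
  obtain ⟨j, rfl⟩ : ∃ j, k = j + 2 := ⟨k - 2, by omega⟩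
  set k := j + 2
  have g1 : (2 : ℝ) ^ k * d ≤ 2 * d ^ k := by
    have h1 : (2 : ℝ) ^ (j + 1) ≤ d ^ (j + 1) := pow_le_pow_left₀ (by norm_num) hd2 _
    calc (2 : ℝ) ^ k * d = 2 * d * 2 ^ (j + 1) := by ring
      _ ≤ 2 * d * d ^ (j + 1) := by gcongr
      _ = 2 * d ^ k := by ring
  have g2 : (2 : ℝ) ^ (p * k + k) * d ^ 2 ≤ 4 * d ^ (p * k + k) := by
    have h1 : (2 : ℝ) ^ (p * k + j) ≤ d ^ (p * k + j) := pow_le_pow_left₀ (by norm_num) hd2 _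
    calc (2 : ℝ) ^ (p * k + k) * (d : ℝ) ^ 2 = 4 * (d : ℝ) ^ 2 * 2 ^ (p * k + j) := by
          rw [show p * k + k = p * k + j + 2 from rfl, pow_add]; ring
      _ ≤ 4 * (d : ℝ) ^ 2 * (d : ℝ) ^ (p * k + j) := by gcongr
      _ = 4 * (d : ℝ) ^ (p * k + k) := by rw [show p * k + k = p * k + j + 2 from rfl, pow_add]; ring
  have t1 : (U : ℝ) ^ 2 * (p + 1) * N ≤ 2 * 1216 * C * d ^ (2 * (p * k) + k) := by
    calc (U : ℝ) ^ 2 * (p + 1) * N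
        ≤ ((16 * (2 * d / 3) ^ p) ^ k) ^ 2 * (p + 1) * (1216 * ((p : ℝ) + 1) ^ 4 * d) := by gcongr
      _ = 1216 * (((p : ℝ) + 1) ^ 5 * (128 * (4 / 9) ^ p) ^ k) * (2 ^ k * d) *
          d ^ (2 * (p * k)) := by
        -- Here `16 ^ 2 = 128 * 2`: the factor `2 ^ k` is kept apart because `2 ^ k * d ≤ 2 * d ^ k`
        -- pays for it together with `d`.
        have e1 : ((16 * (2 * (d : ℝ) / 3) ^ p) ^ k) ^ 2 =
            (128 * (4 / 9) ^ p) ^ k * 2 ^ k * d ^ (2 * (p * k)) := by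
          rw [← pow_mul, mul_comm k 2, pow_mul, ← mul_pow,
            show 2 * (p * k) = (2 * p) * k by ring, pow_mul (d : ℝ), ← mul_pow]
          congr 1
          rw [mul_pow, ← pow_mul, mul_comm p 2, pow_mul, pow_mul,
            show (2 * (d : ℝ) / 3) ^ 2 = 4 / 9 * d ^ 2 by ring, mul_pow]
          ring
        rw [e1]; ring
      _ ≤ 1216 * C * (2 * d ^ k) * d ^ (2 * (p * k)) := by gcongr
      _ = _ := by rw [pow_add]; ring
  have t2 : ((k : ℝ) + 1) * U * N ^ 2 ≤
      4 * 1216 ^ 2 * C * (((k : ℝ) + 1) * d ^ (2 * (p * k) + k)) := by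
    calc ((k : ℝ) + 1) * U * N ^ 2
        ≤ ((k : ℝ) + 1) * (16 * (2 * d / 3) ^ p) ^ k * (1216 * ((p : ℝ) + 1) ^ 4 * d) ^ 2 := by
          gcongr
      _ = 1216 ^ 2 * ((k : ℝ) + 1) * (((p : ℝ) + 1) ^ 8 * (8 * (1 / 3) ^ p) ^ k) *
          (2 ^ (p * k + k) * d ^ 2) * d ^ (p * k) := by
        -- The term is only linear in `U`, so `d ^ (p * k)` is also spare. The powers of `2` from
        -- `16 = 8 * 2` and `(2 / 3) ^ p` can be charged to it, which leaves the faster decay `(1 /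
        -- 3) ^ p`.
        have e1 : (16 * (2 * (d : ℝ) / 3) ^ p) ^ k =
            (8 * (1 / 3) ^ p) ^ k * 2 ^ (p * k + k) * d ^ (p * k) := by
          rw [show p * k + k = (p + 1) * k by ring, pow_mul, pow_mul, ← mul_pow, ← mul_pow]
          congr 1
          rw [show (2 * (d : ℝ) / 3) = 1 / 3 * 2 * d by ring, mul_pow, mul_pow]
          ring
        rw [e1]; ring
      _ ≤ 1216 ^ 2 * ((k : ℝ) + 1) * C * (4 * d ^ (p * k + k)) * d ^ (p * k) := by gcongr
      _ = _ := by rw [show 2 * (p * k) + k = p * k + k + p * k by ring, pow_add]; ring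
  have hC0 : (0 : ℝ) ≤ C := Nat.cast_nonneg _
  have t3 : (2 : ℝ) * 1216 * C * d ^ (2 * (p * k) + k) ≤
      2 * 1216 * C * (((k : ℝ) + 1) * d ^ (2 * (p * k) + k)) := by
    have hk0 : (0 : ℝ) ≤ k := Nat.cast_nonneg _
    have : (d : ℝ) ^ (2 * (p * k) + k) ≤ ((k : ℝ) + 1) * d ^ (2 * (p * k) + k) :=
      le_mul_of_one_le_left (by positivity) (by linarith)
    gcongr
  rw [hE]
  have : ((U ^ 2 * (p + 1) * N + (k + 1) * U * N ^ 2 : ℕ) : ℝ) ≤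
      (((2 * 1216 + 4 * 1216 ^ 2) * C * ((1 + k) * d ^ (2 * (p * k) + k)) : ℕ) : ℝ) := by
    push_cast
    have e : (2 * 1216 + 4 * 1216 ^ 2) * (C : ℝ) * ((1 + (k : ℝ)) * d ^ (2 * (p * k) + k)) =
        2 * 1216 * C * (((k : ℝ) + 1) * d ^ (2 * (p * k) + k)) +
          4 * 1216 ^ 2 * C * (((k : ℝ) + 1) * d ^ (2 * (p * k) + k)) := by ring
    linarith
  exact_mod_cast this

end TropVN

namespace TropVN

/-! ### Executions are unique, and expected times -/

/-- Every halting execution thus agrees with the one constructed, so that the output is correct for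
any run and not just for a particular one. -/
theorem Exec.unique {ω : ℕ → Bool} {p : Prog} {σ τ τ' : State} {t t' : ℕ}
    (h : Exec ω p σ τ t) (h' : Exec ω p σ τ' t') : τ = τ' ∧ t = t' := by
  induction h generalizing τ' t' with
  | skip | const | arith | load | store | flip => cases h'; exact ⟨rfl, rfl⟩
  | seq _ _ ih₁ ih₂ =>
    cases h' with
    | seq h₁ h₂ =>
      obtain ⟨rfl, rfl⟩ := ih₁ h₁
      obtain ⟨rfl, rfl⟩ := ih₂ h₂
      exact ⟨rfl, rfl⟩
  | cond_true hle _ ih =>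
    cases h' with
    | cond_true _ h₁ =>
      obtain ⟨rfl, rfl⟩ := ih h₁
      exact ⟨rfl, rfl⟩
    | cond_false hle' _ => exact absurd hle hle'
  | cond_false hle _ ih =>
    cases h' with
    | cond_true hle' _ => exact absurd hle' hle
    | cond_false _ h₁ =>
      obtain ⟨rfl, rfl⟩ := ih h₁
      exact ⟨rfl, rfl⟩
  | loop_exit hle =>
    cases h' with
    | loop_exit _ => exact ⟨rfl, rfl⟩
    | loop_step hle' _ _ => exact absurd hle' hle
  | loop_step hle _ _ ih₁ ih₂ =>
    cases h' with
    | loop_exit hle' => exact absurd hle hle'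
    | loop_step _ h₁ h₂ =>
      obtain ⟨rfl, rfl⟩ := ih₁ h₁
      obtain ⟨rfl, rfl⟩ := ih₂ h₂
      exact ⟨rfl, rfl⟩

instance : IsProbabilityMeasure fairCoins := by
  unfold fairCoins
  infer_instance

/-- The bound holds for every sequence of random bits, so integrating it against a probability
measure changes nothing. -/
theorem expectedTime_le {p : Prog} {σ τ : State} {t : ℕ} (h : ∀ ω, Exec ω p σ τ t) :
    expectedTime p σ ≤ t := by
  calc expectedTime p σ ≤ ∫⁻ _, (t : ℝ≥0∞) ∂fairCoins :=
        lintegral_mono fun ω => iInf₂_le t ⟨τ, h ω⟩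
    _ = t := by rw [lintegral_const, measure_univ, mul_one]

/-! ### Input and output -/

theorem encode_getD {n : ℕ} (l : List (Fin n →₀ ℕ)) {r c : ℕ} (hr : r < l.length) (hc : c < n) :
    (encode l).getD (r * n + c) 0 = coord (l.getD r 0) c := by
  induction l generalizing r with
  | nil => simp at hr
  | cons μ l ih =>
    have e : encode (μ :: l) = List.ofFn (fun i => (μ i : ℤ)) ++ encode l := by simp [encode]
    rw [e]
    cases r with
    | zero =>
      rw [List.getD_append _ _ _ _ (by simpa using hc)]
      simp [coord, hc, List.getD_eq_getElem?_getD]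
    | succ r =>
      have h1 : (r + 1) * n + c - n = r * n + c := by
        rw [Nat.succ_mul]; omega
      rw [List.getD_append_right _ _ _ _ (by rw [List.length_ofFn, Nat.succ_mul]; omega),
        List.length_ofFn, h1, ih (by simpa using hr)]
      simp

/-- Extend a finite family of lists by empty lists. -/
def extendLists {n k : ℕ} (L : Fin k → List (Fin n →₀ ℕ)) (j : ℕ) : List (Fin n →₀ ℕ) :=
  if h : j < k then L ⟨j, h⟩ else []

theorem extendLists_fin {n k : ℕ} (L : Fin k → List (Fin n →₀ ℕ)) (i : Fin k) :
    extendLists L i = L i := by simp [extendLists]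

theorem flatten_getD {n : ℕ} (F : ℕ → List (Fin n →₀ ℕ)) {k i q : ℕ} (hi : i < k)
    (hq : q < (F i).length) :
    listOffset F i + q < ((List.range k).map F).flatten.length ∧
    ((List.range k).map F).flatten.getD (listOffset F i + q) 0 = (F i).getD q 0 := by
  have hlen : ∀ k, ((List.range k).map F).flatten.length = listOffset F k := by
    intro k
    induction k with
    | zero => simp [listOffset]
    | succ k ih =>
      rw [List.range_succ, List.map_append, List.flatten_append, List.length_append, ih,
        listOffset, listOffset, Finset.sum_range_succ]
      simp
  induction k with
  | zero => omega
  | succ k ih =>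
    have e : ((List.range (k + 1)).map F).flatten =
        ((List.range k).map F).flatten ++ F k := by
      simp [List.range_succ]
    rw [e, List.length_append]
    rcases Nat.lt_succ_iff_lt_or_eq.1 hi with h | rfl
    · obtain ⟨h1, h2⟩ := ih h
      exact ⟨by omega, by rw [List.getD_append _ _ _ _ h1, h2]⟩
    · rw [hlen, List.getD_append_right _ _ _ _ (by rw [hlen]; omega), hlen,
        Nat.add_sub_cancel_left]
      exact ⟨by omega, rfl⟩

theorem ofFn_eq_map_range {n k : ℕ} (L : Fin k → List (Fin n →₀ ℕ)) :
    List.ofFn L = (List.range k).map (extendLists L) := by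
  refine List.ext_getElem (by simp) fun j h1 h2 => ?_
  have hj : j < k := by simpa using h1
  simp [extendLists, hj]

/-- The environment in which the algorithm starts. -/
def inputEnv {n k : ℕ} (L : Fin k → List (Fin n →₀ ℕ)) : Env where
  reg x := (inputState L).reg x.idx
  arr := (inputState L).arr

theorem holdsInput_inputEnv {n k : ℕ} (L : Fin k → List (Fin n →₀ ℕ)) :
    HoldsInput (extendLists L) k (inputEnv L) where
  reg_n := by simp [inputEnv, inputState, Var.idx]
  reg_k := by simp [inputEnv, inputState, Var.idx]
  len i hi := by
    simp [inputEnv, inputState, extendLists, hi, List.getD_eq_getElem?_getD]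
  vec i hi q hq c hc := by
    obtain ⟨h1, h2⟩ := flatten_getD (extendLists L) hi hq
    have e : (inputEnv L).arr 1 ((listOffset (extendLists L) i + q) * n + c) =
        (encode (List.ofFn L).flatten).getD ((listOffset (extendLists L) i + q) * n + c) 0 := by
      simp [inputEnv, inputState]
    rw [e, ofFn_eq_map_range, encode_getD _ h1 hc, h2]

theorem isOutput_of_holdsList {n : ℕ} {s : TPoly n} {τ : State} {l : List (Fin n →₀ ℕ)}
    (hl : IsListing l s) (h0 : τ.reg 0 = l.length) (hA : HoldsList (τ.arr 0) l) :
    IsOutput τ s := by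
  refine ⟨l, hl, h0, fun j hj => ?_⟩
  have hn : 0 < n := Nat.pos_of_ne_zero fun h => by simp [h] at hj
  have hr : j / n < l.length := Nat.div_lt_of_lt_mul (by rwa [mul_comm])
  have e : j = j / n * n + j % n := (Nat.div_add_mod' j n).symm
  rw [e, hA _ hr _ (Nat.mod_lt _ hn), encode_getD _ hr (Nat.mod_lt _ hn)]

theorem length_le_of_isListing {m d : ℕ} {l : List (Fin (m + 1) →₀ ℕ)} {s : TPoly (m + 1)}
    (hl : IsListing l s) (hs : IsMinimalPoly s) (hd : s.totalDegree ≤ d) :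
    l.length ≤ (d + 1) ^ m ∧ (2 ≤ d → (l.length : ℝ) ≤ 16 * (2 * d / 3) ^ m) := by
  classical
  have e : l.length = s.support.card := by
    rw [← List.toFinset_card_of_nodup hl.1]
    congr 1
    ext μ
    rw [List.mem_toFinset, hl.mem_iff]
  have h1 : ∀ μ ∈ s.support, ∀ ν ∈ s.support, μ ≤ ν → μ = ν := by
    rw [hs]
    exact vertNPmin_antichain s
  have h2 : ∀ μ ∈ s.support, ∑ i, μ i ≤ d := fun μ hμ => coe_le_totalDegree hd hμ
  rw [e]
  exact ⟨antichain_card_le_pow h1 h2, fun h => antichain_card_le_sixteen h h1 h2⟩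

/-! ### The algorithm -/

/-- The algorithm for the product of minimal polynomials. -/
def productProg : Prog := mainCmd.compile 24

theorem productProg_spec {n k d U : ℕ} (hn : 1 ≤ n) (hk : 1 ≤ k) (hd : 1 ≤ d)
    {s : Fin k → TPoly n} {L : Fin k → List (Fin n →₀ ℕ)} (hs : ∀ i, (s i).totalDegree ≤ d)
    (hL : ∀ i, IsListing (L i) (s i)) (hU : ∀ i ≤ k, sumCount (extendLists L) i ≤ U) :
    ∃ (D t : ℕ) (τ : State), D ≤ k * d ∧ (∀ ω, Exec ω productProg (inputState L) τ t) ∧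
      τ.used = 0 ∧ IsOutput τ (minPoly (∏ i, s i)) ∧
      t ≤ 20000 * (U ^ 2 * n * iterCount n D + (k + 1) * U * iterCount n D ^ 2) := by
  set s₀ := inputEnv L
  set F := extendLists L
  set S : ℕ → TPoly n := fun j => if h : j < k then s ⟨j, h⟩ else 1 with hS
  have hprod : ∏ i ∈ Finset.range k, S i = ∏ i, s i := by
    rw [Finset.prod_range]
    exact Finset.prod_congr rfl fun i _ => by simp [hS]
  have hin : HoldsInput F k s₀ := holdsInput_inputEnv L
  have hoff : s₀.reg .off = 0 := by simp [s₀, inputEnv, inputState, Var.idx]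
  have h2 : ∀ z, s₀.arr 2 z = 0 := fun z => by simp [s₀, inputEnv, inputState]
  have hsupp : ∀ μ, (∃ p < sumCount F k, sumPts F k p = μ) ↔ μ ∈ (∏ i, s i).support := by
    rw [← hprod]
    refine exists_sumPts_iff F S k fun i hi μ => ?_
    have e1 : F i = L ⟨i, hi⟩ := extendLists_fin L ⟨i, hi⟩
    have e2 : S i = s ⟨i, hi⟩ := by simp [hS, hi]
    rw [e1, e2, (hL _).mem_iff]
  have hdeg : (∏ i, s i).totalDegree ≤ k * d := by
    refine (MvPolynomial.totalDegree_finsetProd _ _).trans ?_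
    refine (Finset.sum_le_card_nsmul _ _ d fun i _ => hs i).trans ?_
    simp
  have hsum := sumset_spec hin hoff h2
  obtain ⟨D, hr, hD, hD1, hle, hub⟩ := params_spec hsum.input.reg_n hsum.cnt hsum.rows
  -- Every exponent in the product is at most its total degree, and the computed `D` is the least
  -- bound.
  have hDk : D ≤ k * d := hub _ (Nat.mul_pos hk hd) fun p hp i =>
    (Finset.single_le_sum (f := fun i => sumPts F k p i) (fun _ _ => Nat.zero_le _)
      (Finset.mem_univ i)).trans (coe_le_totalDegree hdeg ((hsupp _).1 ⟨p, hp, rfl⟩))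
  have hmark := markVertices_spec hn hD1 hle hr
  have hr' : Ready (sumPts F k) (sumCount F k) D (markVertices.eval (params.eval (sumset.eval s₀))) :=
    hr.frame (markVertices.frame _) (by decide) (by decide) (by decide) (by decide) (by decide)
      (by decide)
  obtain ⟨ho, hA⟩ := emitAll_spec hr' hmark
  -- The variables occupy the registers below `24`, so scratch space starts there.
  obtain ⟨τ, hex, hsim⟩ := mainCmd.compile_runs 24 (inputState L) s₀ le_rfl ⟨fun _ => rfl, rfl⟩
  refine ⟨D, _, τ, hDk, hex, hsim.used, ?_, mainCmd_cost_le hn hin hoff h2 hU hr hD⟩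
  refine isOutput_of_holdsList (isListing_minPoly _ _ (nodup_keptList _ _)
    (mem_keptList_iff hsupp)) ?_ ?_
  · rw [← ho]
    exact hsim.agree.1 .n
  · rw [hsim.agree.2]
    exact hA

theorem sumCount_le {n k M : ℕ} {L : Fin k → List (Fin n →₀ ℕ)} (hL : ∀ i, (L i).length ≤ M)
    (hM : 1 ≤ M) {i : ℕ} (hi : i ≤ k) : sumCount (extendLists L) i ≤ M ^ k := by
  calc sumCount (extendLists L) i ≤ ∏ _j ∈ Finset.range i, M :=
        Finset.prod_le_prod' fun j hj => by
          have : j < k := (Finset.mem_range.1 hj).trans_le hi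
          rw [show extendLists L j = L ⟨j, this⟩ from extendLists_fin L ⟨j, this⟩]
          exact hL _
    _ = M ^ i := by simp
    _ ≤ M ^ k := Nat.pow_le_pow_right hM hi

theorem exists_cost_of_le : ∃ C : ℕ, ∀ (n k d : ℕ) (s : Fin k → TPoly n)
    (L : Fin k → List (Fin n →₀ ℕ)), 1 ≤ n → 2 ≤ k → 2 ≤ d → (∀ i, IsMinimalPoly (s i)) →
    (∀ i, (s i).totalDegree ≤ d) → (∀ i, IsListing (L i) (s i)) → n ≤ k →
    ∃ (τ : State) (t : ℕ), (∀ ω, Exec ω productProg (inputState L) τ t) ∧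
      IsOutput τ (minPoly (∏ i, s i)) ∧ t ≤ C * (n * d ^ (k * (2 * n - 1) * max 2 n)) := by
  obtain ⟨C, hC⟩ := exists_time_le_of_le
  refine ⟨20000 * C, fun n k d s L hn hk hd hmin hdeg hL hnk => ?_⟩
  obtain ⟨p, rfl⟩ : ∃ p, n = p + 1 := ⟨n - 1, by omega⟩
  obtain ⟨D, t, τ, hD, hex, -, hout, ht⟩ := productProg_spec hn (by omega) (by omega) hdeg hL
    fun i hi => sumCount_le (fun i => (length_le_of_isListing (hL i) (hmin i) (hdeg i)).1)
      (Nat.one_le_pow _ _ (Nat.succ_pos d)) hi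
  refine ⟨τ, t, hex, hout, ht.trans ?_⟩
  rw [mul_assoc 20000 C]
  exact Nat.mul_le_mul_left _ (hC p k d D _ hnk hk hd hD (by rw [pow_mul]))

theorem exists_cost_of_lt : ∃ C : ℕ, ∀ (n k d : ℕ) (s : Fin k → TPoly n)
    (L : Fin k → List (Fin n →₀ ℕ)), 1 ≤ n → 2 ≤ k → 2 ≤ d → (∀ i, IsMinimalPoly (s i)) →
    (∀ i, (s i).totalDegree ≤ d) → (∀ i, IsListing (L i) (s i)) → k < n →
    ∃ (τ : State) (t : ℕ), (∀ ω, Exec ω productProg (inputState L) τ t) ∧ τ.used = 0 ∧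
      IsOutput τ (minPoly (∏ i, s i)) ∧ t ≤ C * ((1 + k) * d ^ (k * (2 * n - 1))) := by
  obtain ⟨C, hC⟩ := exists_time_le_of_lt
  refine ⟨20000 * C, fun n k d s L hn hk hd hmin hdeg hL hkn => ?_⟩
  obtain ⟨p, rfl⟩ : ∃ p, n = p + 1 := ⟨n - 1, by omega⟩
  have hd' : (2 : ℝ) ≤ d := by exact_mod_cast hd
  -- List lengths are integers, so the real bound may be rounded down. It is at least `1`, so that
  -- partial products are bounded by the `k`-th power too.
  set M : ℕ := ⌊(16 * (2 * d / 3) ^ p : ℝ)⌋₊ with hM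
  have hM1 : 1 ≤ M := by
    rw [hM, Nat.one_le_floor_iff]
    have : (1 : ℝ) ≤ (2 * d / 3) ^ p := one_le_pow₀ (by linarith)
    linarith
  have hMle : (M : ℝ) ≤ 16 * (2 * d / 3) ^ p := Nat.floor_le (by positivity)
  obtain ⟨D, t, τ, hD, hex, hused, hout, ht⟩ := productProg_spec hn (by omega) (by omega) hdeg hL
    fun i hi => sumCount_le (M := M) (fun i => Nat.le_floor
      ((length_le_of_isListing (hL i) (hmin i) (hdeg i)).2 hd)) hM1 hi
  refine ⟨τ, t, hex, hused, hout, ht.trans ?_⟩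
  rw [mul_assoc 20000 C]
  refine Nat.mul_le_mul_left _ (hC p k d D _ hkn hk hd hD ?_)
  rw [Nat.cast_pow]
  exact pow_le_pow_left₀ (Nat.cast_nonneg _) hMle k

end TropVN

/-! ### Assembly of both ranges and of the monomial bound -/

theorem mainTheorem7 :
    (∃ (VN : TropVN.Prog) (C : ℕ),
      ∀ (n k d : ℕ) (s : Fin k → TropVN.TPoly n) (L : Fin k → List (Fin n →₀ ℕ)),
        1 ≤ n → 2 ≤ k → 2 ≤ d →
        (∀ i, TropVN.IsMinimalPoly (s i)) →
        (∀ i, (s i).totalDegree ≤ d) →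
        (∀ i, TropVN.IsListing (L i) (s i)) →
        (n ≤ k →
          (∀ (ω : ℕ → Bool) (τ : TropVN.State) (t : ℕ),
            TropVN.Exec ω VN (TropVN.inputState L) τ t →
              TropVN.IsOutput τ (TropVN.minPoly (∏ i, s i))) ∧
          TropVN.expectedTime VN (TropVN.inputState L) ≤
            ((C * (n * d ^ (k * (2 * n - 1) * max 2 n)) : ℕ) : ENNReal)) ∧
        (k < n →
          ∃ (τ : TropVN.State) (t : ℕ),
            (∀ ω : ℕ → Bool, TropVN.Exec ω VN (TropVN.inputState L) τ t) ∧
            τ.used = 0 ∧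
            TropVN.IsOutput τ (TropVN.minPoly (∏ i, s i)) ∧
            t ≤ C * ((1 + k) * d ^ (k * (2 * n - 1))))) ∧
    (∃ C : ℕ,
      ∀ (n k d : ℕ) (s : Fin k → TropVN.TPoly n),
        1 ≤ n → 2 ≤ k → 1 ≤ d →
        (∀ i, TropVN.IsMinimalPoly (s i)) →
        (∀ i, (s i).totalDegree ≤ d) →
        (TropVN.minPoly (∏ i, s i)).support.card ≤ C * (k * d) ^ (2 * n - 1)) := by
  obtain ⟨C₁, h₁⟩ := TropVN.exists_cost_of_le
  obtain ⟨C₂, h₂⟩ := TropVN.exists_cost_of_lt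
  refine ⟨⟨TropVN.productProg, max C₁ C₂, fun n k d s L hn hk hd hmin hdeg hL =>
    ⟨fun hnk => ?_, fun hkn => ?_⟩⟩, 1, fun n k d s hn hk hd _ hdeg => ?_⟩
  · obtain ⟨τ, t, hex, hout, ht⟩ := h₁ n k d s L hn hk hd hmin hdeg hL hnk
    -- Correctness is claimed for whatever state a run halts in; uniqueness identifies it with the
    -- constructed one.
    refine ⟨fun ω τ' t' h' => ((hex ω).unique h').1 ▸ hout, ?_⟩
    refine (TropVN.expectedTime_le hex).trans (Nat.cast_le.2 (ht.trans ?_))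
    exact Nat.mul_le_mul_right _ (le_max_left _ _)
  · obtain ⟨τ, t, hex, hused, hout, ht⟩ := h₂ n k d s L hn hk hd hmin hdeg hL hkn
    exact ⟨τ, t, hex, hused, hout, ht.trans (Nat.mul_le_mul_right _ (le_max_right _ _))⟩
  · rw [one_mul]
    exact TropVN.card_support_minPoly_prod_le n k d s hn hk hd hdeg
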